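/- Let $\alpha,\beta\in\mathbb{C}\setminus\{-1,-2,-3,\dots\}$ with $\alpha\neq 0$, $\beta\neq 0$ and $\alpha+\beta\notin\{-2,-3,-4,\dots\}$, and let $n\ge 1$ be an integer. **Finite part.** For $g$ analytic on a disk $|t|\le x$ ($x>0$) with Taylor series $g(t)=\sum_k g_kt^k$, the Hadamard finite part of $\int_0^x t^\alpha g(t)\,dt$ is $x^{\alpha+1}\sum_{k\ge0}\frac{g_k}{k+\alpha+1}x^k$. For $f$ analytic on $[0,1]$, the finite part of $\int_0^1t^\alpha(1-t)^\beta f(t)\,dt$ is the sum of the finite part of $\int_0^{\xi_0}t^\alpha\,[(1-t)^\beta f(t)]\,dt$, the ordinary integral $\int_{\xi_0}^{\xi_1}t^\alpha(1-t)^\beta f(t)\,dt$, and the finite part of $\int_0^{1-\xi_1}s^\beta\,[(1-s)^\alpha f(1-s)]\,ds$, where $0<\xi_0\le\xi_1<1$ are any numbers such that $f$ is analytic for $|z|\le\xi_0$ and for $|1-z|\le 1-\xi_1$ (the result does not depend on them). For a polynomial $p$ and $z\in\mathbb{C}\setminus[0,1]$ let $\mathcal{C}_{\alpha,\beta}[p](z)$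 be $\frac1{2\pi i}$ times the finite part of $\int_0^1\frac{t^\alpha(1-t)^\beta p(t)}{t-z}\,dt$. **Jacobi polynomials.** For $m\ge0$ let $P_m^{(\alpha,\beta)}$ be the polynomial with $P_m^{(\alpha,\beta)}(x)=w(x)^{-1}\frac{d^m}{dx^m}\left[(x-x^2)^mw(x)\right]$ on $(0,1)$, where $w(x)=x^\alpha(1-x)^\beta$; let $C_m=(-1)^m\prod_{k=1}^m(k+m+\alpha+\beta)$ and $\pi_m=C_m^{-1}P_m^{(\alpha,\beta)}$ (the monic Jacobi polynomial). Let $B(r,s)=\Gamma(r)\Gamma(s)/\Gamma(r+s)$ and $$c_n=(-1)^n\,2\pi i\,C_{n-1}\left[(n-1)!\,B(\alpha+n,\beta+n)\right]^{-1}.$$ **Riemann–Hilbert problem.** Find $Y:\mathbb{C}\setminus[0,1]\to\mathcal{M}_2(\mathbb{C})$ such that (I) $Y$ is analytic on $\mathbb{C}\setminus[0,1]$ and for every $x\in(0,1)$ the limits $Y^{+}(x)=\lim_{z\to x,\ \operatorname{Im}z>0}Y(z)$ and $Y^{-}(x)=\lim_{z\to x,\ \operatorname{Im}z<0}Y(z)$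 exist; (II) $Y^+(x)=Y^-(x)\begin{pmatrix}1&x^\alpha(1-x)^\beta\\0&1\end{pmatrix}$ for $x\in(0,1)$; (III$_\infty$) $Y(z)=\left(I+O(z^{-1})\right)\begin{pmatrix}z^n&0\\0&z^{-n}\end{pmatrix}$ as $z\to\infty$; (III$_0$) as $z\to0$, $Y_{j1}(z)=O(1)$ and $Y_{j2}(z)=z^\alpha h_j(z)+O(1)$ for some $h_j$ analytic at $0$ ($j=1,2$), where $z^\alpha$ is taken with $0<\arg z<2\pi$; (III$_1$) as $z\to1$, $Y_{j1}(z)=O(1)$ and $Y_{j2}(z)=(z-1)^\beta k_j(z)+O(1)$ for some $k_j$ analytic at $1$ ($j=1,2$), where $(z-1)^\beta$ is taken with $-\pi<\arg(z-1)<\pi$. This problem has exactly one solution, namely $$Y=\begin{pmatrix}\pi_n&\mathcal{C}_{\alpha,\beta}[\pi_n]\\ c_n\pi_{n-1}&c_n\,\mathcal{C}_{\alpha,\beta}[\pi_{n-1}]\end{pmatrix}.$$ -/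

import Mathlib

open Filter Topology Asymptotics

noncomputable section

namespace JacobiRH

/-! ### The finite part of a (possibly divergent) integral -/

/-- The `n`-th Taylor coefficient at `0` of `g`. -/
def taylorCoeff (g : ℂ → ℂ) (n : ℕ) : ℂ := ((n.factorial : ℂ))⁻¹ * iteratedDeriv n g 0

/-- The Hadamard finite part of `∫_0^x t^α g(t) dt`, for `g` analytic on the closed disk of
radius `x > 0` around `0`: integrate `t^α ∑ g_n t^n` term by term, to get
`x^(α+1) ∑ g_n x^n / (n + α + 1)`. -/
def finitePartZero (α : ℂ) (g : ℂ → ℂ) (x : ℝ) : ℂ :=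
  (x : ℂ) ^ (α + 1) * ∑' n : ℕ, taylorCoeff g n / ((n : ℂ) + α + 1) * (x : ℂ) ^ n

/-- Splitting points `0 < a ≤ b < 1` such that `f` is analytic on the disks `|z| ≤ a` and
`|1 - z| ≤ 1 - b`. -/
def IsSplitting (f : ℂ → ℂ) (a b : ℝ) : Prop :=
  0 < a ∧ a ≤ b ∧ b < 1 ∧ AnalyticOnNhd ℂ f (Metric.closedBall 0 a) ∧
    AnalyticOnNhd ℂ f (Metric.closedBall 1 (1 - b))

/-- The finite part of `∫_0^1 t^α (1-t)^β f(t) dt` computed with the splitting points `a ≤ b`: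
a finite part from `0` to `a`, an ordinary integral from `a` to `b`, and a finite part from `b`
to `1`, the latter through the change of variable `t = 1 - s`. -/
def splitFinitePart (α β : ℂ) (f : ℂ → ℂ) (a b : ℝ) : ℂ :=
  finitePartZero α (fun t => (1 - t) ^ β * f t) a
    + (∫ t in a..b, (t : ℂ) ^ α * (1 - (t : ℂ)) ^ β * f (t : ℂ))
    + finitePartZero β (fun s => (1 - s) ^ α * f (1 - s)) (1 - b)

open scoped Classical in
/-- The Hadamard finite part of `∫_0^1 t^α (1-t)^β f(t) dt`, for `f` analytic on `[0,1]`. By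
`finitePart_eq` below it may be computed with any splitting points. -/
def finitePart (α β : ℂ) (f : ℂ → ℂ) : ℂ :=
  if h : ∃ ab : ℝ × ℝ, IsSplitting f ab.1 ab.2 then
    splitFinitePart α β f h.choose.1 h.choose.2
  else 0

/-- Additivity: the finite part from `0` to `b` is the finite part from `0` to `a` plus the
integral from `a` to `b`. -/
theorem finitePartZero_add (α : ℂ) (hα : ∀ k : ℕ, α ≠ -((k : ℂ) + 1)) (g : ℂ → ℂ) (R a b : ℝ)
    (hg : DifferentiableOn ℂ g (Metric.ball 0 R)) (ha : 0 < a) (haR : a < R) (hb : 0 < b)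
    (hbR : b < R) :
    finitePartZero α g a + (∫ t in a..b, (t : ℂ) ^ α * g (t : ℂ)) = finitePartZero α g b := by
  have hT : ∀ x : ℝ, 0 < x → x < R →
      HasSum (fun n : ℕ => taylorCoeff g n * (x : ℂ) ^ n) (g x) := by
    intro x hx hxR
    have h := Complex.hasSum_taylorSeries_on_ball hg (z := (x : ℂ))
      (by simpa [abs_of_pos hx] using hxR)
    refine h.congr_fun fun n => ?_
    simp [taylorCoeff, smul_eq_mul]
    ring
  have hne : ∀ n : ℕ, (n : ℂ) + α + 1 ≠ 0 := by
    intro n h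
    exact hα n (by linear_combination h)
  have hbd : ∀ᶠ n : ℕ in atTop, ‖((n : ℂ) + α + 1)⁻¹‖ ≤ 1 := by
    filter_upwards [eventually_ge_atTop (⌈‖α + 1‖ + 1⌉₊)] with n hn
    have h1 : ‖α + 1‖ + 1 ≤ n := Nat.ceil_le.mp hn
    have h2 : ‖(n : ℂ)‖ - ‖α + 1‖ ≤ ‖(n : ℂ) + (α + 1)‖ := by
      have := norm_sub_norm_le (n : ℂ) (-(α + 1))
      rwa [sub_neg_eq_add, norm_neg] at this
    rw [Complex.norm_natCast] at h2
    rw [norm_inv]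
    apply inv_le_one_of_one_le₀
    rw [add_assoc]
    linarith
  have hS : ∀ x : ℝ, 0 < x → x < R →
      Summable (fun n : ℕ => taylorCoeff g n / ((n : ℂ) + α + 1) * (x : ℂ) ^ n) := by
    intro x hx hxR
    refine Summable.of_norm_bounded_eventually_nat (hT x hx hxR).summable.norm ?_
    filter_upwards [hbd] with n hn
    rw [div_eq_mul_inv, mul_right_comm, norm_mul]
    exact mul_le_of_le_one_right (norm_nonneg _) hn
  have h0 : (0 : ℝ) ∉ Set.uIcc a b := by
    rw [Set.mem_uIcc]; rintro (h | h) <;> linarith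
  have hint : ∀ n : ℕ, (∫ t in a..b, (t : ℂ) ^ α * (taylorCoeff g n * (t : ℂ) ^ n))
      = taylorCoeff g n / ((n : ℂ) + α + 1) * ((b : ℂ) ^ (α + 1) * (b : ℂ) ^ n
        - (a : ℂ) ^ (α + 1) * (a : ℂ) ^ n) := by
    intro n
    have e1 : ∀ t ∈ Set.uIcc a b, (t : ℂ) ^ α * (taylorCoeff g n * (t : ℂ) ^ n)
        = taylorCoeff g n * (t : ℂ) ^ (α + n) := by
      intro t ht
      have ht0 : (t : ℂ) ≠ 0 := by
        intro h
        rw [Complex.ofReal_eq_zero] at h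
        exact h0 (h ▸ ht)
      rw [Complex.cpow_add _ _ ht0, Complex.cpow_natCast]; ring
    rw [intervalIntegral.integral_congr e1, intervalIntegral.integral_const_mul, integral_cpow]
    · have hb0 : (b : ℂ) ≠ 0 := by exact_mod_cast hb.ne'
      have ha0 : (a : ℂ) ≠ 0 := by exact_mod_cast ha.ne'
      have e : α + n + 1 = (α + 1) + n := by ring
      rw [e, Complex.cpow_add _ _ hb0, Complex.cpow_add _ _ ha0, Complex.cpow_natCast,
        Complex.cpow_natCast]
      have e' : (n : ℂ) + α + 1 = α + 1 + n := by ring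
      rw [e']; ring
    · right
      exact ⟨fun h => hα n (by linear_combination h), h0⟩
  have hsum : HasSum (fun n : ℕ => ∫ t in a..b, (t : ℂ) ^ α * (taylorCoeff g n * (t : ℂ) ^ n))
      (∫ t in a..b, (t : ℂ) ^ α * g (t : ℂ)) := by
    set M : ℝ := max a b with hM
    have hM0 : 0 < M := lt_max_of_lt_left ha
    have hMR : M < R := max_lt haR hbR
    have hcont : ContinuousOn (fun t : ℝ => (t : ℂ) ^ α) (Set.uIcc a b) := by
      intro t ht
      apply ContinuousAt.continuousWithinAt
      apply Complex.continuousAt_ofReal_cpow_const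
      right; rintro rfl; exact h0 ht
    obtain ⟨K, hK⟩ := isCompact_uIcc.exists_bound_of_continuousOn hcont
    have hmem : ∀ t ∈ Set.uIoc a b, t ∈ Set.uIcc a b := fun t ht => Set.uIoc_subset_uIcc ht
    have hpos : ∀ t ∈ Set.uIcc a b, 0 < t ∧ t ≤ M := by
      intro t ht
      rw [Set.uIcc, Set.mem_Icc] at ht
      exact ⟨lt_of_lt_of_le (lt_min ha hb) ht.1, ht.2⟩
    refine intervalIntegral.hasSum_integral_of_dominated_convergence
      (fun n _ => K * ‖taylorCoeff g n * (M : ℂ) ^ n‖) ?_ ?_ ?_ ?_ ?_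
    · intro n
      apply ContinuousOn.aestronglyMeasurable _ measurableSet_uIoc
      apply ContinuousOn.mul (hcont.mono Set.uIoc_subset_uIcc)
      fun_prop
    · intro n
      refine Eventually.of_forall fun t ht => ?_
      rw [norm_mul]
      have h1 := hpos t (hmem t ht)
      apply mul_le_mul (hK t (hmem t ht)) _ (norm_nonneg _)
        ((norm_nonneg _).trans (hK t (hmem t ht)))
      rw [norm_mul, norm_mul]
      gcongr
      rw [norm_pow, norm_pow, Complex.norm_real, Complex.norm_real, Real.norm_of_nonneg h1.1.le,
        Real.norm_of_nonneg hM0.le]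
      exact pow_le_pow_left₀ h1.1.le h1.2 n
    · exact Eventually.of_forall fun t _ => ((hT M hM0 hMR).summable.norm.mul_left K)
    · simp
    · refine Eventually.of_forall fun t ht => ?_
      have h1 := hpos t (hmem t ht)
      exact (hT t h1.1 (h1.2.trans_lt hMR)).mul_left _
  have hsum2 : HasSum (fun n : ℕ => ∫ t in a..b, (t : ℂ) ^ α * (taylorCoeff g n * (t : ℂ) ^ n))
      (finitePartZero α g b - finitePartZero α g a) := by
    have h1 := ((hS b hb hbR).hasSum.mul_left ((b : ℂ) ^ (α + 1))).sub
      ((hS a ha haR).hasSum.mul_left ((a : ℂ) ^ (α + 1)))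
    refine h1.congr_fun fun n => ?_
    rw [hint]; ring
  rw [hsum.unique hsum2]; ring

theorem differentiableOn_one_sub_cpow_mul (β : ℂ) (f : ℂ → ℂ) (a : ℝ) (ha1 : a < 1)
    (hf : AnalyticOnNhd ℂ f (Metric.closedBall 0 a)) (ha : 0 < a) :
    ∃ R, a < R ∧ DifferentiableOn ℂ (fun t => (1 - t) ^ β * f t) (Metric.ball 0 R) := by
  obtain ⟨δ, hδ, hsub⟩ := (isCompact_closedBall (0 : ℂ) a).exists_cthickening_subset_open
    (isOpen_analyticAt ℂ f) hf
  rw [cthickening_closedBall hδ.le ha.le] at hsub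
  refine ⟨min (δ + a) 1, lt_min (by linarith) ha1, ?_⟩
  intro t ht
  rw [mem_ball_zero_iff, lt_min_iff] at ht
  apply DifferentiableAt.differentiableWithinAt
  apply DifferentiableAt.mul
  · apply DifferentiableAt.cpow_const
    · fun_prop
    · left
      have := (Complex.abs_re_le_norm t).trans_lt ht.2
      have := (abs_lt.mp this).2
      simp only [Complex.sub_re, Complex.one_re]
      linarith
  · have : t ∈ {x | AnalyticAt ℂ f x} := hsub (by simpa using ht.1.le)
    exact AnalyticAt.differentiableAt this

theorem finitePartZero_one_sub_add (α β : ℂ) (hα : ∀ k : ℕ, α ≠ -((k : ℂ) + 1)) (f : ℂ → ℂ)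
    (a b : ℝ) (ha : 0 < a) (ha1 : a < 1) (hfa : AnalyticOnNhd ℂ f (Metric.closedBall 0 a))
    (hb : 0 < b) (hb1 : b < 1) (hfb : AnalyticOnNhd ℂ f (Metric.closedBall 0 b)) :
    finitePartZero α (fun t => (1 - t) ^ β * f t) a
      + (∫ t in a..b, (t : ℂ) ^ α * (1 - (t : ℂ)) ^ β * f (t : ℂ))
      = finitePartZero α (fun t => (1 - t) ^ β * f t) b := by
  obtain ⟨R, hR, hd⟩ : ∃ R, max a b < R ∧
      DifferentiableOn ℂ (fun t => (1 - t) ^ β * f t) (Metric.ball 0 R) := by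
    apply differentiableOn_one_sub_cpow_mul
    · exact max_lt ha1 hb1
    · rcases max_cases a b with h | h <;> rw [h.1] <;> assumption
    · exact lt_max_of_lt_left ha
  rw [← finitePartZero_add α hα _ R a b hd ha ((le_max_left _ _).trans_lt hR) hb
    ((le_max_right _ _).trans_lt hR)]
  simp only [mul_assoc]

/-- The value of the finite part does not depend on the splitting points. -/
theorem splitFinitePart_eq (α β : ℂ) (hα : ∀ k : ℕ, α ≠ -((k : ℂ) + 1))
    (hβ : ∀ k : ℕ, β ≠ -((k : ℂ) + 1)) (f : ℂ → ℂ)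
    (hf : ∀ t ∈ Set.Icc (0 : ℝ) 1, AnalyticAt ℂ f (t : ℂ)) (a b a' b' : ℝ)
    (h : IsSplitting f a b) (h' : IsSplitting f a' b') :
    splitFinitePart α β f a b = splitFinitePart α β f a' b' := by
  obtain ⟨ha, hab, hb, hfa, hfb⟩ := h
  obtain ⟨ha', hab', hb', hfa', hfb'⟩ := h'
  have hrefl : ∀ c : ℝ, AnalyticOnNhd ℂ f (Metric.closedBall 1 (1 - c)) →
      AnalyticOnNhd ℂ (fun s => f (1 - s)) (Metric.closedBall 0 (1 - c)) := by
    intro c hc s hs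
    have h1 : AnalyticAt ℂ f (1 - s) := hc (1 - s) (by simpa using hs)
    exact AnalyticAt.fun_comp (f := fun s : ℂ => 1 - s) h1 (by fun_prop)
  have e0 := finitePartZero_one_sub_add α β hα f a a' ha (by linarith) hfa ha' (by linarith) hfa'
  have e1 := finitePartZero_one_sub_add β α hβ (fun s => f (1 - s)) (1 - b) (1 - b')
    (by linarith) (by linarith) (hrefl b hfb) (by linarith) (by linarith) (hrefl b' hfb')
  have e2 : (∫ t in (1 - b)..(1 - b'), (t : ℂ) ^ β * (1 - (t : ℂ)) ^ α * f (1 - (t : ℂ)))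
      = ∫ t in b'..b, (t : ℂ) ^ α * (1 - (t : ℂ)) ^ β * f (t : ℂ) := by
    have := intervalIntegral.integral_comp_sub_left (a := 1 - b) (b := 1 - b')
      (fun t : ℝ => (t : ℂ) ^ α * (1 - (t : ℂ)) ^ β * f (t : ℂ)) 1
    simp only [sub_sub_cancel, Complex.ofReal_sub, Complex.ofReal_one] at this
    rw [← this]
    congr 1; funext t; ring
  have hc : ContinuousOn (fun t : ℝ => (t : ℂ) ^ α * (1 - (t : ℂ)) ^ β * f (t : ℂ))
      (Set.Ioo 0 1) := by
    intro t ht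
    apply ContinuousAt.continuousWithinAt
    apply ContinuousAt.mul
    · apply ContinuousAt.mul
      · exact Complex.continuousAt_ofReal_cpow_const _ _ (Or.inr ht.1.ne')
      · apply ContinuousAt.cpow (by fun_prop) continuousAt_const
        left; simpa using ht.2
    · exact (hf t (Set.Ioo_subset_Icc_self ht)).continuousAt.comp
        Complex.continuous_ofReal.continuousAt
  have hi : ∀ x y : ℝ, 0 < x → x < 1 → 0 < y → y < 1 → IntervalIntegrable
      (fun t : ℝ => (t : ℂ) ^ α * (1 - (t : ℂ)) ^ β * f (t : ℂ)) MeasureTheory.volume x y := by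
    intro x y hx hx1 hy hy1
    apply ContinuousOn.intervalIntegrable
    apply hc.mono
    intro t ht
    exact ⟨lt_of_lt_of_le (lt_min hx hy) ht.1, lt_of_le_of_lt ht.2 (max_lt hx1 hy1)⟩
  have e3 := intervalIntegral.integral_add_adjacent_intervals
    (hi a a' ha (by linarith) ha' (by linarith)) (hi a' b' ha' (by linarith) (by linarith) hb')
  have e4 := intervalIntegral.integral_add_adjacent_intervals
    (hi a b' ha (by linarith) (by linarith) hb') (hi b' b (by linarith) hb' (by linarith) hb)
  rw [e2] at e1
  unfold splitFinitePart
  linear_combination e0 - e3 - e4 + e1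

/-- The finite part may be computed with any splitting points. -/
theorem finitePart_eq (α β : ℂ) (hα : ∀ k : ℕ, α ≠ -((k : ℂ) + 1))
    (hβ : ∀ k : ℕ, β ≠ -((k : ℂ) + 1)) (f : ℂ → ℂ)
    (hf : ∀ t ∈ Set.Icc (0 : ℝ) 1, AnalyticAt ℂ f (t : ℂ)) (a b : ℝ) (h : IsSplitting f a b) :
    finitePart α β f = splitFinitePart α β f a b := by
  have hex : ∃ ab : ℝ × ℝ, IsSplitting f ab.1 ab.2 := ⟨(a, b), h⟩
  rw [finitePart, dif_pos hex]
  exact splitFinitePart_eq α β hα hβ f hf _ _ _ _ hex.choose_spec h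

/-- Splitting points exist for every function analytic on `[0,1]`. -/
theorem exists_isSplitting (f : ℂ → ℂ)
    (hf : ∀ t ∈ Set.Icc (0 : ℝ) 1, AnalyticAt ℂ f (t : ℂ)) : ∃ a b, IsSplitting f a b := by
  have h0 : AnalyticAt ℂ f 0 := by simpa using hf 0 (by simp)
  have h1 : AnalyticAt ℂ f 1 := by simpa using hf 1 (by simp)
  obtain ⟨r, hr, hr'⟩ := Metric.isOpen_iff.mp (isOpen_analyticAt ℂ f) 0 h0
  obtain ⟨s, hs, hs'⟩ := Metric.isOpen_iff.mp (isOpen_analyticAt ℂ f) 1 h1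
  refine ⟨min (r / 2) (1 / 2), 1 - min (s / 2) (1 / 2), by positivity, ?_, ?_, ?_, ?_⟩
  · have := min_le_right (r / 2) (1 / 2)
    have := min_le_right (s / 2) (1 / 2)
    linarith
  · have : 0 < min (s / 2) (1 / 2) := by positivity
    linarith
  · intro z hz
    refine hr' (Metric.closedBall_subset_ball ?_ hz)
    have := min_le_left (r / 2) (1 / 2)
    linarith
  · intro z hz
    refine hs' (Metric.closedBall_subset_ball ?_ hz)
    have := min_le_left (s / 2) (1 / 2)
    linarith

/-- The operator `C_{α,β}[p](z)`: the finite-part Cauchy transform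
`(2πi)⁻¹ ∫_0^1 t^α (1-t)^β p(t) / (t - z) dt`. -/
def cauchyTransform (α β : ℂ) (p : Polynomial ℂ) (z : ℂ) : ℂ :=
  (2 * (Real.pi : ℂ) * Complex.I)⁻¹ * finitePart α β (fun t => p.eval t / (t - z))

/-! ### Jacobi polynomials on `[0,1]` -/

/-- The weight `x^α (1-x)^β` with the usual branches, for `0 < x < 1`. -/
def weight (α β : ℂ) (x : ℝ) : ℂ := (x : ℂ) ^ α * (1 - (x : ℂ)) ^ β

/-- Rodrigues' formula `P(x) = w(x)⁻¹ dⁿ/dxⁿ [(x - x²)ⁿ w(x)]` on `(0,1)`, with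
`w(x) = x^α (1-x)^β`. -/
def IsRodrigues (α β : ℂ) (n : ℕ) (P : Polynomial ℂ) : Prop :=
  ∀ x ∈ Set.Ioo (0 : ℝ) 1, P.eval (x : ℂ)
    = (weight α β x)⁻¹ *
      iteratedDeriv n (fun t : ℝ => ((t : ℂ) - (t : ℂ) ^ 2) ^ n * weight α β t) x

theorem weight_ne_zero (α β : ℂ) {x : ℝ} (hx : x ∈ Set.Ioo (0 : ℝ) 1) : weight α β x ≠ 0 := by
  have h1 : (x : ℂ) ≠ 0 := by exact_mod_cast hx.1.ne'
  have h2 : (1 : ℂ) - x ≠ 0 := by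
    rw [sub_ne_zero]; exact_mod_cast hx.2.ne'
  unfold weight
  simp [Complex.cpow_eq_zero_iff, h1, h2]

theorem weight_add_one (α β : ℂ) {x : ℝ} (hx : x ∈ Set.Ioo (0 : ℝ) 1) :
    weight (α + 1) (β + 1) x = ((x : ℂ) - (x : ℂ) ^ 2) * weight α β x := by
  have h1 : (x : ℂ) ≠ 0 := by exact_mod_cast hx.1.ne'
  have h2 : (1 : ℂ) - x ≠ 0 := by
    rw [sub_ne_zero]; exact_mod_cast hx.2.ne'
  unfold weight
  rw [Complex.cpow_add _ _ h1, Complex.cpow_add _ _ h2, Complex.cpow_one, Complex.cpow_one]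
  ring

theorem hasDerivAt_weight (α β : ℂ) {x : ℝ} (hx : x ∈ Set.Ioo (0 : ℝ) 1) :
    HasDerivAt (weight (α + 1) (β + 1))
      (((α + 1) * (1 - (x : ℂ)) - (β + 1) * x) * weight α β x) x := by
  have h1 : (x : ℂ) ≠ 0 := by exact_mod_cast hx.1.ne'
  have h2 : (1 : ℂ) - x ≠ 0 := by
    rw [sub_ne_zero]; exact_mod_cast hx.2.ne'
  have d1 : HasDerivAt (fun z : ℂ => z ^ (α + 1)) ((α + 1) * (x : ℂ) ^ (α + 1 - 1) * 1) (x : ℂ) :=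
    (hasDerivAt_id (x : ℂ)).cpow_const (Or.inl (by simpa using hx.1))
  have d2 : HasDerivAt (fun z : ℂ => (1 - z) ^ (β + 1))
      ((β + 1) * (1 - (x : ℂ)) ^ (β + 1 - 1) * (-1)) (x : ℂ) :=
    ((hasDerivAt_id (x : ℂ)).const_sub 1).cpow_const (Or.inl (by simpa using hx.2))
  have d := (d1.mul d2).comp_ofReal
  refine d.congr_deriv ?_
  unfold weight
  rw [add_sub_cancel_right, add_sub_cancel_right, Complex.cpow_add _ _ h1,
    Complex.cpow_add _ _ h2, Complex.cpow_one, Complex.cpow_one]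
  ring

/-- Rodrigues' formula does define a polynomial. -/
theorem exists_isRodrigues (n : ℕ) :
    ∀ α β : ℂ, ∃ P : Polynomial ℂ, IsRodrigues α β n P := by
  induction n with
  | zero =>
    intro α β
    refine ⟨1, fun x hx => ?_⟩
    simp [inv_mul_cancel₀ (weight_ne_zero α β hx)]
  | succ n ih =>
    intro α β
    obtain ⟨Q, hQ⟩ := ih (α + 1) (β + 1)
    refine ⟨(Polynomial.C (α + 1) - Polynomial.C (α + β + 2) * Polynomial.X) * Q
      + (Polynomial.X - Polynomial.X ^ 2) * Polynomial.derivative Q, fun x hx => ?_⟩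
    have hU : Set.Ioo (0 : ℝ) 1 ∈ 𝓝 x := isOpen_Ioo.mem_nhds hx
    have e1 : ∀ y ∈ Set.Ioo (0 : ℝ) 1,
        iteratedDeriv n (fun t : ℝ => ((t : ℂ) - (t : ℂ) ^ 2) ^ (n + 1) * weight α β t) y
          = weight (α + 1) (β + 1) y * Q.eval (y : ℂ) := by
      intro y hy
      rw [hQ y hy, mul_inv_cancel_left₀ (weight_ne_zero _ _ hy)]
      apply Filter.EventuallyEq.iteratedDeriv_eq
      filter_upwards [isOpen_Ioo.mem_nhds hy] with t ht
      rw [weight_add_one α β ht]; ring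
    have e2 : iteratedDeriv n
        (fun t : ℝ => ((t : ℂ) - (t : ℂ) ^ 2) ^ (n + 1) * weight α β t)
          =ᶠ[𝓝 x] fun y : ℝ => weight (α + 1) (β + 1) y * Q.eval (y : ℂ) := by
      filter_upwards [hU] with y hy using e1 y hy
    have hd : deriv (fun y : ℝ => weight (α + 1) (β + 1) y * Q.eval (y : ℂ)) x = _ :=
      ((hasDerivAt_weight α β hx).mul (Q.hasDerivAt (x : ℂ)).comp_ofReal).deriv
    rw [iteratedDeriv_succ, e2.deriv_eq, hd, weight_add_one α β hx]
    have hw := weight_ne_zero α β hx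
    simp only [Polynomial.eval_add, Polynomial.eval_mul, Polynomial.eval_sub, Polynomial.eval_C,
      Polynomial.eval_X, Polynomial.eval_pow]
    field_simp
    ring

/-- Rodrigues' formula determines the polynomial. -/
theorem IsRodrigues.unique {α β : ℂ} {n : ℕ} {P Q : Polynomial ℂ} (hP : IsRodrigues α β n P)
    (hQ : IsRodrigues α β n Q) : P = Q := by
  apply Polynomial.eq_of_infinite_eval_eq
  refine Set.Infinite.mono (s := (fun x : ℝ => (x : ℂ)) '' Set.Ioo (0 : ℝ) 1) ?_ ?_
  · rintro _ ⟨x, hx, rfl⟩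
    exact (hP x hx).trans (hQ x hx).symm
  · exact (Set.Ioo_infinite one_pos).image Complex.ofReal_injective.injOn

/-- The Jacobi polynomial `P_n^{(α,β)}` on `[0,1]`: the polynomial given by Rodrigues' formula. -/
def jacobi (α β : ℂ) (n : ℕ) : Polynomial ℂ := (exists_isRodrigues n α β).choose

theorem jacobi_isRodrigues (α β : ℂ) (n : ℕ) : IsRodrigues α β n (jacobi α β n) :=
  (exists_isRodrigues n α β).choose_spec

/-- `C_n = (-1)^n ∏_{k=1}^n (k + n + α + β)`. -/
def leadCoeffConst (α β : ℂ) (n : ℕ) : ℂ :=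
  (-1) ^ n * ∏ k ∈ Finset.Icc 1 n, ((k : ℂ) + n + α + β)

/-- The monic Jacobi polynomial `π_n = C_n⁻¹ P_n^{(α,β)}`. -/
def monicJacobi (α β : ℂ) (n : ℕ) : Polynomial ℂ :=
  Polynomial.C (leadCoeffConst α β n)⁻¹ * jacobi α β n

/-- The beta function `B(r,s) = Γ(r) Γ(s) / Γ(r+s)`. -/
def betaFn (r s : ℂ) : ℂ := Complex.Gamma r * Complex.Gamma s / Complex.Gamma (r + s)

/-- `c_n = (-1)^n 2πi C_{n-1} / ((n-1)! B(α+n, β+n))`, for `n ≥ 1`. -/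
def normConst (α β : ℂ) (n : ℕ) : ℂ :=
  (-1) ^ n * (2 * (Real.pi : ℂ) * Complex.I) * leadCoeffConst α β (n - 1)
    * (((n - 1).factorial : ℂ) * betaFn (α + n) (β + n))⁻¹

/-! ### The Riemann–Hilbert problem -/

/-- The segment `[0,1]` in the complex plane. -/
def cut : Set ℂ := (fun x : ℝ => (x : ℂ)) '' Set.Icc (0 : ℝ) 1

/-- The branch of `z^α` which is analytic on `ℂ ∖ [0,∞)`, with `0 < arg z < 2π`. (Any other
branch there is a nonzero constant multiple of this one.) -/
def branchZero (α z : ℂ) : ℂ := Complex.exp (α * (Complex.log (-z) + Real.pi * Complex.I))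

/-- The branch of `(z-1)^β` which is analytic on `ℂ ∖ (-∞,1]`, with `-π < arg (z-1) < π`. -/
def branchOne (β z : ℂ) : ℂ := (z - 1) ^ β

/-- `Y` solves the Riemann–Hilbert problem on `ℂ ∖ [0,1]`. The values of `Y` on `[0,1]` itself are
irrelevant. -/
structure IsSolution (α β : ℂ) (n : ℕ) (Y : ℂ → Matrix (Fin 2) (Fin 2) ℂ) : Prop where
  /-- `Y` is analytic on `ℂ ∖ [0,1]`. -/
  analytic : ∀ i j, AnalyticOnNhd ℂ (fun z => Y z i j) cutᶜ
  /-- The boundary values `Y⁺` (from above) and `Y⁻` (from below) exist on `(0,1)`, and they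
  satisfy the jump condition. -/
  jump : ∀ x ∈ Set.Ioo (0 : ℝ) 1, ∃ Yplus Yminus : Matrix (Fin 2) (Fin 2) ℂ,
    Tendsto Y (𝓝[{z : ℂ | 0 < z.im}] (x : ℂ)) (𝓝 Yplus) ∧
    Tendsto Y (𝓝[{z : ℂ | z.im < 0}] (x : ℂ)) (𝓝 Yminus) ∧
    Yplus = Yminus * !![1, (x : ℂ) ^ α * (1 - (x : ℂ)) ^ β; 0, 1]
  /-- `Y(z) = (I + O(1/z)) diag(z^n, z^{-n})` as `z → ∞`. -/
  atInfinity : ∃ E : ℂ → Matrix (Fin 2) (Fin 2) ℂ,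
    (∀ i j, (fun z => E z i j) =O[cocompact ℂ] fun z => z⁻¹) ∧
    ∀ᶠ z in cocompact ℂ, Y z = (1 + E z) * !![z ^ n, 0; 0, (z ^ n)⁻¹]
  /-- The first column is `O(1)` as `z → 0`. -/
  atZero_left : ∀ i, (fun z => Y z i 0) =O[𝓝[cutᶜ] 0] fun _ => (1 : ℂ)
  /-- The second column is `z^α h(z) + O(1)` as `z → 0`, with `h` analytic at `0`. -/
  atZero_right : ∀ i, ∃ h : ℂ → ℂ, AnalyticAt ℂ h 0 ∧
    (fun z => Y z i 1 - branchZero α z * h z) =O[𝓝[cutᶜ] 0] fun _ => (1 : ℂ)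
  /-- The first column is `O(1)` as `z → 1`. -/
  atOne_left : ∀ i, (fun z => Y z i 0) =O[𝓝[cutᶜ] 1] fun _ => (1 : ℂ)
  /-- The second column is `(z-1)^β h(z) + O(1)` as `z → 1`, with `h` analytic at `1`. -/
  atOne_right : ∀ i, ∃ h : ℂ → ℂ, AnalyticAt ℂ h 1 ∧
    (fun z => Y z i 1 - branchOne β z * h z) =O[𝓝[cutᶜ] 1] fun _ => (1 : ℂ)

/-- The explicit solution, built from monic Jacobi polynomials and their finite-part Cauchy
transforms (for `n ≥ 1`). -/
def explicitSolution (α β : ℂ) (n : ℕ) (z : ℂ) : Matrix (Fin 2) (Fin 2) ℂ :=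
  !![(monicJacobi α β n).eval z, cauchyTransform α β (monicJacobi α β n) z;
    normConst α β n * (monicJacobi α β (n - 1)).eval z,
    normConst α β n * cauchyTransform α β (monicJacobi α β (n - 1)) z]

end JacobiRH

end

noncomputable section

namespace JacobiRH

/-! Existence. Everything reduces to the kernel `K(z)`, the finite part of `∫ t^α (1-t)^β / (t - z)
dt`. The Cauchy transform of a polynomial `p` is `(2πi)⁻¹ p(z) K(z)` plus a polynomial
(`exists_polyCauchy_eq`), because `(p(t) - p(z)) / (t - z)` is a polynomial in `t`. For exponents
with positive real part the finite part is an ordinary integral. The general case is reached by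
raising exponents by one: a factor `t` or `1 - t` is absorbed in the weight, and `t / (t - z) = 1 +
z / (t - z)` expresses `K` for `α + 1` through `K` for `α` and the total mass. Solving for the
latter, `ladder_induction` carries analyticity, decay and the jump down to all admissible exponents.

The finite part obeys integration by parts without boundary terms
(`finitePart_integration_by_parts`). Applied to `(t - z)⁻¹`, this gives a first-order linear
differential equation for `K`. Variation of constants yields boundary values on `(0,1)`, and a power
series solution yields the form `z^α h(z) + O(1)` at `0`. If `α` is a natural number `m`, a
resonance term `z^m log(-z)` appears, which is bounded because `α ≠ 0` forces `m ≥ 1`. The jump for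
positive real parts comes from the Poisson kernel. Applied repeatedly with Rodrigues' formula,
integration by parts gives orthogonality of the Jacobi polynomials and the moment `(-1)^n n!
B(α+n+1, β+n+1)`. Orthogonality produces the decay `z^{-n}` in the second column, and the moment
explains `c_n`.

Uniqueness. For two solutions `Y`, `Z`, the combinations `Y_{i0} Z_{k1} - Y_{i1} Z_{k0}` have no
jump, since the weight terms cancel. The delicate point is boundedness at `0` and `1`, where the
second column may be large. By `isBigO_one_of_branchZero`, a function of the form `z^α h(z) + O(1)`
without jump is bounded: its one-sided limits agree, so the difference of the two branches of `z^α
h` is controlled. Morera's theorem, removal of singularities and Liouville's theorem then make each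
combination constant. With `Y = Z` this says that the determinant is `1`, and Cramer's rule gives `Y
= Z`. -/

/-- `α` is not a negative integer. -/
def NotNegInt (α : ℂ) : Prop := ∀ k : ℕ, α ≠ -((k : ℂ) + 1)

/-! ### Admissible exponents and induction on integer shifts. -/

theorem NotNegInt.add_one {α : ℂ} (h : NotNegInt α) : NotNegInt (α + 1) := by
  intro k hk
  apply h (k + 1)
  push_cast
  linear_combination hk

theorem NotNegInt.add_natCast {α : ℂ} (h : NotNegInt α) (n : ℕ) : NotNegInt (α + n) := by
  intro k hk
  apply h (k + n)
  push_cast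
  linear_combination hk

theorem NotNegInt.ne {α : ℂ} (h : NotNegInt α) (n : ℕ) : (n : ℂ) + α + 1 ≠ 0 :=
  fun hk => h n (by linear_combination hk)

theorem NotNegInt.add_one_ne_zero {α : ℂ} (h : NotNegInt α) : α + 1 ≠ 0 := by
  simpa using h.ne 0

theorem notNegInt_of_re_pos {α : ℂ} (h : 0 < α.re) : NotNegInt α := by
  rintro k rfl
  simp at h
  linarith [(Nat.cast_nonneg k : (0 : ℝ) ≤ k)]

/-- A statement about pairs of parameters follows from the case of positive real parts if it can
be shifted down in each parameter. -/
theorem ladder_induction {P : ℂ → ℂ → Prop}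
    (base : ∀ α β : ℂ, 0 < α.re → 0 < β.re → P α β)
    (left : ∀ α β : ℂ, NotNegInt α → NotNegInt β → P (α + 1) β → P α β)
    (right : ∀ α β : ℂ, NotNegInt α → NotNegInt β → P α (β + 1) → P α β)
    {α β : ℂ} (hα : NotNegInt α) (hβ : NotNegInt β) : P α β := by
  -- `n` bounds the number of unit shifts that make the real part of the second exponent positive.
  -- The first exponent is already in the right half-plane here and is treated afterwards in the
  -- same way.
  have h1 : ∀ (n : ℕ) (α β : ℂ), 0 < α.re → NotNegInt β → 0 < β.re + n → P α β := by
    intro n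
    induction n with
    | zero => intro α β h0 _ h2; exact base α β h0 (by simpa using h2)
    | succ n ih =>
      intro α β h0 h1 h2
      refine right α β (notNegInt_of_re_pos h0) h1 (ih α (β + 1) h0 h1.add_one ?_)
      push_cast at h2
      simp only [Complex.add_re, Complex.one_re]
      linarith
  have h2 : ∀ (n : ℕ) (α β : ℂ), NotNegInt α → NotNegInt β → 0 < α.re + n → P α β := by
    intro n
    induction n with
    | zero =>
      intro α β _ hβ h2
      obtain ⟨m, hm⟩ := exists_nat_gt (-β.re)
      exact h1 m α β (by simpa using h2) hβ (by linarith)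
    | succ n ih =>
      intro α β hα hβ h2
      refine left α β hα hβ (ih (α + 1) β hα.add_one hβ ?_)
      push_cast at h2
      simp only [Complex.add_re, Complex.one_re]
      linarith
  obtain ⟨m, hm⟩ := exists_nat_gt (-α.re)
  exact h2 m α β hα hβ (by linarith)

/-! ### Taylor coefficients and the one-sided finite part -/

theorem hasSum_taylorCoeff {g : ℂ → ℂ} {R : ℝ} (hg : DifferentiableOn ℂ g (Metric.ball 0 R))
    {z : ℂ} (hz : ‖z‖ < R) : HasSum (fun n : ℕ => taylorCoeff g n * z ^ n) (g z) := by
  have h := Complex.hasSum_taylorSeries_on_ball hg (z := z) (by simpa using hz)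
  refine h.congr_fun fun n => ?_
  simp [taylorCoeff, smul_eq_mul]
  ring

/-- Uniqueness of power series expansions. It reduces each identity for one-sided finite parts to a
comparison of coefficients. -/
theorem taylorCoeff_eq_of_hasSum {g : ℂ → ℂ} {c : ℕ → ℂ} {R : ℝ} (hR : 0 < R)
    (h : ∀ z : ℂ, ‖z‖ < R → HasSum (fun n : ℕ => c n * z ^ n) (g z)) (n : ℕ) :
    taylorCoeff g n = c n := by
  have hp : HasFPowerSeriesAt g (FormalMultilinearSeries.ofScalars ℂ c) 0 := by
    rw [hasFPowerSeriesAt_iff]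
    filter_upwards [Metric.ball_mem_nhds (0 : ℂ) hR] with z hz
    have := h z (by simpa using hz)
    simpa [FormalMultilinearSeries.coeff_ofScalars, mul_comm] using this
  have hq := hp.analyticAt.hasFPowerSeriesAt
  have := congrArg (fun p => p.coeff n) (hp.eq_formalMultilinearSeries hq)
  simp only [FormalMultilinearSeries.coeff_ofScalars] at this
  rw [this, taylorCoeff, div_eq_inv_mul]

theorem taylorCoeff_congr {f g : ℂ → ℂ} (h : f =ᶠ[𝓝 0] g) (n : ℕ) :
    taylorCoeff f n = taylorCoeff g n := by
  rw [taylorCoeff, taylorCoeff, h.iteratedDeriv_eq]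

theorem finitePartZero_congr (α : ℂ) {f g : ℂ → ℂ} (h : f =ᶠ[𝓝 0] g) (x : ℝ) :
    finitePartZero α f x = finitePartZero α g x := by
  simp only [finitePartZero, taylorCoeff_congr h]

theorem norm_inv_natCast_add_le {α : ℂ} (n : ℕ) (hn : ⌈‖α + 1‖ + 1⌉₊ ≤ n) :
    ‖((n : ℂ) + α + 1)⁻¹‖ ≤ 1 := by
  have h1 : ‖α + 1‖ + 1 ≤ n := Nat.ceil_le.mp hn
  have h2 : ‖(n : ℂ)‖ - ‖α + 1‖ ≤ ‖(n : ℂ) + (α + 1)‖ := by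
    have := norm_sub_norm_le (n : ℂ) (-(α + 1))
    rwa [sub_neg_eq_add, norm_neg] at this
  rw [Complex.norm_natCast] at h2
  rw [norm_inv]
  apply inv_le_one_of_one_le₀
  rw [add_assoc]
  linarith

/-- Dividing by `n + α + 1` eventually does not increase the terms. If the denominator vanishes for
some `n`, that single term does not affect summability, so `α` is arbitrary. -/
theorem summable_div_mul_pow {c : ℕ → ℂ} (α : ℂ) {z : ℂ} (h : Summable fun n => c n * z ^ n) :
    Summable (fun n : ℕ => c n / ((n : ℂ) + α + 1) * z ^ n) := by
  refine Summable.of_norm_bounded_eventually_nat h.norm ?_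
  filter_upwards [eventually_ge_atTop (⌈‖α + 1‖ + 1⌉₊)] with n hn
  rw [div_eq_mul_inv, mul_right_comm, norm_mul]
  exact mul_le_of_le_one_right (norm_nonneg _) (norm_inv_natCast_add_le n hn)

theorem hasSum_finitePartZero (α : ℂ) {g : ℂ → ℂ} {R x : ℝ}
    (hg : DifferentiableOn ℂ g (Metric.ball 0 R)) (hx : 0 < x) (hxR : x < R) :
    HasSum (fun n : ℕ => (x : ℂ) ^ (α + 1) * (taylorCoeff g n / ((n : ℂ) + α + 1) * (x : ℂ) ^ n))
      (finitePartZero α g x) := by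
  apply HasSum.mul_left
  apply Summable.hasSum
  apply summable_div_mul_pow
  exact (hasSum_taylorCoeff hg (by simpa [abs_of_pos hx] using hxR)).summable

theorem taylorCoeff_id_mul {g : ℂ → ℂ} {R : ℝ} (hR : 0 < R)
    (hg : DifferentiableOn ℂ g (Metric.ball 0 R)) (n : ℕ) :
    taylorCoeff (fun t => t * g t) n = if n = 0 then 0 else taylorCoeff g (n - 1) := by
  refine taylorCoeff_eq_of_hasSum hR (c := fun n => if n = 0 then 0 else taylorCoeff g (n - 1)) ?_ n
  intro z hz
  rw [← hasSum_nat_add_iff' 1]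
  simp only [Nat.add_eq_zero_iff, one_ne_zero, and_false, if_false, Nat.add_sub_cancel,
    Finset.range_one, Finset.sum_singleton, if_true, zero_mul, sub_zero]
  refine ((hasSum_taylorCoeff hg hz).mul_left z).congr_fun fun n => ?_
  ring

theorem taylorCoeff_add {f g : ℂ → ℂ} {R : ℝ} (hR : 0 < R)
    (hf : DifferentiableOn ℂ f (Metric.ball 0 R))
    (hg : DifferentiableOn ℂ g (Metric.ball 0 R)) (n : ℕ) :
    taylorCoeff (fun t => f t + g t) n = taylorCoeff f n + taylorCoeff g n := by
  refine taylorCoeff_eq_of_hasSum hR (c := fun n => taylorCoeff f n + taylorCoeff g n) ?_ n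
  intro z hz
  refine ((hasSum_taylorCoeff hf hz).add (hasSum_taylorCoeff hg hz)).congr_fun fun n => ?_
  ring

theorem taylorCoeff_const_mul {f : ℂ → ℂ} (c : ℂ) {R : ℝ} (hR : 0 < R)
    (hf : DifferentiableOn ℂ f (Metric.ball 0 R)) (n : ℕ) :
    taylorCoeff (fun t => c * f t) n = c * taylorCoeff f n := by
  refine taylorCoeff_eq_of_hasSum hR (c := fun n => c * taylorCoeff f n) ?_ n
  intro z hz
  refine ((hasSum_taylorCoeff hf hz).mul_left c).congr_fun fun n => ?_
  ring

theorem finitePartZero_add_fun (α : ℂ) {f g : ℂ → ℂ} {R x : ℝ}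
    (hf : DifferentiableOn ℂ f (Metric.ball 0 R)) (hg : DifferentiableOn ℂ g (Metric.ball 0 R))
    (hx : 0 < x) (hxR : x < R) :
    finitePartZero α (fun t => f t + g t) x = finitePartZero α f x + finitePartZero α g x := by
  refine (hasSum_finitePartZero α (hf.add hg) hx hxR).unique ?_
  refine ((hasSum_finitePartZero α hf hx hxR).add
    (hasSum_finitePartZero α hg hx hxR)).congr_fun fun n => ?_
  have := taylorCoeff_add (hx.trans hxR) hf hg n
  simp only [Pi.add_def]
  rw [this]
  ring

theorem finitePartZero_const_mul (α c : ℂ) {f : ℂ → ℂ} {R x : ℝ}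
    (hf : DifferentiableOn ℂ f (Metric.ball 0 R)) (hx : 0 < x) (hxR : x < R) :
    finitePartZero α (fun t => c * f t) x = c * finitePartZero α f x := by
  refine (hasSum_finitePartZero α (hf.const_mul c) hx hxR).unique ?_
  refine ((hasSum_finitePartZero α hf hx hxR).mul_left c).congr_fun fun n => ?_
  rw [taylorCoeff_const_mul c (hx.trans hxR) hf]
  ring

/-- The factor `t` moves the coefficient of index `n` to `n + 1`, and `(n + 1) + α + 1 = n + (α + 1)
+ 1`. The term of index `0` vanishes even if its denominator is zero, so `α` is arbitrary. -/
theorem finitePartZero_id_mul (α : ℂ) {f : ℂ → ℂ} {R x : ℝ}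
    (hf : DifferentiableOn ℂ f (Metric.ball 0 R)) (hx : 0 < x) (hxR : x < R) :
    finitePartZero α (fun t => t * f t) x = finitePartZero (α + 1) f x := by
  have hx0 : (x : ℂ) ≠ 0 := by exact_mod_cast hx.ne'
  have hd : DifferentiableOn ℂ (fun t => t * f t) (Metric.ball 0 R) := differentiableOn_id.mul hf
  have h := hasSum_finitePartZero α hd hx hxR
  rw [← hasSum_nat_add_iff' 1] at h
  simp only [taylorCoeff_id_mul (hx.trans hxR) hf, Nat.add_eq_zero_iff, one_ne_zero, and_false,
    if_false, Nat.add_sub_cancel, Finset.range_one, Finset.sum_singleton, if_true, zero_mul,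
    zero_div, mul_zero, sub_zero] at h
  refine h.unique ((hasSum_finitePartZero (α + 1) hf hx hxR).congr_fun fun n => ?_)
  rw [Complex.cpow_add (α + 1) 1 hx0, Complex.cpow_one]
  push_cast
  ring

/-- The finite part of the derivative of `t^(α+1) g(t)` is its value at the upper end point. -/
theorem finitePartZero_deriv {α : ℂ} (hα : NotNegInt α) {g : ℂ → ℂ} {R x : ℝ}
    (hg : DifferentiableOn ℂ g (Metric.ball 0 R)) (hx : 0 < x) (hxR : x < R) :
    finitePartZero α (fun t => (α + 1) * g t + t * deriv g t) x = (x : ℂ) ^ (α + 1) * g x := by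
  have hR := hx.trans hxR
  have hg' : DifferentiableOn ℂ (deriv g) (Metric.ball 0 R) := hg.deriv Metric.isOpen_ball
  have hd : DifferentiableOn ℂ (fun t => t * deriv g t) (Metric.ball 0 R) :=
    differentiableOn_id.mul hg'
  refine (hasSum_finitePartZero α ((hg.const_mul (α + 1)).add hd) hx hxR).unique ?_
  refine ((hasSum_taylorCoeff hg (z := x)
    (by simpa [abs_of_pos hx] using hxR)).mul_left ((x : ℂ) ^ (α + 1))).congr_fun fun n => ?_
  simp only [Pi.add_def]
  rw [taylorCoeff_add hR (hg.const_mul (α + 1)) hd, taylorCoeff_const_mul _ hR hg,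
    taylorCoeff_id_mul hR hg']
  have hn := hα.ne n
  -- The operator `(α + 1) + t d/dt` multiplies the `n`-th coefficient by exactly the denominator in
  -- the finite part; the cancellation needs that denominator to be nonzero.
  have key : (α + 1) * taylorCoeff g n + (if n = 0 then 0 else taylorCoeff (deriv g) (n - 1))
      = taylorCoeff g n * (n + α + 1) := by
    rcases n with _ | n
    · simp; ring
    · have hf : ((n.factorial : ℕ) : ℂ) ≠ 0 := by exact_mod_cast n.factorial_ne_zero
      have hn1 : (n : ℂ) + 1 ≠ 0 := by exact_mod_cast n.succ_ne_zero
      simp only [taylorCoeff, Nat.add_eq_zero_iff, one_ne_zero, and_false, if_false,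
        Nat.add_sub_cancel, ← iteratedDeriv_succ', Nat.factorial_succ]
      push_cast
      field_simp
      ring
  rw [key, mul_div_cancel_right₀ _ hn]

/-- By additivity the finite part up to `a` is the one up to `x` plus an ordinary integral from `x`
to `a`. As `x` decreases to `0`, the former vanishes like `x^(Re α + 1)` and the latter converges.
-/
theorem finitePartZero_eq_integral {α : ℂ} (hα : 0 < α.re) {g : ℂ → ℂ} {R a : ℝ}
    (hg : DifferentiableOn ℂ g (Metric.ball 0 R)) (ha : 0 < a) (haR : a < R) :
    finitePartZero α g a = ∫ t in (0 : ℝ)..a, (t : ℂ) ^ α * g (t : ℂ) := by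
  have hα' := notNegInt_of_re_pos hα
  have hcont : ContinuousOn (fun t : ℝ => (t : ℂ) ^ α * g (t : ℂ)) (Set.Icc 0 a) := by
    intro t ht
    apply ContinuousAt.continuousWithinAt
    apply ContinuousAt.mul
    · exact Complex.continuousAt_ofReal_cpow_const _ _ (Or.inl hα)
    · have : ((t : ℂ)) ∈ Metric.ball (0 : ℂ) R := by
        simpa [abs_of_nonneg ht.1] using ht.2.trans_lt haR
      exact ContinuousAt.comp (f := fun t : ℝ => (t : ℂ))
        (hg.differentiableAt (Metric.isOpen_ball.mem_nhds this)).continuousAt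
        Complex.continuous_ofReal.continuousAt
  have hint : IntervalIntegrable (fun t : ℝ => (t : ℂ) ^ α * g (t : ℂ)) MeasureTheory.volume 0 a :=
    ContinuousOn.intervalIntegrable (by rwa [Set.uIcc_of_le ha.le])
  have h1 : Tendsto (fun x : ℝ => finitePartZero α g x) (𝓝[>] 0) (𝓝 0) := by
    have hs := summable_div_mul_pow α (hasSum_taylorCoeff hg (z := (a : ℂ))
      (by simpa [abs_of_pos ha] using haR)).summable
    set C := ∑' n : ℕ, ‖taylorCoeff g n / ((n : ℂ) + α + 1) * (a : ℂ) ^ n‖ with hC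
    have hb : Tendsto (fun x : ℝ => x ^ (α.re + 1) * C) (𝓝[>] 0) (𝓝 0) := by
      have : Tendsto (fun x : ℝ => x ^ (α.re + 1) * C) (𝓝 0) (𝓝 (0 ^ (α.re + 1) * C)) :=
        ((Real.continuousAt_rpow_const 0 (α.re + 1) (Or.inr (by linarith))).tendsto).mul_const C
      rw [Real.zero_rpow (by linarith), zero_mul] at this
      exact this.mono_left nhdsWithin_le_nhds
    refine squeeze_zero_norm' ?_ hb
    filter_upwards [Ioo_mem_nhdsGT ha] with x hx
    rw [finitePartZero, norm_mul, Complex.norm_cpow_eq_rpow_re_of_pos hx.1]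
    simp only [Complex.add_re, Complex.one_re]
    refine mul_le_mul_of_nonneg_left ?_ (Real.rpow_nonneg hx.1.le _)
    apply tsum_of_norm_bounded hs.norm.hasSum
    intro n
    rw [norm_mul, norm_mul, norm_pow, norm_pow, Complex.norm_real, Complex.norm_real,
      Real.norm_of_nonneg hx.1.le, Real.norm_of_nonneg ha.le]
    have := hx.1.le
    have := hx.2.le
    gcongr
  have h2 : Tendsto (fun x : ℝ => ∫ t in x..a, (t : ℂ) ^ α * g (t : ℂ)) (𝓝[>] 0)
      (𝓝 (∫ t in (0 : ℝ)..a, (t : ℂ) ^ α * g (t : ℂ))) := by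
    have hc := intervalIntegral.continuousOn_primitive_interval_left
      (hint.1.congr_set_ae (MeasureTheory.Ioc_ae_eq_Icc (α := ℝ)).symm |> fun h => by
        rwa [Set.uIcc_of_le ha.le])
    rw [Set.uIcc_of_le ha.le] at hc
    have := (hc 0 (Set.left_mem_Icc.mpr ha.le))
    exact this.mono_left (nhdsWithin_le_of_mem (mem_of_superset (Ioo_mem_nhdsGT ha)
      Set.Ioo_subset_Icc_self))
  have h3 := h1.add h2
  rw [zero_add] at h3
  refine tendsto_nhds_unique (Tendsto.congr' ?_ tendsto_const_nhds) h3
  filter_upwards [Ioo_mem_nhdsGT ha] with x hx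
  exact (finitePartZero_add α hα' g R x a hg hx.1 (hx.2.trans haR) ha haR).symm

/-! ### The two-sided finite part -/

/-- `f` is analytic at every point of `[0,1]`. -/
def AnalyticOnUnit (f : ℂ → ℂ) : Prop := ∀ t ∈ Set.Icc (0 : ℝ) 1, AnalyticAt ℂ f (t : ℂ)

theorem AnalyticOnUnit.add {f g : ℂ → ℂ} (hf : AnalyticOnUnit f) (hg : AnalyticOnUnit g) :
    AnalyticOnUnit (fun t => f t + g t) := fun t ht => (hf t ht).add (hg t ht)

theorem AnalyticOnUnit.mul {f g : ℂ → ℂ} (hf : AnalyticOnUnit f) (hg : AnalyticOnUnit g) :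
    AnalyticOnUnit (fun t => f t * g t) := fun t ht => (hf t ht).mul (hg t ht)

theorem AnalyticOnUnit.deriv {f : ℂ → ℂ} (hf : AnalyticOnUnit f) :
    AnalyticOnUnit (deriv f) := fun t ht => (hf t ht).deriv

theorem AnalyticOnUnit.of_differentiable {f : ℂ → ℂ} (hf : Differentiable ℂ f) :
    AnalyticOnUnit f := fun t _ => hf.analyticAt t

theorem AnalyticOnUnit.const (c : ℂ) : AnalyticOnUnit (fun _ => c) := fun _ _ => analyticAt_const

theorem AnalyticOnUnit.one_sub {f : ℂ → ℂ} (hf : AnalyticOnUnit f) :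
    AnalyticOnUnit (fun t => f (1 - t)) := by
  intro t ht
  have h : AnalyticAt ℂ f (1 - (t : ℂ)) := by
    simpa using hf (1 - t) ⟨by linarith [ht.2], by linarith [ht.1]⟩
  exact AnalyticAt.fun_comp (f := fun s : ℂ => 1 - s) h (by fun_prop)

theorem AnalyticOnUnit.continuousOn_comp_ofReal {f : ℂ → ℂ} (hf : AnalyticOnUnit f) :
    ContinuousOn (fun t : ℝ => f t) (Set.Icc 0 1) := fun t ht =>
  ((hf t ht).continuousAt.comp (f := fun t : ℝ => (t : ℂ))
    Complex.continuous_ofReal.continuousAt).continuousWithinAt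

theorem IsSplitting.mono {f : ℂ → ℂ} {a b a' b' : ℝ} (h : IsSplitting f a b) (ha' : 0 < a')
    (ha : a' ≤ a) (hb : b ≤ b') (hb' : b' < 1) : IsSplitting f a' b' := by
  obtain ⟨h1, h2, h3, h4, h5⟩ := h
  exact ⟨ha', by linarith, hb', h4.mono (Metric.closedBall_subset_closedBall ha),
    h5.mono (Metric.closedBall_subset_closedBall (by linarith))⟩

/-- With shared splitting points, identities between two finite parts can be checked on the three
pieces separately. -/
theorem exists_common_splitting {f g : ℂ → ℂ} (hf : AnalyticOnUnit f) (hg : AnalyticOnUnit g) :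
    ∃ a b, IsSplitting f a b ∧ IsSplitting g a b := by
  obtain ⟨a, b, h⟩ := exists_isSplitting f hf
  obtain ⟨a', b', h'⟩ := exists_isSplitting g hg
  refine ⟨min a a', max b b', h.mono ?_ ?_ ?_ ?_, h'.mono ?_ ?_ ?_ ?_⟩
  all_goals
    first
      | exact lt_min h.1 h'.1
      | exact max_lt h.2.2.1 h'.2.2.1
      | exact min_le_left _ _
      | exact min_le_right _ _
      | exact le_max_left _ _
      | exact le_max_right _ _

theorem IsSplitting.one_sub {f : ℂ → ℂ} {a b : ℝ} (h : IsSplitting f a b) :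
    IsSplitting (fun t => f (1 - t)) (1 - b) (1 - a) := by
  obtain ⟨h1, h2, h3, h4, h5⟩ := h
  refine ⟨by linarith, by linarith, by linarith, ?_, ?_⟩
  · intro s hs
    have : AnalyticAt ℂ f (1 - s) := h5 (1 - s) (by simpa using hs)
    exact AnalyticAt.fun_comp (f := fun s : ℂ => 1 - s) this (by fun_prop)
  · intro s hs
    have : AnalyticAt ℂ f (1 - s) := h4 (1 - s) (by
      simpa [dist_eq_norm, norm_sub_rev] using hs)
    exact AnalyticAt.fun_comp (f := fun s : ℂ => 1 - s) this (by fun_prop)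

theorem IsSplitting.exists_differentiableOn_left {f : ℂ → ℂ} {a b : ℝ} (h : IsSplitting f a b)
    (β : ℂ) :
    ∃ R, a < R ∧ DifferentiableOn ℂ (fun t => (1 - t) ^ β * f t) (Metric.ball 0 R) :=
  differentiableOn_one_sub_cpow_mul β f a (h.2.1.trans_lt h.2.2.1) h.2.2.2.1 h.1

theorem IsSplitting.exists_differentiableOn_right {f : ℂ → ℂ} {a b : ℝ} (h : IsSplitting f a b)
    (α : ℂ) :
    ∃ R, 1 - b < R ∧
      DifferentiableOn ℂ (fun s => (1 - s) ^ α * f (1 - s)) (Metric.ball 0 R) :=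
  h.one_sub.exists_differentiableOn_left α

theorem intervalIntegrable_weight_mul (α β : ℂ) {f : ℂ → ℂ} (hf : AnalyticOnUnit f) {a b : ℝ}
    (ha : 0 < a) (hab : a ≤ b) (hb : b < 1) :
    IntervalIntegrable (fun t : ℝ => (t : ℂ) ^ α * (1 - (t : ℂ)) ^ β * f (t : ℂ))
      MeasureTheory.volume a b := by
  apply ContinuousOn.intervalIntegrable
  intro t ht
  rw [Set.uIcc_of_le hab] at ht
  have h0 : 0 < t := ha.trans_le ht.1
  have h1 : t < 1 := ht.2.trans_lt hb
  apply ContinuousAt.continuousWithinAt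
  apply ContinuousAt.mul
  · apply ContinuousAt.mul
    · exact Complex.continuousAt_ofReal_cpow_const _ _ (Or.inr h0.ne')
    · apply ContinuousAt.cpow (by fun_prop) continuousAt_const
      left; simpa using h1
  · exact (hf t ⟨h0.le, h1.le⟩).continuousAt.comp (f := fun t : ℝ => (t : ℂ))
      Complex.continuous_ofReal.continuousAt

variable {α β : ℂ}

theorem finitePart_add (hα : NotNegInt α) (hβ : NotNegInt β) {f g : ℂ → ℂ}
    (hf : AnalyticOnUnit f) (hg : AnalyticOnUnit g) :
    finitePart α β (fun t => f t + g t) = finitePart α β f + finitePart α β g := by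
  obtain ⟨a, b, h1, h2⟩ := exists_common_splitting hf hg
  have h3 : IsSplitting (fun t => f t + g t) a b :=
    ⟨h1.1, h1.2.1, h1.2.2.1, h1.2.2.2.1.add h2.2.2.2.1, h1.2.2.2.2.add h2.2.2.2.2⟩
  rw [finitePart_eq α β hα hβ f hf a b h1, finitePart_eq α β hα hβ g hg a b h2,
    finitePart_eq α β hα hβ _ (hf.add hg) a b h3]
  unfold splitFinitePart
  obtain ⟨R1, hR1, d1⟩ := h1.exists_differentiableOn_left β
  obtain ⟨R2, hR2, d2⟩ := h2.exists_differentiableOn_left β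
  obtain ⟨S1, hS1, e1⟩ := h1.exists_differentiableOn_right α
  obtain ⟨S2, hS2, e2⟩ := h2.exists_differentiableOn_right α
  have k1 := finitePartZero_add_fun α
    (d1.mono (Metric.ball_subset_ball (min_le_left R1 R2)))
    (d2.mono (Metric.ball_subset_ball (min_le_right R1 R2))) h1.1 (lt_min hR1 hR2)
  have k2 := finitePartZero_add_fun β
    (e1.mono (Metric.ball_subset_ball (min_le_left S1 S2)))
    (e2.mono (Metric.ball_subset_ball (min_le_right S1 S2))) (by linarith [h1.2.2.1])
    (lt_min hS1 hS2)
  have k3 := intervalIntegral.integral_add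
    (intervalIntegrable_weight_mul α β hf h1.1 h1.2.1 h1.2.2.1)
    (intervalIntegrable_weight_mul α β hg h1.1 h1.2.1 h1.2.2.1)
  simp only [mul_add]
  rw [k1, k2, k3]
  ring

theorem finitePart_const_mul (hα : NotNegInt α) (hβ : NotNegInt β) (c : ℂ) {f : ℂ → ℂ}
    (hf : AnalyticOnUnit f) :
    finitePart α β (fun t => c * f t) = c * finitePart α β f := by
  obtain ⟨a, b, h1⟩ := exists_isSplitting f hf
  have h3 : IsSplitting (fun t => c * f t) a b :=
    ⟨h1.1, h1.2.1, h1.2.2.1, analyticOnNhd_const.mul h1.2.2.2.1, analyticOnNhd_const.mul h1.2.2.2.2⟩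
  rw [finitePart_eq α β hα hβ f hf a b h1,
    finitePart_eq α β hα hβ _ ((AnalyticOnUnit.const c).mul hf) a b h3]
  unfold splitFinitePart
  obtain ⟨R1, hR1, d1⟩ := h1.exists_differentiableOn_left β
  obtain ⟨S1, hS1, e1⟩ := h1.exists_differentiableOn_right α
  have k1 := finitePartZero_const_mul α c d1 h1.1 hR1
  have k2 := finitePartZero_const_mul β c e1 (by linarith [h1.2.2.1]) hS1
  simp only [mul_left_comm _ c]
  rw [k1, k2, intervalIntegral.integral_const_mul]
  ring

theorem finitePart_sub (hα : NotNegInt α) (hβ : NotNegInt β) {f g : ℂ → ℂ}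
    (hf : AnalyticOnUnit f) (hg : AnalyticOnUnit g) :
    finitePart α β (fun t => f t - g t) = finitePart α β f - finitePart α β g := by
  have h := finitePart_add hα hβ hf ((AnalyticOnUnit.const (-1)).mul hg)
  rw [finitePart_const_mul hα hβ _ hg] at h
  simpa [sub_eq_add_neg] using h

/-- The end pieces depend only on the Taylor coefficients at `0` and `1`, the middle piece only on
the values in between. -/
theorem finitePart_congr (hα : NotNegInt α) (hβ : NotNegInt β) {f g : ℂ → ℂ}
    (hf : AnalyticOnUnit f) (h : ∀ t ∈ Set.Icc (0 : ℝ) 1, f =ᶠ[𝓝 (t : ℂ)] g) :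
    finitePart α β f = finitePart α β g := by
  have hg : AnalyticOnUnit g := fun t ht => (hf t ht).congr (h t ht)
  obtain ⟨a, b, h1, h2⟩ := exists_common_splitting hf hg
  rw [finitePart_eq α β hα hβ f hf a b h1, finitePart_eq α β hα hβ g hg a b h2]
  unfold splitFinitePart
  congr 1
  · congr 1
    · apply finitePartZero_congr
      filter_upwards [(by simpa using h 0 (by simp) : f =ᶠ[𝓝 0] g)] with t ht
      rw [ht]
    · apply intervalIntegral.integral_congr
      intro t ht
      rw [Set.uIcc_of_le h1.2.1] at ht
      simp only
      rw [(h t ⟨h1.1.le.trans ht.1, ht.2.trans h1.2.2.1.le⟩).eq_of_nhds]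
  · apply finitePartZero_congr
    have : Tendsto (fun s : ℂ => 1 - s) (𝓝 0) (𝓝 1) := by
      have : ContinuousAt (fun s : ℂ => 1 - s) 0 := by fun_prop
      simpa [ContinuousAt] using this
    filter_upwards [this.eventually (by simpa using h 1 (by simp) : f =ᶠ[𝓝 1] g)] with t ht
    rw [ht]

/-- The substitution `t ↦ 1 - t`. -/
theorem finitePart_one_sub (hα : NotNegInt α) (hβ : NotNegInt β) {f : ℂ → ℂ}
    (hf : AnalyticOnUnit f) :
    finitePart β α (fun t => f (1 - t)) = finitePart α β f := by
  obtain ⟨a, b, h1⟩ := exists_isSplitting f hf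
  rw [finitePart_eq α β hα hβ f hf a b h1, finitePart_eq β α hβ hα _ hf.one_sub _ _ h1.one_sub]
  unfold splitFinitePart
  have e2 : (∫ t in (1 - b)..(1 - a), (t : ℂ) ^ β * (1 - (t : ℂ)) ^ α * f (1 - (t : ℂ)))
      = ∫ t in a..b, (t : ℂ) ^ α * (1 - (t : ℂ)) ^ β * f (t : ℂ) := by
    have := intervalIntegral.integral_comp_sub_left (a := 1 - b) (b := 1 - a)
      (fun t : ℝ => (t : ℂ) ^ α * (1 - (t : ℂ)) ^ β * f (t : ℂ)) 1
    simp only [sub_sub_cancel, Complex.ofReal_sub, Complex.ofReal_one] at this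
    rw [← this]
    congr 1; funext t; ring
  rw [e2]
  simp only [sub_sub_cancel]
  ring

theorem one_sub_mem_slitPlane {t : ℂ} (ht : ‖t‖ < 1) : 1 - t ∈ Complex.slitPlane := by
  left
  have := (abs_lt.mp ((Complex.abs_re_le_norm t).trans_lt ht)).2
  simp only [Complex.sub_re, Complex.one_re]
  linarith

/-- Multiplication by `t` raises the left exponent by one. This is the mechanism behind every
parameter shift below. -/
theorem finitePart_id_mul (hα : NotNegInt α) (hβ : NotNegInt β) {f : ℂ → ℂ}
    (hf : AnalyticOnUnit f) :
    finitePart α β (fun t => t * f t) = finitePart (α + 1) β f := by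
  obtain ⟨a, b, h1⟩ := exists_isSplitting f hf
  have h3 : IsSplitting (fun t => t * f t) a b :=
    ⟨h1.1, h1.2.1, h1.2.2.1, analyticOnNhd_id.mul h1.2.2.2.1, analyticOnNhd_id.mul h1.2.2.2.2⟩
  rw [finitePart_eq _ β hα.add_one hβ f hf a b h1, finitePart_eq α β hα hβ _
    ((AnalyticOnUnit.of_differentiable (f := fun t => t) differentiable_id).mul hf) a b h3]
  unfold splitFinitePart
  obtain ⟨R1, hR1, d1⟩ := h1.exists_differentiableOn_left β
  have k1 := finitePartZero_id_mul α d1 h1.1 hR1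
  congr 1
  · congr 1
    · rw [← k1]
      simp only [mul_left_comm]
    · apply intervalIntegral.integral_congr
      intro t ht
      rw [Set.uIcc_of_le h1.2.1] at ht
      have ht0 : (t : ℂ) ≠ 0 := by
        exact_mod_cast (h1.1.trans_le ht.1).ne'
      simp only
      rw [Complex.cpow_add _ _ ht0, Complex.cpow_one]
      ring
  · apply finitePartZero_congr
    filter_upwards [Metric.ball_mem_nhds (0 : ℂ) one_pos] with s hs
    have : (1 : ℂ) - s ≠ 0 :=
      Complex.slitPlane_ne_zero (one_sub_mem_slitPlane (by simpa using hs))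
    rw [Complex.cpow_add _ _ this, Complex.cpow_one]
    ring

theorem finitePart_one_sub_mul (hα : NotNegInt α) (hβ : NotNegInt β) {f : ℂ → ℂ}
    (hf : AnalyticOnUnit f) :
    finitePart α β (fun t => (1 - t) * f t) = finitePart α (β + 1) f := by
  have h : AnalyticOnUnit (fun t => (1 - t) * f t) :=
    (AnalyticOnUnit.of_differentiable (by fun_prop)).mul hf
  rw [← finitePart_one_sub hα hβ h, ← finitePart_one_sub hα hβ.add_one hf,
    ← finitePart_id_mul hβ hα hf.one_sub]
  simp only [sub_sub_cancel]

theorem hasDerivAt_one_sub_cpow {β t : ℂ} (ht : 1 - t ∈ Complex.slitPlane) :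
    HasDerivAt (fun t : ℂ => (1 - t) ^ (β + 1)) (-((β + 1) * (1 - t) ^ β)) t := by
  have := ((hasDerivAt_id t).const_sub 1).cpow_const (c := β + 1) ht
  simpa using this

/-- The one-sided form of integration by parts. -/
theorem finitePartZero_integration_by_parts (hα : NotNegInt α) (β : ℂ) {f : ℂ → ℂ} {a : ℝ}
    (ha : 0 < a) (ha1 : a < 1) (hf : AnalyticOnNhd ℂ f (Metric.closedBall 0 a)) :
    finitePartZero α (fun t => (1 - t) ^ β *
      (((α + 1) * (1 - t) - (β + 1) * t) * f t + t * (1 - t) * deriv f t)) a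
      = (a : ℂ) ^ (α + 1) * ((1 - (a : ℂ)) ^ (β + 1) * f a) := by
  obtain ⟨R, hR, hd⟩ := differentiableOn_one_sub_cpow_mul (β + 1) f a ha1 hf ha
  rw [← finitePartZero_deriv hα hd ha hR]
  apply finitePartZero_congr
  have hf0 : AnalyticAt ℂ f 0 := hf 0 (by simp [ha.le])
  filter_upwards [hf0.eventually_analyticAt, Metric.ball_mem_nhds (0 : ℂ) one_pos] with t h1 h2
  have h3 := one_sub_mem_slitPlane (by simpa using h2)
  have h4 : (1 : ℂ) - t ≠ 0 := Complex.slitPlane_ne_zero h3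
  have h5 : deriv (fun t => (1 - t) ^ (β + 1) * f t) t = _ :=
    ((hasDerivAt_one_sub_cpow h3).mul h1.differentiableAt.hasDerivAt).deriv
  rw [h5, Complex.cpow_add _ _ h4, Complex.cpow_one]
  ring

/-- Integration by parts: the finite part of `(t^(α+1) (1-t)^(β+1) f(t))'` vanishes. -/
theorem finitePart_integration_by_parts (hα : NotNegInt α) (hβ : NotNegInt β) {f : ℂ → ℂ}
    (hf : AnalyticOnUnit f) :
    finitePart α β (fun t =>
      ((α + 1) * (1 - t) - (β + 1) * t) * f t + t * (1 - t) * deriv f t) = 0 := by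
  have hψ : ∀ t, AnalyticAt ℂ f t → AnalyticAt ℂ (fun t =>
      ((α + 1) * (1 - t) - (β + 1) * t) * f t + t * (1 - t) * deriv f t) t := by
    intro t ht
    have := ht.deriv
    fun_prop
  obtain ⟨a, b, h1⟩ := exists_isSplitting f hf
  have h2 : IsSplitting (fun t =>
      ((α + 1) * (1 - t) - (β + 1) * t) * f t + t * (1 - t) * deriv f t) a b :=
    ⟨h1.1, h1.2.1, h1.2.2.1, fun t ht => hψ t (h1.2.2.2.1 t ht),
      fun t ht => hψ t (h1.2.2.2.2 t ht)⟩
  rw [finitePart_eq α β hα hβ _ (fun t ht => hψ t (hf t ht)) a b h2]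
  unfold splitFinitePart
  have k1 := finitePartZero_integration_by_parts hα β h1.1 (h1.2.1.trans_lt h1.2.2.1) h1.2.2.2.1
  have k2 := finitePartZero_integration_by_parts hβ α h1.one_sub.1
    (h1.one_sub.2.1.trans_lt h1.one_sub.2.2.1) h1.one_sub.2.2.2.1
  -- Under `t = 1 - s` the derivative changes sign, so the right end piece is minus the one computed
  -- in `k2`. The boundary values at `a` and `b` then cancel against those of the middle integral
  -- `k4`.
  have k3 : finitePartZero β (fun s => (1 - s) ^ α *
      (((α + 1) * (1 - (1 - s)) - (β + 1) * (1 - s)) * f (1 - s)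
        + (1 - s) * (1 - (1 - s)) * deriv f (1 - s))) (1 - b)
      = -((1 - (b : ℂ)) ^ (β + 1) * ((b : ℂ) ^ (α + 1) * f b)) := by
    obtain ⟨R, hR, hd⟩ := differentiableOn_one_sub_cpow_mul α (fun s =>
      (((β + 1) * (1 - s) - (α + 1) * s) * f (1 - s)
        + s * (1 - s) * deriv (fun s => f (1 - s)) s)) (1 - b) (by linarith [h1.1, h1.2.1]) (by
          intro s hs
          have h3 := h1.one_sub.2.2.2.1 s hs
          exact ((by fun_prop : AnalyticAt ℂ (fun s => (β + 1) * (1 - s) - (α + 1) * s) s).mul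
            h3).add ((by fun_prop : AnalyticAt ℂ (fun s => s * (1 - s)) s).mul h3.deriv))
      h1.one_sub.1
    have := finitePartZero_const_mul β (-1) hd h1.one_sub.1 hR
    rw [k2] at this
    simp only [Complex.ofReal_sub, Complex.ofReal_one, sub_sub_cancel, neg_one_mul] at this
    rw [← this]
    congr 1
    funext s
    have : deriv (fun s => f (1 - s)) s = - deriv f (1 - s) := by
      simpa using deriv_comp_const_sub f 1 s
    rw [this]
    ring
  have k4 : (∫ t in a..b, (t : ℂ) ^ α * (1 - (t : ℂ)) ^ β *
      (((α + 1) * (1 - (t : ℂ)) - (β + 1) * (t : ℂ)) * f t + t * (1 - (t : ℂ)) * deriv f t))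
      = (b : ℂ) ^ (α + 1) * ((1 - (b : ℂ)) ^ (β + 1) * f b)
        - (a : ℂ) ^ (α + 1) * ((1 - (a : ℂ)) ^ (β + 1) * f a) := by
    have hw : ∀ t ∈ Set.uIcc a b, HasDerivAt (fun t : ℝ => weight (α + 1) (β + 1) t * f t)
        ((t : ℂ) ^ α * (1 - (t : ℂ)) ^ β *
        (((α + 1) * (1 - (t : ℂ)) - (β + 1) * (t : ℂ)) * f t
          + t * (1 - (t : ℂ)) * deriv f t)) t := by
      intro t ht
      rw [Set.uIcc_of_le h1.2.1] at ht
      have ht' : t ∈ Set.Ioo (0 : ℝ) 1 := ⟨h1.1.trans_le ht.1, ht.2.trans_lt h1.2.2.1⟩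
      have hd := (hasDerivAt_weight α β ht').mul
        (hf t ⟨ht'.1.le, ht'.2.le⟩).differentiableAt.hasDerivAt.comp_ofReal
      refine hd.congr_deriv ?_
      rw [weight_add_one α β ht', weight]
      ring
    rw [intervalIntegral.integral_eq_sub_of_hasDerivAt hw
      (intervalIntegrable_weight_mul α β (fun t ht => hψ t (hf t ht)) h1.1 h1.2.1 h1.2.2.1)]
    simp only [weight]
    ring
  rw [k1, k3, k4]
  ring

theorem finitePart_eq_integral (hα : 0 < α.re) (hβ : 0 < β.re) {f : ℂ → ℂ}
    (hf : AnalyticOnUnit f) :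
    finitePart α β f = ∫ t in (0 : ℝ)..1, weight α β t * f t := by
  obtain ⟨a, b, h1⟩ := exists_isSplitting f hf
  rw [finitePart_eq α β (notNegInt_of_re_pos hα) (notNegInt_of_re_pos hβ) f hf a b h1]
  unfold splitFinitePart
  obtain ⟨R, hR, d⟩ := h1.exists_differentiableOn_left β
  obtain ⟨S, hS, e⟩ := h1.exists_differentiableOn_right α
  rw [finitePartZero_eq_integral hα d h1.1 hR, finitePartZero_eq_integral hβ e h1.one_sub.1 hS]
  have hw : ContinuousOn (fun t : ℝ => weight α β t * f t) (Set.Icc 0 1) := by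
    refine ContinuousOn.mul ?_ hf.continuousOn_comp_ofReal
    apply Continuous.continuousOn
    have h2 : Continuous (fun t : ℝ => (t : ℂ) ^ α) :=
      Complex.continuous_ofReal_cpow_const hα
    have h3 : Continuous (fun t : ℝ => (t : ℂ) ^ β) :=
      Complex.continuous_ofReal_cpow_const hβ
    have h4 : Continuous (fun t : ℝ => (((1 - t : ℝ)) : ℂ) ^ β) := h3.comp (by fun_prop)
    simp only [Complex.ofReal_sub, Complex.ofReal_one] at h4
    exact h2.mul h4
  have hi : ∀ x y : ℝ, 0 ≤ x → x ≤ y → y ≤ 1 → IntervalIntegrable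
      (fun t : ℝ => weight α β t * f t) MeasureTheory.volume x y := by
    intro x y h0 hxy hy
    apply ContinuousOn.intervalIntegrable
    rw [Set.uIcc_of_le hxy]
    exact hw.mono (Set.Icc_subset_Icc h0 hy)
  have e1 : (∫ t in (0 : ℝ)..(1 - b), (t : ℂ) ^ β * ((1 - (t : ℂ)) ^ α * f (1 - (t : ℂ))))
      = ∫ t in b..1, weight α β t * f t := by
    have := intervalIntegral.integral_comp_sub_left (a := 0) (b := 1 - b)
      (fun t : ℝ => weight α β t * f (t : ℂ)) 1
    simp only [sub_sub_cancel, sub_zero, Complex.ofReal_sub, Complex.ofReal_one, weight] at this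
    simp only [weight]
    rw [← this]
    congr 1; funext t; ring
  have e2 : (∫ t in (0 : ℝ)..a, (t : ℂ) ^ α * ((1 - (t : ℂ)) ^ β * f (t : ℂ)))
      = ∫ t in (0 : ℝ)..a, weight α β t * f t := by
    simp only [weight, mul_assoc]
  obtain ⟨h1a, h1b, h1c, -, -⟩ := h1
  rw [e1, e2, ← intervalIntegral.integral_add_adjacent_intervals (hi 0 a le_rfl h1a.le (by linarith))
    (hi a 1 h1a.le (by linarith) le_rfl), ← intervalIntegral.integral_add_adjacent_intervals
    (hi a b h1a.le h1b h1c.le) (hi b 1 (by linarith) h1c.le le_rfl), ← add_assoc]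
  rfl

/-! ### The finite-part Cauchy transform of the constant polynomial -/

theorem isOpen_compl_cut : IsOpen cutᶜ :=
  ((isCompact_Icc.image Complex.continuous_ofReal).isClosed).isOpen_compl

theorem zero_mem_cut : (0 : ℂ) ∈ cut := ⟨0, by simp, by simp⟩

theorem one_mem_cut : (1 : ℂ) ∈ cut := ⟨1, by simp, by simp⟩

theorem ne_zero_of_mem_compl_cut {z : ℂ} (hz : z ∈ cutᶜ) : z ≠ 0 := by
  rintro rfl; exact hz zero_mem_cut

theorem one_sub_ne_zero_of_mem_compl_cut {z : ℂ} (hz : z ∈ cutᶜ) : 1 - z ≠ 0 := by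
  intro h
  rw [← sub_eq_zero.mp h] at hz
  exact hz one_mem_cut

theorem ofReal_sub_ne_zero {z : ℂ} (hz : z ∈ cutᶜ) {t : ℝ} (ht : t ∈ Set.Icc (0 : ℝ) 1) :
    (t : ℂ) - z ≠ 0 := by
  intro h
  exact hz ⟨t, ht, sub_eq_zero.mp h⟩

theorem one_sub_mem_compl_cut {z : ℂ} (hz : z ∈ cutᶜ) : 1 - z ∈ cutᶜ := by
  rintro ⟨t, ht, h⟩
  refine hz ⟨1 - t, ⟨by linarith [ht.2], by linarith [ht.1]⟩, ?_⟩
  simp only at h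
  push_cast
  rw [h]; ring

theorem mem_compl_cut_of_im_ne_zero {z : ℂ} (hz : z.im ≠ 0) : z ∈ cutᶜ := by
  rintro ⟨t, -, rfl⟩
  simp at hz

theorem analyticOnUnit_inv_sub {z : ℂ} (hz : z ∈ cutᶜ) :
    AnalyticOnUnit (fun t => (t - z)⁻¹) := fun t ht =>
  (by fun_prop : AnalyticAt ℂ (fun t : ℂ => t - z) t).inv (ofReal_sub_ne_zero hz ht)

theorem analyticOnUnit_inv_sub_sq {z : ℂ} (hz : z ∈ cutᶜ) :
    AnalyticOnUnit (fun t => ((t - z) ^ 2)⁻¹) := fun t ht =>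
  (by fun_prop : AnalyticAt ℂ (fun t : ℂ => (t - z) ^ 2) t).inv
    (pow_ne_zero 2 (ofReal_sub_ne_zero hz ht))

theorem AnalyticOnUnit.id : AnalyticOnUnit (fun t => t) :=
  .of_differentiable differentiable_id

/-- For `z` off the cut, the set `t ≠ z` is a neighbourhood of `[0,1]`, so algebraic identities may
be verified with `t - z` cleared from denominators. -/
theorem finitePart_congr_of_ne (hα : NotNegInt α) (hβ : NotNegInt β) {f g : ℂ → ℂ} {z : ℂ}
    (hz : z ∈ cutᶜ) (hf : AnalyticOnUnit f) (h : ∀ t, t - z ≠ 0 → f t = g t) :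
    finitePart α β f = finitePart α β g := by
  refine finitePart_congr hα hβ hf fun t ht => ?_
  filter_upwards [isOpen_compl_singleton.mem_nhds
    (show (t : ℂ) ∈ ({z}ᶜ : Set ℂ) from fun h => hz ⟨t, ht, h⟩)] with s hs
  exact h s (sub_ne_zero.mpr hs)

/-- The zeroth moment, i.e. the finite part of `∫_0^1 t^α (1-t)^β dt`. -/
def moment (α β : ℂ) : ℂ := finitePart α β (fun _ => 1)

/-- The finite part of `∫_0^1 t^α (1-t)^β (t - z)⁻¹ dt`. -/
def cauchyKernel (α β z : ℂ) : ℂ := finitePart α β (fun t => (t - z)⁻¹)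

/-- The finite part of `∫_0^1 t^α (1-t)^β (t - z)⁻² dt`. -/
def cauchyKernelSq (α β z : ℂ) : ℂ := finitePart α β (fun t => ((t - z) ^ 2)⁻¹)

theorem finitePart_const (hα : NotNegInt α) (hβ : NotNegInt β) (c : ℂ) :
    finitePart α β (fun _ => c) = c * moment α β := by
  have := finitePart_const_mul hα hβ c (AnalyticOnUnit.const 1)
  simpa [moment] using this

theorem moment_comm (hα : NotNegInt α) (hβ : NotNegInt β) : moment β α = moment α β :=
  finitePart_one_sub hα hβ (AnalyticOnUnit.const 1)

/-- Integration by parts for the constant function `1`. Together with the functional equation of `Γ`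
it identifies the moment with a beta value. -/
theorem moment_add_one_left (hα : NotNegInt α) (hβ : NotNegInt β) :
    (α + 1) * moment α β = (α + β + 2) * moment (α + 1) β := by
  have h := finitePart_integration_by_parts hα hβ (AnalyticOnUnit.const 1)
  have e : (fun t : ℂ => ((α + 1) * (1 - t) - (β + 1) * t) * 1 + t * (1 - t) *
      deriv (fun _ : ℂ => (1 : ℂ)) t) = fun t => (α + 1) - (α + β + 2) * (t * 1) := by
    funext t; simp; ring
  rw [e, finitePart_sub hα hβ (AnalyticOnUnit.const _)
    ((AnalyticOnUnit.const _).mul (AnalyticOnUnit.id.mul (AnalyticOnUnit.const _))),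
    finitePart_const_mul hα hβ _ (AnalyticOnUnit.id.mul (AnalyticOnUnit.const _)),
    finitePart_id_mul hα hβ (AnalyticOnUnit.const _), finitePart_const hα hβ] at h
  exact sub_eq_zero.mp h

theorem cauchyKernel_one_sub (hα : NotNegInt α) (hβ : NotNegInt β) {z : ℂ} (hz : z ∈ cutᶜ) :
    cauchyKernel β α (1 - z) = -cauchyKernel α β z := by
  have h := finitePart_one_sub hα hβ (analyticOnUnit_inv_sub hz)
  have h2 := finitePart_const_mul hβ hα (-1) (analyticOnUnit_inv_sub (one_sub_mem_compl_cut hz))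
  have e : (fun t : ℂ => (1 - t - z)⁻¹) = fun t => -1 * (t - (1 - z))⁻¹ := by
    funext t
    rw [neg_one_mul, ← inv_neg]
    ring
  rw [e, h2] at h
  rw [cauchyKernel, cauchyKernel, ← h]
  ring

theorem cauchyKernelSq_one_sub (hα : NotNegInt α) (hβ : NotNegInt β) {z : ℂ} (hz : z ∈ cutᶜ) :
    cauchyKernelSq β α (1 - z) = cauchyKernelSq α β z := by
  have h := finitePart_one_sub hα hβ (analyticOnUnit_inv_sub_sq hz)
  rw [cauchyKernelSq, cauchyKernelSq, ← h]
  congr 1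
  funext t
  ring

/-- This is `t / (t - z) = 1 + z / (t - z)` under the finite part. -/
theorem finitePart_id_mul_inv_sub (hα : NotNegInt α) (hβ : NotNegInt β) {f : ℂ → ℂ}
    (hf : AnalyticOnUnit f) {z : ℂ} (hz : z ∈ cutᶜ) :
    finitePart α β (fun t => t * f t * (t - z)⁻¹)
      = finitePart α β f + z * finitePart α β (fun t => f t * (t - z)⁻¹) := by
  have h1 := hf.mul (analyticOnUnit_inv_sub hz)
  rw [← finitePart_const_mul hα hβ z h1, ← finitePart_add hα hβ hf ((AnalyticOnUnit.const z).mul h1)]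
  refine finitePart_congr_of_ne hα hβ hz ((AnalyticOnUnit.id.mul hf).mul
    (analyticOnUnit_inv_sub hz)) fun t ht => ?_
  field_simp
  ring

/-- Since `z ≠ 0` off the cut, this can be solved for the kernel with the lower exponent; it is the
inductive step of the following results. -/
theorem cauchyKernel_add_one_left (hα : NotNegInt α) (hβ : NotNegInt β) {z : ℂ} (hz : z ∈ cutᶜ) :
    cauchyKernel (α + 1) β z = moment α β + z * cauchyKernel α β z := by
  have h := finitePart_id_mul_inv_sub hα hβ (AnalyticOnUnit.const 1) hz
  simp only [mul_one, one_mul] at h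
  rw [cauchyKernel, ← finitePart_id_mul hα hβ (analyticOnUnit_inv_sub hz), h]
  rfl

theorem cauchyKernel_add_one_right (hα : NotNegInt α) (hβ : NotNegInt β) {z : ℂ}
    (hz : z ∈ cutᶜ) :
    cauchyKernel α (β + 1) z = -moment α β + (1 - z) * cauchyKernel α β z := by
  have h := cauchyKernel_add_one_left hβ hα (one_sub_mem_compl_cut hz)
  rw [cauchyKernel_one_sub hα hβ.add_one hz, cauchyKernel_one_sub hα hβ hz,
    moment_comm hα hβ] at h
  linear_combination -h

theorem cauchyKernelSq_add_one_left (hα : NotNegInt α) (hβ : NotNegInt β) {z : ℂ}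
    (hz : z ∈ cutᶜ) :
    cauchyKernelSq (α + 1) β z = cauchyKernel α β z + z * cauchyKernelSq α β z := by
  have h := finitePart_id_mul_inv_sub hα hβ (analyticOnUnit_inv_sub hz) hz
  have e : ∀ t : ℂ, (t - z)⁻¹ * (t - z)⁻¹ = ((t - z) ^ 2)⁻¹ := fun t => by
    rw [← mul_inv, sq]
  simp only [mul_assoc, e] at h
  rw [cauchyKernelSq, ← finitePart_id_mul hα hβ (analyticOnUnit_inv_sub_sq hz), h]
  rfl

/-- For properties invariant under `t ↦ 1 - t`, only the shift in the first exponent needs an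
argument. -/
theorem ladder_induction_of_symm {P : ℂ → ℂ → Prop}
    (base : ∀ α β : ℂ, 0 < α.re → 0 < β.re → P α β)
    (left : ∀ α β : ℂ, NotNegInt α → NotNegInt β → P (α + 1) β → P α β)
    (symm : ∀ α β : ℂ, NotNegInt α → NotNegInt β → P α β → P β α)
    {α β : ℂ} (hα : NotNegInt α) (hβ : NotNegInt β) : P α β :=
  ladder_induction base left (fun α β hα hβ h =>
    symm β α hβ hα (left β α hβ hα (symm α (β + 1) hα hβ.add_one h))) hα hβ

theorem continuous_weight (hα : 0 < α.re) (hβ : 0 < β.re) : Continuous (weight α β) := by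
  have h2 : Continuous (fun t : ℝ => (t : ℂ) ^ α) :=
    Complex.continuous_ofReal_cpow_const hα
  have h3 : Continuous (fun t : ℝ => (t : ℂ) ^ β) :=
    Complex.continuous_ofReal_cpow_const hβ
  have h4 : Continuous (fun t : ℝ => (((1 - t : ℝ)) : ℂ) ^ β) := h3.comp (by fun_prop)
  simp only [Complex.ofReal_sub, Complex.ofReal_one] at h4
  exact h2.mul h4

theorem hasDerivAt_cauchyKernel_of_re_pos (hα : 0 < α.re) (hβ : 0 < β.re) {z : ℂ}
    (hz : z ∈ cutᶜ) : HasDerivAt (cauchyKernel α β) (cauchyKernelSq α β z) z := by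
  have hw := continuous_weight hα hβ
  obtain ⟨r, hr, hball⟩ := Metric.isOpen_iff.mp isOpen_compl_cut z hz
  obtain ⟨K, hK⟩ := isCompact_Icc.exists_bound_of_continuousOn (hw.continuousOn (s := Set.Icc 0 1))
  have hI : Set.uIoc (0 : ℝ) 1 ⊆ Set.Icc 0 1 := by
    rw [Set.uIoc_of_le zero_le_one]; exact Set.Ioc_subset_Icc_self
  have hmem : ∀ x ∈ Metric.ball z (r / 2), x ∈ cutᶜ := fun x hx =>
    hball (Metric.ball_subset_ball (by linarith) hx)
  -- The ball of radius `r` about `z` misses the cut, so points of the half-radius ball keep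
  -- distance at least `r / 2` from it. This gives a uniform dominating constant for differentiation
  -- under the integral.
  have hlow : ∀ x ∈ Metric.ball z (r / 2), ∀ t ∈ Set.Icc (0 : ℝ) 1, r / 2 ≤ ‖(t : ℂ) - x‖ := by
    intro x hx t ht
    have h1 : r ≤ ‖(t : ℂ) - z‖ := by
      by_contra h
      exact hball (by simpa [dist_eq_norm] using h) ⟨t, ht, rfl⟩
    have h2 := norm_sub_norm_le ((t : ℂ) - z) (x - z)
    have h3 : ‖x - z‖ < r / 2 := by simpa [dist_eq_norm] using hx
    have h4 : (t : ℂ) - z - (x - z) = t - x := by ring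
    rw [h4] at h2
    linarith
  have hcont : ∀ {f : ℂ → ℂ}, AnalyticOnUnit f → ContinuousOn (fun t : ℝ => weight α β t * f t)
      (Set.Icc 0 1) := fun hf => hw.continuousOn.mul hf.continuousOn_comp_ofReal
  have hint : ∀ {f : ℂ → ℂ}, AnalyticOnUnit f → IntervalIntegrable
      (fun t : ℝ => weight α β t * f t) MeasureTheory.volume 0 1 := fun hf =>
    ContinuousOn.intervalIntegrable (by rw [Set.uIcc_of_le zero_le_one]; exact hcont hf)
  have key := (intervalIntegral.hasDerivAt_integral_of_dominated_loc_of_deriv_le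
    (μ := MeasureTheory.volume) (a := 0) (b := 1)
    (F := fun x t => weight α β t * ((t : ℂ) - x)⁻¹)
    (F' := fun x t => weight α β t * (((t : ℂ) - x) ^ 2)⁻¹) (x₀ := z)
    (bound := fun _ => K * ((r / 2) ^ 2)⁻¹)
    (Metric.ball_mem_nhds z (half_pos hr)) ?_ (hint (analyticOnUnit_inv_sub hz)) ?_ ?_ ?_ ?_).2
  · have e1 : cauchyKernelSq α β z = ∫ t in (0 : ℝ)..1, weight α β t * (((t : ℂ) - z) ^ 2)⁻¹ :=
      finitePart_eq_integral hα hβ (analyticOnUnit_inv_sub_sq hz)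
    rw [e1]
    refine key.congr_of_eventuallyEq ?_
    filter_upwards [Metric.ball_mem_nhds z (half_pos hr)] with x hx
    exact finitePart_eq_integral hα hβ (analyticOnUnit_inv_sub (hmem x hx))
  · filter_upwards [Metric.ball_mem_nhds z (half_pos hr)] with x hx
    exact ((hint (analyticOnUnit_inv_sub (hmem x hx))).def').aestronglyMeasurable
  · exact ((hint (analyticOnUnit_inv_sub_sq hz)).def').aestronglyMeasurable
  · refine Eventually.of_forall fun t ht x hx => ?_
    rw [norm_mul, norm_inv, norm_pow]
    have := hlow x hx t (hI ht)
    have := (norm_nonneg _).trans (hK t (hI ht))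
    gcongr
    exact hK t (hI ht)
  · simp
  · refine Eventually.of_forall fun t ht x hx => ?_
    have h := ofReal_sub_ne_zero (hmem x hx) (hI ht)
    have := (((hasDerivAt_id x).const_sub (t : ℂ)).inv h).const_mul (weight α β t)
    simpa [div_eq_mul_inv] using this

theorem hasDerivAt_cauchyKernel (hα : NotNegInt α) (hβ : NotNegInt β) :
    ∀ z ∈ cutᶜ, HasDerivAt (cauchyKernel α β) (cauchyKernelSq α β z) z := by
  refine ladder_induction_of_symm (P := fun α β => ∀ z ∈ cutᶜ,
    HasDerivAt (cauchyKernel α β) (cauchyKernelSq α β z) z) ?_ ?_ ?_ hα hβ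
  · intro α β hα hβ z hz
    exact hasDerivAt_cauchyKernel_of_re_pos hα hβ hz
  · intro α β hα hβ ih z hz
    have hz0 := ne_zero_of_mem_compl_cut hz
    have h := ((ih z hz).sub_const (moment α β)).div (hasDerivAt_id z) hz0
    have h' := h.congr_of_eventuallyEq (f₁ := cauchyKernel α β) (by
      filter_upwards [isOpen_compl_cut.mem_nhds hz] with x hx
      have hx0 := ne_zero_of_mem_compl_cut hx
      simp only [Pi.div_apply, id]
      rw [cauchyKernel_add_one_left hα hβ hx]
      field_simp
      ring)
    refine h'.congr_deriv ?_
    rw [cauchyKernel_add_one_left hα hβ hz, cauchyKernelSq_add_one_left hα hβ hz]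
    simp only [id]
    field_simp
    ring
  · intro α β hα hβ ih z hz
    have hd : HasDerivAt (fun z : ℂ => 1 - z) (-1) z := by
      simpa using (hasDerivAt_id z).const_sub 1
    have h := ((ih (1 - z) (one_sub_mem_compl_cut hz)).comp z hd).neg
    rw [cauchyKernelSq_one_sub hβ hα hz] at h
    refine (h.congr_of_eventuallyEq ?_).congr_deriv (by ring)
    filter_upwards [isOpen_compl_cut.mem_nhds hz] with x hx
    have := cauchyKernel_one_sub hβ hα hx
    simp [this]

theorem differentiableOn_cauchyKernel (hα : NotNegInt α) (hβ : NotNegInt β) :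
    DifferentiableOn ℂ (cauchyKernel α β) cutᶜ := fun z hz =>
  (hasDerivAt_cauchyKernel hα hβ z hz).differentiableAt.differentiableWithinAt

/-- The differential equation of the Cauchy transform. -/
theorem cauchyKernel_ode (hα : NotNegInt α) (hβ : NotNegInt β) {z : ℂ} (hz : z ∈ cutᶜ) :
    z * (1 - z) * cauchyKernelSq α β z
      = (α - (α + β) * z) * cauchyKernel α β z - (α + β + 1) * moment α β := by
  have h1 := analyticOnUnit_inv_sub hz
  have h2 := analyticOnUnit_inv_sub_sq hz
  have c := fun c => AnalyticOnUnit.const c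
  have h := finitePart_integration_by_parts hα hβ h1
  -- `d` is the coefficient of `(t - z)⁻¹` after expanding the integrand about `t = z`, with `t(1-t)
  -- = z(1-z) + (1-2z)(t-z) - (t-z)²`.
  set d : ℂ := (α + 1) - (α + β + 2) * z - (1 - 2 * z) with hd
  have e : finitePart α β (fun t => ((α + 1) * (1 - t) - (β + 1) * t) * (t - z)⁻¹
        + t * (1 - t) * deriv (fun t => (t - z)⁻¹) t)
      = finitePart α β (fun t => (d * (t - z)⁻¹ - (α + β + 1))
        - z * (1 - z) * ((t - z) ^ 2)⁻¹) := by
    refine finitePart_congr_of_ne hα hβ hz ?_ fun t ht => ?_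
    · exact ((AnalyticOnUnit.of_differentiable (by fun_prop)).mul h1).add
        ((AnalyticOnUnit.of_differentiable (by fun_prop)).mul h1.deriv)
    · have hdv : HasDerivAt (fun t => (t - z)⁻¹) (-1 / (t - z) ^ 2) t :=
        ((hasDerivAt_id t).sub_const z).inv ht
      rw [hdv.deriv, hd]
      field_simp
      ring
  have hs : AnalyticOnUnit (fun t => d * (t - z)⁻¹ - (α + β + 1)) := fun t ht =>
    (analyticAt_const.mul (h1 t ht)).sub analyticAt_const
  rw [e, finitePart_sub hα hβ hs ((c _).mul h2), finitePart_sub hα hβ ((c _).mul h1) (c _),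
    finitePart_const_mul hα hβ _ h1, finitePart_const_mul hα hβ _ h2, finitePart_const hα hβ] at h
  rw [cauchyKernel, cauchyKernelSq]
  linear_combination -h + hd * finitePart α β (fun t => (t - z)⁻¹)

/-- For positive real parts the integrand is bounded by a multiple of `|z|⁻¹`. In the downward
shifts, a bounded kernel plus or minus the moment is divided by `z` or `1 - z`, which restores the
decay. -/
theorem isBigO_cauchyKernel (hα : NotNegInt α) (hβ : NotNegInt β) :
    cauchyKernel α β =O[cocompact ℂ] fun z => z⁻¹ := by
  have hcut : ∀ᶠ z in cocompact ℂ, z ∈ cutᶜ := by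
    have := (isCompact_Icc.image Complex.continuous_ofReal : IsCompact cut).compl_mem_cocompact
    exact this
  have hlarge : ∀ R : ℝ, ∀ᶠ z in cocompact ℂ, R ≤ ‖z‖ := fun R =>
    (tendsto_norm_cocompact_atTop (E := ℂ)).eventually_ge_atTop R
  refine ladder_induction (P := fun α β => cauchyKernel α β =O[cocompact ℂ] fun z => z⁻¹)
    ?_ ?_ ?_ hα hβ
  · intro α β hα hβ
    obtain ⟨K, hK⟩ := isCompact_Icc.exists_bound_of_continuousOn
      ((continuous_weight hα hβ).continuousOn (s := Set.Icc 0 1))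
    refine IsBigO.of_bound (2 * K) ?_
    filter_upwards [hcut, hlarge 2] with z hz hz2
    rw [cauchyKernel, finitePart_eq_integral hα hβ (analyticOnUnit_inv_sub hz)]
    have := intervalIntegral.norm_integral_le_of_norm_le_const (a := 0) (b := 1)
      (C := 2 * K * ‖z⁻¹‖) (f := fun t : ℝ => weight α β t * ((t : ℂ) - z)⁻¹) ?_
    · simpa using this
    · intro t ht
      rw [Set.uIoc_of_le zero_le_one] at ht
      have hKt := hK t ⟨ht.1.le, ht.2⟩
      rw [norm_mul, norm_inv, norm_inv]
      have h3 : ‖z‖ / 2 ≤ ‖(t : ℂ) - z‖ := by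
        have := norm_sub_norm_le z (t : ℂ)
        rw [norm_sub_rev] at this
        have h4 : ‖(t : ℂ)‖ ≤ 1 := by
          rw [Complex.norm_real, Real.norm_of_nonneg ht.1.le]; exact ht.2
        linarith
      have h5 : ‖(t : ℂ) - z‖⁻¹ ≤ 2 * ‖z‖⁻¹ := by
        have : (2 : ℝ) * ‖z‖⁻¹ = (‖z‖ / 2)⁻¹ := by field_simp
        rw [this]
        exact inv_anti₀ (by linarith) h3
      calc _ ≤ K * (2 * ‖z‖⁻¹) :=
            mul_le_mul hKt h5 (inv_nonneg.mpr (norm_nonneg _)) ((norm_nonneg _).trans hKt)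
        _ = _ := by ring
  · intro α β hα hβ ih
    have h1 : (fun z : ℂ => z⁻¹) =O[cocompact ℂ] fun _ => (1 : ℂ) := by
      refine IsBigO.of_bound 1 ?_
      filter_upwards [hlarge 1] with z hz
      simpa using inv_le_one_of_one_le₀ hz
    have h2 := ((ih.trans h1).sub (isBigO_const_const (moment α β) one_ne_zero _)).mul
      (isBigO_refl (fun z : ℂ => z⁻¹) (cocompact ℂ))
    simp only [one_mul] at h2
    refine h2.congr' ?_ EventuallyEq.rfl
    filter_upwards [hcut] with z hz
    have := ne_zero_of_mem_compl_cut hz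
    rw [cauchyKernel_add_one_left hα hβ hz]
    field_simp
    ring
  · intro α β hα hβ ih
    have h0 : (fun z : ℂ => (1 - z)⁻¹) =O[cocompact ℂ] fun z => z⁻¹ := by
      refine IsBigO.of_bound 2 ?_
      filter_upwards [hlarge 2] with z hz
      rw [norm_inv, norm_inv]
      have : (2 : ℝ) * ‖z‖⁻¹ = (‖z‖ / 2)⁻¹ := by field_simp
      rw [this]
      refine inv_anti₀ (by linarith) ?_
      have := norm_sub_norm_le z 1
      rw [norm_sub_rev, norm_one] at this
      linarith
    have h1 : (fun z : ℂ => z⁻¹) =O[cocompact ℂ] fun _ => (1 : ℂ) := by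
      refine IsBigO.of_bound 1 ?_
      filter_upwards [hlarge 1] with z hz
      simpa using inv_le_one_of_one_le₀ hz
    have h2 := ((ih.trans h1).add (isBigO_const_const (moment α β) one_ne_zero _)).mul h0
    simp only [one_mul] at h2
    refine h2.congr' ?_ EventuallyEq.rfl
    filter_upwards [hcut] with z hz
    have := one_sub_ne_zero_of_mem_compl_cut hz
    rw [cauchyKernel_add_one_right hα hβ hz]
    field_simp
    ring

/-! ### Boundary values of the Cauchy transform -/

/-- The Cauchy transform is determined, up to a solution of the homogeneous equation, by its
differential equation. -/
theorem cauchyKernel_eq_of_ode (hα : NotNegInt α) (hβ : NotNegInt β) {U : Set ℂ} (hU : IsOpen U)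
    (hU' : IsPreconnected U) (hcut : U ⊆ cutᶜ) {b E E' : ℂ → ℂ} (hb : ∀ z ∈ U, b z ≠ 0)
    (hb' : ∀ z ∈ U, HasDerivAt b ((α / z - β / (1 - z)) * b z) z)
    (hE : ∀ z ∈ U, HasDerivAt E (E' z) z)
    (hode : ∀ z ∈ U, z * (1 - z) * E' z
      = (α - (α + β) * z) * E z - (α + β + 1) * moment α β) :
    ∃ c, ∀ z ∈ U, cauchyKernel α β z = c * b z + E z := by
  have hd : ∀ z ∈ U, HasDerivAt (fun z => (cauchyKernel α β z - E z) / b z) 0 z := by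
    intro z hz
    refine (((hasDerivAt_cauchyKernel hα hβ z (hcut hz)).sub (hE z hz)).div (hb' z hz)
      (hb z hz)).congr_deriv ?_
    have h0 := ne_zero_of_mem_compl_cut (hcut hz)
    have h1 := one_sub_ne_zero_of_mem_compl_cut (hcut hz)
    have h2 := hb z hz
    -- The difference with a particular solution satisfies the homogeneous equation, whose
    -- logarithmic derivative is that of `b`; hence the quotient by `b` is locally constant.
    have key : cauchyKernelSq α β z - E' z
        = (α / z - β / (1 - z)) * (cauchyKernel α β z - E z) := by
      have e1 := cauchyKernel_ode hα hβ (hcut hz)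
      have e2 := hode z hz
      have e3 : (α / z - β / (1 - z)) = (α - (α + β) * z) / (z * (1 - z)) := by
        field_simp; ring
      rw [e3, div_mul_eq_mul_div, eq_div_iff (mul_ne_zero h0 h1)]
      linear_combination e1 - e2
    rw [div_eq_zero_iff]
    left
    simp only [Pi.sub_apply]
    rw [key]
    ring
  obtain ⟨c, hc⟩ := hU.exists_is_const_of_deriv_eq_zero hU'
    (fun z hz => (hd z hz).differentiableAt.differentiableWithinAt) (fun z hz => (hd z hz).deriv)
  refine ⟨c, fun z hz => ?_⟩
  have := hc z hz
  rw [div_eq_iff (hb z hz)] at this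
  linear_combination this

theorem hasDerivAt_one_sub_cpow' {β z : ℂ} (hz : 1 - z ∈ Complex.slitPlane) :
    HasDerivAt (fun z : ℂ => (1 - z) ^ β) (-(β / (1 - z)) * (1 - z) ^ β) z := by
  have h := (((hasDerivAt_id z).const_sub 1).cpow_const (c := β) hz)
  refine h.congr_deriv ?_
  rw [id, Complex.cpow_sub _ _ (Complex.slitPlane_ne_zero hz), Complex.cpow_one]
  ring

theorem mem_slitPlane_of_mem_ball_half {z : ℂ} (hz : z ∈ Metric.ball (1 / 2 : ℂ) (1 / 2)) :
    z ∈ Complex.slitPlane ∧ 1 - z ∈ Complex.slitPlane := by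
  have h1 : ‖z - 1 / 2‖ < 1 / 2 := by simpa [dist_eq_norm] using hz
  have h2 := abs_lt.mp ((Complex.abs_re_le_norm (z - 1 / 2)).trans_lt h1)
  simp only [Complex.sub_re, Complex.div_ofNat_re, Complex.one_re] at h2
  constructor <;> left
  · linarith
  · simp only [Complex.sub_re, Complex.one_re]
    linarith

theorem ofReal_mem_ball_half {x : ℝ} (hx : x ∈ Set.Ioo (0 : ℝ) 1) :
    (x : ℂ) ∈ Metric.ball (1 / 2 : ℂ) (1 / 2) := by
  have : (x : ℂ) - 1 / 2 = ((x - 1 / 2 : ℝ) : ℂ) := by push_cast; ring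
  rw [Metric.mem_ball, dist_eq_norm, this, Complex.norm_real, Real.norm_eq_abs, abs_lt]
  constructor <;> linarith [hx.1, hx.2]

/-- On the disk with diameter `(0,1)` both factors of the weight are holomorphic, so variation of
constants solves the differential equation on the whole disk, across the cut. On the convex part of
the disk inside `H` the kernel coincides with such a solution, hence has a limit at `x`. -/
theorem exists_tendsto_cauchyKernel (hα : NotNegInt α) (hβ : NotNegInt β) {H : Set ℂ}
    (hH : IsOpen H) (hH' : Convex ℝ H) (hcut : H ⊆ cutᶜ) {x : ℝ} (hx : x ∈ Set.Ioo (0 : ℝ) 1) :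
    ∃ l, Tendsto (cauchyKernel α β) (𝓝[H] (x : ℂ)) (𝓝 l) := by
  set B := Metric.ball (1 / 2 : ℂ) (1 / 2) with hB
  set b : ℂ → ℂ := fun z => z ^ α * (1 - z) ^ β with hbdef
  have hb : ∀ z ∈ B, b z ≠ 0 := by
    intro z hz
    obtain ⟨h1, h2⟩ := mem_slitPlane_of_mem_ball_half hz
    have := Complex.slitPlane_ne_zero h1
    have := Complex.slitPlane_ne_zero h2
    simp [Complex.cpow_eq_zero_iff, *]
  have hb' : ∀ z ∈ B, HasDerivAt b ((α / z - β / (1 - z)) * b z) z := by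
    intro z hz
    obtain ⟨h1, h2⟩ := mem_slitPlane_of_mem_ball_half hz
    refine ((Complex.hasStrictDerivAt_cpow_const (c := α) h1).hasDerivAt.mul
      (hasDerivAt_one_sub_cpow' (β := β) h2)).congr_deriv ?_
    rw [Complex.cpow_sub _ _ (Complex.slitPlane_ne_zero h1), Complex.cpow_one]
    ring
  set K := (α + β + 1) * moment α β with hK
  -- A holomorphic function on a disk has a primitive; `-b R` is then a particular solution.
  obtain ⟨R, hR⟩ : ∃ R : ℂ → ℂ, ∀ z ∈ B, HasDerivAt R (K / (z * (1 - z) * b z)) z := by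
    have hd : DifferentiableOn ℂ (fun z => K / (z * (1 - z) * b z)) B := by
      intro z hz
      obtain ⟨h1, h2⟩ := mem_slitPlane_of_mem_ball_half hz
      apply DifferentiableAt.differentiableWithinAt
      apply DifferentiableAt.div (by fun_prop)
      · exact DifferentiableAt.mul (by fun_prop) (hb' z hz).differentiableAt
      · exact mul_ne_zero (mul_ne_zero (Complex.slitPlane_ne_zero h1)
          (Complex.slitPlane_ne_zero h2)) (hb z hz)
    exact hd.isExactOn_ball
  have hxB := ofReal_mem_ball_half hx
  obtain ⟨c, hc⟩ := cauchyKernel_eq_of_ode hα hβ (U := B ∩ H) (Metric.isOpen_ball.inter hH)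
    ((convex_ball _ _).inter hH').isPreconnected (fun z hz => hcut hz.2) (b := b)
    (E := fun z => -(b z * R z)) (fun z hz => hb z hz.1) (fun z hz => hb' z hz.1)
    (fun z hz => ((hb' z hz.1).mul (hR z hz.1)).neg) (by
      intro z hz
      obtain ⟨h1, h2⟩ := mem_slitPlane_of_mem_ball_half hz.1
      have h1 := Complex.slitPlane_ne_zero h1
      have h2 := Complex.slitPlane_ne_zero h2
      have h3 := hb z hz.1
      field_simp
      ring)
  refine ⟨c * b x + -(b x * R x), Tendsto.congr' ?_ (((((hb' x hxB).continuousAt.const_mul c).add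
    ((hb' x hxB).continuousAt.mul (hR x hxB).continuousAt).neg).tendsto).mono_left
      nhdsWithin_le_nhds)⟩
  filter_upwards [mem_nhdsWithin_of_mem_nhds (Metric.isOpen_ball.mem_nhds hxB),
    self_mem_nhdsWithin] with z h1 h2
  exact (hc z ⟨h1, h2⟩).symm

/-- The height is `s / c` with `c → ∞`, to match the scaling parameter of the approximate identity.
-/
theorem tendsto_vertical {x : ℝ} {s : ℝ} (H : Set ℂ)
    (h : ∀ c : ℝ, 0 < c → (x : ℂ) + (s * c⁻¹ : ℝ) * Complex.I ∈ H) :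
    Tendsto (fun c : ℝ => (x : ℂ) + (s * c⁻¹ : ℝ) * Complex.I) atTop (𝓝[H] (x : ℂ)) := by
  apply tendsto_nhdsWithin_of_tendsto_nhds_of_eventually_within
  · have h1 : Tendsto (fun c : ℝ => s * c⁻¹) atTop (𝓝 0) := by
      simpa using tendsto_inv_atTop_zero.const_mul s
    have h2 : Continuous (fun y : ℝ => (x : ℂ) + (y : ℂ) * Complex.I) := by fun_prop
    have h3 := (h2.tendsto 0).comp h1
    simpa [Function.comp_def] using h3
  · filter_upwards [eventually_gt_atTop 0] with c hc using h c hc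

/-- The Poisson kernel computes the jump of the Cauchy transform. -/
theorem tendsto_cauchyKernel_sub (hα : 0 < α.re) (hβ : 0 < β.re) {x : ℝ}
    (hx : x ∈ Set.Ioo (0 : ℝ) 1) :
    Tendsto (fun c : ℝ => cauchyKernel α β (x + (1 * c⁻¹ : ℝ) * Complex.I)
        - cauchyKernel α β (x + (-1 * c⁻¹ : ℝ) * Complex.I)) atTop
      (𝓝 (2 * (Real.pi : ℂ) * Complex.I * weight α β x)) := by
  -- Extension by zero gives an integrable function on the whole line that is still continuous at
  -- `x`.
  set g : ℝ → ℂ := (Set.Ioc (0 : ℝ) 1).indicator (weight α β) with hg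
  have hw := continuous_weight hα hβ
  have hgi : MeasureTheory.Integrable g := by
    rw [hg, MeasureTheory.integrable_indicator_iff measurableSet_Ioc]
    exact (hw.continuousOn.integrableOn_Icc).mono_set Set.Ioc_subset_Icc_self
  have hge : g =ᶠ[𝓝 x] weight α β := by
    filter_upwards [isOpen_Ioo.mem_nhds hx] with t ht
    exact Set.indicator_of_mem (Set.Ioo_subset_Ioc_self ht) _
  have hgc : ContinuousAt g x := hw.continuousAt.congr hge.symm
  -- The density `π⁻¹ / (1 + y²)` has mass one and is `o(1/|y|)`, so its rescalings form an
  -- approximate identity.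
  have hφ := tendsto_integral_comp_smul_smul_of_integrable' (μ := MeasureTheory.volume)
    (φ := fun y : ℝ => Real.pi⁻¹ * (1 + y ^ 2)⁻¹) (fun y => by positivity) (by
      rw [MeasureTheory.integral_const_mul, integral_univ_inv_one_add_sq]
      exact inv_mul_cancel₀ Real.pi_ne_zero) (by
      have h1 : Tendsto (fun y : ℝ => Real.pi⁻¹ * ‖y‖⁻¹) (Bornology.cobounded ℝ) (𝓝 0) := by
        simpa using (tendsto_inv_atTop_zero.comp
          (tendsto_norm_cobounded_atTop (E := ℝ))).const_mul Real.pi⁻¹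
      refine squeeze_zero_norm' ?_ h1
      filter_upwards [(tendsto_norm_cobounded_atTop (E := ℝ)).eventually_gt_atTop 0] with y hy
      rw [Module.finrank_self, pow_one]
      have hp := Real.pi_pos
      rw [Real.norm_of_nonneg (by positivity : 0 ≤ ‖y‖ * (Real.pi⁻¹ * (1 + y ^ 2)⁻¹)),
        Real.norm_eq_abs, ← sq_abs y]
      rw [Real.norm_eq_abs] at hy
      have : |y| * (1 + |y| ^ 2)⁻¹ ≤ |y|⁻¹ := by
        rw [← div_eq_mul_inv, div_le_iff₀ (by positivity)]
        field_simp
        linarith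
      calc _ = Real.pi⁻¹ * (|y| * (1 + |y| ^ 2)⁻¹) := by ring
        _ ≤ _ := by gcongr) hgi hgc
  rw [hge.eq_of_nhds] at hφ
  have hφ2 := hφ.const_mul (2 * (Real.pi : ℂ) * Complex.I)
  refine hφ2.congr' ?_
  filter_upwards [eventually_gt_atTop 0] with c hc
  have him : ∀ s : ℝ, s ≠ 0 → (x : ℂ) + (s * c⁻¹ : ℝ) * Complex.I ∈ cutᶜ := by
    intro s hs
    apply mem_compl_cut_of_im_ne_zero
    simp [hs, hc.ne']
  have h1 := him 1 one_ne_zero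
  have h2 := him (-1) (by norm_num)
  have hI : ∀ z ∈ cutᶜ, IntervalIntegrable (fun t : ℝ => weight α β t * ((t : ℂ) - z)⁻¹)
      MeasureTheory.volume 0 1 := fun z hz => ContinuousOn.intervalIntegrable (by
    rw [Set.uIcc_of_le zero_le_one]
    exact hw.continuousOn.mul (analyticOnUnit_inv_sub hz).continuousOn_comp_ofReal)
  have e1 : cauchyKernel α β (x + (1 * c⁻¹ : ℝ) * Complex.I) = _ :=
    finitePart_eq_integral hα hβ (analyticOnUnit_inv_sub h1)
  have e2 : cauchyKernel α β (x + (-1 * c⁻¹ : ℝ) * Complex.I) = _ :=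
    finitePart_eq_integral hα hβ (analyticOnUnit_inv_sub h2)
  rw [e1, e2, ← intervalIntegral.integral_sub (hI _ h1) (hI _ h2),
    ← MeasureTheory.integral_const_mul, intervalIntegral.integral_of_le zero_le_one,
    ← MeasureTheory.integral_indicator measurableSet_Ioc]
  congr 1
  funext t
  by_cases ht : t ∈ Set.Ioc (0 : ℝ) 1
  · rw [hg, Set.indicator_of_mem ht, Set.indicator_of_mem ht]
    have ht' : t ∈ Set.Icc (0 : ℝ) 1 := ⟨ht.1.le, ht.2⟩
    have n1 := ofReal_sub_ne_zero h1 ht'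
    have n2 := ofReal_sub_ne_zero h2 ht'
    have hc' : (c : ℂ) ≠ 0 := by exact_mod_cast hc.ne'
    have hpi : (Real.pi : ℂ) ≠ 0 := by exact_mod_cast Real.pi_ne_zero
    have n3 : (1 : ℂ) + (c * (x - t)) ^ 2 ≠ 0 := by
      have : (0 : ℝ) < 1 + (c * (x - t)) ^ 2 := by positivity
      exact_mod_cast this.ne'
    have n4 : ((t : ℂ) - (x + (1 * c⁻¹ : ℝ) * Complex.I)) * (t - (x + (-1 * c⁻¹ : ℝ) * Complex.I))
        = (1 + (c * (x - t)) ^ 2) / c ^ 2 := by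
      push_cast
      field_simp
      linear_combination -Complex.I_sq
    -- The difference of the Cauchy kernels at conjugate points is `2πi` times the rescaled density.
    have n5 : ((t : ℂ) - (x + (1 * c⁻¹ : ℝ) * Complex.I))⁻¹
        - (t - (x + (-1 * c⁻¹ : ℝ) * Complex.I))⁻¹
        = 2 * Complex.I * c / (1 + (c * (x - t)) ^ 2) := by
      rw [inv_sub_inv n1 n2, n4]
      push_cast
      field_simp
      ring
    rw [← mul_sub, n5, Module.finrank_self, pow_one, Complex.real_smul, smul_eq_mul]
    push_cast
    field_simp
  · rw [hg, Set.indicator_of_notMem ht, Set.indicator_of_notMem ht]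
    simp

/-- In the base case both one-sided limits exist by the differential equation, so it is enough to
find their difference along the vertical line through `x`. In a shift the moment cancels from the
difference, and the division by `x` or `1 - x` lowers the weight's exponent. -/
theorem cauchyKernel_jump (hα : NotNegInt α) (hβ : NotNegInt β) :
    ∀ x ∈ Set.Ioo (0 : ℝ) 1, ∃ lp lm : ℂ,
      Tendsto (cauchyKernel α β) (𝓝[{z : ℂ | 0 < z.im}] (x : ℂ)) (𝓝 lp) ∧
      Tendsto (cauchyKernel α β) (𝓝[{z : ℂ | z.im < 0}] (x : ℂ)) (𝓝 lm) ∧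
      lp - lm = 2 * (Real.pi : ℂ) * Complex.I * weight α β x := by
  have hP : {z : ℂ | 0 < z.im} ⊆ cutᶜ := fun z hz => mem_compl_cut_of_im_ne_zero (ne_of_gt hz)
  have hM : {z : ℂ | z.im < 0} ⊆ cutᶜ := fun z hz => mem_compl_cut_of_im_ne_zero (ne_of_lt hz)
  have hid : ∀ (x : ℝ) (S : Set ℂ), Tendsto (fun z : ℂ => z) (𝓝[S] (x : ℂ)) (𝓝 (x : ℂ)) :=
    fun x S => tendsto_id.mono_left nhdsWithin_le_nhds
  refine ladder_induction (P := fun α β => ∀ x ∈ Set.Ioo (0 : ℝ) 1, ∃ lp lm : ℂ,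
      Tendsto (cauchyKernel α β) (𝓝[{z : ℂ | 0 < z.im}] (x : ℂ)) (𝓝 lp) ∧
      Tendsto (cauchyKernel α β) (𝓝[{z : ℂ | z.im < 0}] (x : ℂ)) (𝓝 lm) ∧
      lp - lm = 2 * (Real.pi : ℂ) * Complex.I * weight α β x) ?_ ?_ ?_ hα hβ
  · intro α β hα hβ x hx
    have hα' := notNegInt_of_re_pos hα
    have hβ' := notNegInt_of_re_pos hβ
    obtain ⟨lp, hlp⟩ := exists_tendsto_cauchyKernel hα' hβ'
      (isOpen_lt continuous_const Complex.continuous_im) (convex_halfSpace_im_gt 0) hP hx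
    obtain ⟨lm, hlm⟩ := exists_tendsto_cauchyKernel hα' hβ'
      (isOpen_lt Complex.continuous_im continuous_const) (convex_halfSpace_im_lt 0) hM hx
    refine ⟨lp, lm, hlp, hlm, ?_⟩
    refine tendsto_nhds_unique ?_ (tendsto_cauchyKernel_sub hα hβ hx)
    refine (hlp.comp (tendsto_vertical _ fun c hc => ?_)).sub
      (hlm.comp (tendsto_vertical _ fun c hc => ?_))
    · simpa using hc
    · simpa using hc
  · intro α β hα hβ ih x hx
    obtain ⟨lp, lm, h1, h2, h3⟩ := ih x hx
    have hx0 : (x : ℂ) ≠ 0 := by exact_mod_cast hx.1.ne'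
    have key : ∀ z ∈ cutᶜ, (cauchyKernel (α + 1) β z - moment α β) / z = cauchyKernel α β z := by
      intro z hz
      have := ne_zero_of_mem_compl_cut hz
      rw [cauchyKernel_add_one_left hα hβ hz]
      field_simp
      ring
    refine ⟨(lp - moment α β) / x, (lm - moment α β) / x,
      ((h1.sub_const _).div (hid x _) hx0).congr' ?_,
      ((h2.sub_const _).div (hid x _) hx0).congr' ?_, ?_⟩
    · filter_upwards [self_mem_nhdsWithin] with z hz using key z (hP hz)
    · filter_upwards [self_mem_nhdsWithin] with z hz using key z (hM hz)
    · rw [weight, Complex.cpow_add _ _ hx0, Complex.cpow_one] at h3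
      rw [weight]
      field_simp
      linear_combination h3
  · intro α β hα hβ ih x hx
    obtain ⟨lp, lm, h1, h2, h3⟩ := ih x hx
    have hx0 : (1 : ℂ) - x ≠ 0 := by
      rw [sub_ne_zero]; exact_mod_cast hx.2.ne'
    have key : ∀ z ∈ cutᶜ,
        (cauchyKernel α (β + 1) z + moment α β) / (1 - z) = cauchyKernel α β z := by
      intro z hz
      have := one_sub_ne_zero_of_mem_compl_cut hz
      rw [cauchyKernel_add_one_right hα hβ hz]
      field_simp
      ring
    refine ⟨(lp + moment α β) / (1 - x), (lm + moment α β) / (1 - x),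
      ((h1.add_const _).div ((hid x _).const_sub 1) hx0).congr' ?_,
      ((h2.add_const _).div ((hid x _).const_sub 1) hx0).congr' ?_, ?_⟩
    · filter_upwards [self_mem_nhdsWithin] with z hz using key z (hP hz)
    · filter_upwards [self_mem_nhdsWithin] with z hz using key z (hM hz)
    · rw [weight, Complex.cpow_add _ _ hx0, Complex.cpow_one] at h3
      rw [weight]
      field_simp
      linear_combination h3

/-! ### Behaviour of the Cauchy transform at the end points -/

theorem hasDerivAt_branchZero {z : ℂ} (hz : -z ∈ Complex.slitPlane) :
    HasDerivAt (branchZero α) (α / z * branchZero α z) z := by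
  have h1 : HasDerivAt (fun z : ℂ => Complex.log (-z)) (z⁻¹) z := by
    have := (Complex.hasDerivAt_log hz).comp z (hasDerivAt_neg z)
    refine this.congr_deriv ?_
    rw [inv_neg]; ring
  have h2 := ((h1.add_const (Real.pi * Complex.I)).const_mul α).cexp
  refine h2.congr_deriv ?_
  rw [branchZero]; ring

theorem branchZero_ne_zero (α z : ℂ) : branchZero α z ≠ 0 := Complex.exp_ne_zero _

theorem neg_mem_slitPlane_of_mem_compl_cut {z : ℂ} (hz : z ∈ cutᶜ) (hz1 : ‖z‖ < 1) :
    -z ∈ Complex.slitPlane := by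
  rw [Complex.mem_slitPlane_iff]
  by_contra h
  push Not at h
  simp only [Complex.neg_re, Complex.neg_im, neg_eq_zero] at h
  have := (Complex.abs_re_le_norm z).trans_lt hz1
  exact hz ⟨z.re, ⟨by linarith [h.1], by linarith [(abs_lt.mp this).2]⟩,
    Complex.ext (by simp) (by simp [h.2])⟩

theorem mem_compl_cut_of_neg_mem_slitPlane {z : ℂ} (hz : -z ∈ Complex.slitPlane) : z ∈ cutᶜ := by
  rintro ⟨t, ht, rfl⟩
  rcases hz with h | h
  · simp at h; linarith [ht.1]
  · simp at h

/-- The reflection `z ↦ -z` turns the slit disk into one that is star-shaped about `1/2`. -/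
theorem isPreconnected_slit_ball :
    IsPreconnected (Metric.ball (0 : ℂ) 1 ∩ {z | -z ∈ Complex.slitPlane}) := by
  have h1 : StarConvex ℝ ((1 / 2 : ℝ) : ℂ) (Metric.ball (0 : ℂ) 1 ∩ Complex.slitPlane) := by
    refine StarConvex.inter ((convex_ball _ _).starConvex ?_)
      (Complex.starConvex_ofReal_slitPlane (by norm_num))
    rw [mem_ball_zero_iff, Complex.norm_real]
    norm_num [abs_of_pos]
  have hmem : ((1 / 2 : ℝ) : ℂ) ∈ Metric.ball (0 : ℂ) 1 ∩ Complex.slitPlane := by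
    refine ⟨?_, ?_⟩
    · rw [mem_ball_zero_iff, Complex.norm_real]
      norm_num [abs_of_pos]
    · left; simp
  have h2 := (h1.isPathConnected hmem).isConnected.isPreconnected
  have h3 := h2.image (fun z : ℂ => -z) continuous_neg.continuousOn
  convert h3 using 1
  ext z
  constructor
  · rintro ⟨h, h'⟩
    exact ⟨-z, ⟨by simpa using h, h'⟩, neg_neg z⟩
  · rintro ⟨w, ⟨h, h'⟩, rfl⟩
    exact ⟨by simpa using h, by simpa using h'⟩

/-- The formal power series solution of `z e' = α e - g`; if `α` is a natural number `m` there is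
an obstruction `s z^m`. -/
theorem exists_series_solution (α : ℂ) {g : ℂ → ℂ}
    (hg : DifferentiableOn ℂ g (Metric.ball 0 1)) :
    ∃ e : ℂ → ℂ, DifferentiableOn ℂ e (Metric.ball 0 1) ∧ ∃ (s : ℂ) (m : ℕ), (s = 0 ∨ α = m) ∧
      ∀ z ∈ Metric.ball (0 : ℂ) 1, z * deriv e z = α * e z - g z + s * z ^ m := by
  -- Comparison of coefficients in `z e' = α e - g`. At a resonance `k = α` the quotient is `0` by
  -- convention, so the coefficient of `g` remains as the obstruction.
  set a : ℕ → ℂ := fun k => taylorCoeff g k / (α - k) with ha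
  have hsum : ∀ z : ℂ, ‖z‖ < 1 → Summable fun k => a k * z ^ k := by
    intro z hz
    have := (summable_div_mul_pow (-α - 1) (hasSum_taylorCoeff hg hz).summable).neg
    refine this.congr fun k => ?_
    have e : (k : ℂ) + (-α - 1) + 1 = -(α - k) := by ring
    rw [e, div_neg, neg_mul, neg_neg]
  have hF : ∀ r : ℝ, 0 ≤ r → r < 1 → Summable (fun k => ‖a k * (r : ℂ) ^ k‖) ∧
      (∀ (k : ℕ), DifferentiableOn ℂ (fun w : ℂ => a k * w ^ k) (Metric.ball 0 r)) ∧
      ∀ (k : ℕ) (w : ℂ), w ∈ Metric.ball (0 : ℂ) r → ‖a k * w ^ k‖ ≤ ‖a k * (r : ℂ) ^ k‖ := by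
    intro r hr hr1
    refine ⟨(hsum r (by simpa [abs_of_nonneg hr] using hr1)).norm, fun k => by fun_prop,
      fun k w hw => ?_⟩
    rw [norm_mul, norm_mul, norm_pow, norm_pow, Complex.norm_real, Real.norm_of_nonneg hr]
    have : ‖w‖ ≤ r := by simpa using (mem_ball_zero_iff.mp hw).le
    gcongr
  have hmid : ∀ z ∈ Metric.ball (0 : ℂ) 1, ∃ r : ℝ, 0 ≤ r ∧ r < 1 ∧ z ∈ Metric.ball (0 : ℂ) r := by
    intro z hz
    rw [mem_ball_zero_iff] at hz
    obtain ⟨r, h1, h2⟩ := exists_between hz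
    exact ⟨r, (norm_nonneg z).trans h1.le, h2, by simpa using h1⟩
  set e : ℂ → ℂ := fun z => ∑' k, a k * z ^ k with he
  refine ⟨e, ?_, ?_⟩
  · intro z hz
    obtain ⟨r, hr0, hr1, hzr⟩ := hmid z hz
    obtain ⟨h1, h2, h3⟩ := hF r hr0 hr1
    exact ((Complex.differentiableOn_tsum_of_summable_norm h1 h2 Metric.isOpen_ball
      h3).differentiableAt (Metric.isOpen_ball.mem_nhds hzr)).differentiableWithinAt
  have hs : ∀ z ∈ Metric.ball (0 : ℂ) 1,
      HasSum (fun k : ℕ => ((α - k) * a k - taylorCoeff g k) * z ^ k)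
        (α * e z - z * deriv e z - g z) := by
    intro z hz
    obtain ⟨r, hr0, hr1, hzr⟩ := hmid z hz
    obtain ⟨h1, h2, h3⟩ := hF r hr0 hr1
    have k1 := (Complex.hasSum_deriv_of_summable_norm h1 h2 Metric.isOpen_ball h3 hzr).mul_left z
    have k2 := (hsum z (by simpa using hz)).hasSum.mul_left α
    have k3 := hasSum_taylorCoeff hg (z := z) (by simpa using hz)
    refine ((k2.sub k1).sub k3).congr_fun fun k => ?_
    have : deriv (fun w : ℂ => a k * w ^ k) z = a k * (k * z ^ (k - 1)) := by
      simp
    rw [this]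
    rcases k with _ | k
    · simp
    · simp only [Nat.add_sub_cancel]
      ring
  have hcoef : ∀ k : ℕ, α ≠ k → (α - k) * a k - taylorCoeff g k = 0 := by
    intro k hk
    rw [ha]
    simp only
    rw [mul_div_cancel₀ _ (sub_ne_zero.mpr hk), sub_self]
  by_cases hα : ∃ m : ℕ, α = m
  · obtain ⟨m, hm⟩ := hα
    refine ⟨taylorCoeff g m, m, Or.inr hm, fun z hz => ?_⟩
    have h := (hs z hz).unique (hasSum_single m fun k hk => by
      rw [hcoef k (by rw [hm]; exact_mod_cast hk.symm), zero_mul])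
    rw [hm, sub_self, zero_mul, zero_sub] at h
    rw [hm]
    linear_combination -h
  · push Not at hα
    refine ⟨0, 0, Or.inl rfl, fun z hz => ?_⟩
    have h := (hs z hz).unique (hasSum_zero.congr_fun fun k => by
      rw [hcoef k (hα k), zero_mul])
    linear_combination -h

/-- A positive power absorbs the logarithm of the modulus, and the argument is bounded by `π`. -/
theorem isBigO_pow_mul_log {m : ℕ} (hm : m ≠ 0) :
    (fun z : ℂ => z ^ m * Complex.log (-z)) =O[𝓝[cutᶜ] 0] fun _ => (1 : ℂ) := by
  refine IsBigO.of_bound (1 + Real.pi) ?_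
  filter_upwards [self_mem_nhdsWithin, mem_nhdsWithin_of_mem_nhds
    (Metric.ball_mem_nhds (0 : ℂ) one_pos)] with z hz hz1
  rw [mem_ball_zero_iff] at hz1
  have hz0 : 0 < ‖z‖ := norm_pos_iff.mpr (ne_zero_of_mem_compl_cut hz)
  have h1 : ‖Complex.log (-z)‖ ≤ |Real.log ‖z‖| + Real.pi := by
    refine (Complex.norm_le_abs_re_add_abs_im _).trans ?_
    rw [Complex.log_re, norm_neg, Complex.log_im]
    gcongr
    exact Complex.abs_arg_le_pi _
  have h2 := Real.abs_log_mul_self_lt ‖z‖ hz0 hz1.le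
  rw [abs_mul, abs_of_pos hz0] at h2
  rw [norm_mul, norm_pow, norm_one, mul_one]
  calc ‖z‖ ^ m * ‖Complex.log (-z)‖ ≤ ‖z‖ * (|Real.log ‖z‖| + Real.pi) := by
        gcongr
        exact pow_le_of_le_one hz0.le hz1.le hm
    _ ≤ _ := by nlinarith [Real.pi_pos]

/-- The homogeneous solutions are multiples of `z^α (1-z)^β` and supply the branch term. A
particular solution is built from a power series, with the correction `z^m log(-z)` at a resonance
`α = m`. The hypothesis `α ≠ 0` excludes a bare logarithm, so the particular solution is bounded. -/
theorem cauchyKernel_near_zero (hα : NotNegInt α) (hβ : NotNegInt β) (hα0 : α ≠ 0) :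
    ∃ h : ℂ → ℂ, AnalyticAt ℂ h 0 ∧
      (fun z => cauchyKernel α β z - branchZero α z * h z) =O[𝓝[cutᶜ] 0] fun _ => (1 : ℂ) := by
  set K := (α + β + 1) * moment α β with hK
  -- Writing a solution as `(1-z)^β ε(z)` turns the equation into `z ε' = α ε - g`.
  set g : ℂ → ℂ := fun z => K * (1 - z) ^ (-β - 1) with hgdef
  have hball : ∀ z ∈ Metric.ball (0 : ℂ) 1, 1 - z ∈ Complex.slitPlane := fun z hz =>
    one_sub_mem_slitPlane (by simpa using hz)
  have hg : DifferentiableOn ℂ g (Metric.ball 0 1) := fun z hz =>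
    ((hasDerivAt_one_sub_cpow' (hball z hz)).const_mul K).differentiableAt.differentiableWithinAt
  obtain ⟨e, he, s, m, hsm, hode⟩ := exists_series_solution α hg
  set U : Set ℂ := Metric.ball (0 : ℂ) 1 ∩ {z | -z ∈ Complex.slitPlane} with hU
  set E : ℂ → ℂ := fun z => (1 - z) ^ β * (e z - s * (z ^ m * Complex.log (-z))) with hE
  set E' : ℂ → ℂ := fun z => -(β / (1 - z)) * (1 - z) ^ β * (e z - s * (z ^ m * Complex.log (-z)))
    + (1 - z) ^ β * (deriv e z - s * (m * z ^ (m - 1) * Complex.log (-z) + z ^ m * z⁻¹)) with hE'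
  have hd : ∀ z ∈ U, HasDerivAt E (E' z) z := by
    intro z hz
    have h1 : HasDerivAt (fun z : ℂ => Complex.log (-z)) (z⁻¹) z := by
      refine ((Complex.hasDerivAt_log hz.2).comp z (hasDerivAt_neg z)).congr_deriv ?_
      rw [inv_neg]; ring
    have h2 := (he.differentiableAt (Metric.isOpen_ball.mem_nhds hz.1)).hasDerivAt
    exact (hasDerivAt_one_sub_cpow' (hball z hz.1)).mul
      (h2.sub (((hasDerivAt_pow m z).mul h1).const_mul s))
  have hEode : ∀ z ∈ U, z * (1 - z) * E' z = (α - (α + β) * z) * E z - K := by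
    intro z hz
    have h0 := ne_zero_of_mem_compl_cut (mem_compl_cut_of_neg_mem_slitPlane hz.2)
    have h1 := Complex.slitPlane_ne_zero (hball z hz.1)
    have h2 := hode z hz.1
    have h3 : (1 - z) ^ β * (1 - z) * g z = K := by
      have : (1 - z) ^ β * (1 - z) * (1 - z) ^ (-β - 1) = 1 := by
        have h1' : (1 - z) ^ β * (1 - z) = (1 - z) ^ (β + 1) := by
          rw [Complex.cpow_add _ _ h1, Complex.cpow_one]
        have e0 : β + 1 + (-β - 1) = 0 := by ring
        rw [h1', ← Complex.cpow_add _ _ h1, e0, Complex.cpow_zero]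
      rw [hgdef]
      linear_combination K * this
    have h4 : s * (m * z ^ (m - 1) * z) = s * (α * z ^ m) := by
      rcases hsm with rfl | rfl
      · simp
      · rcases m with _ | m
        · simp
        · simp only [Nat.add_sub_cancel]
          ring
    have h5 : z * (1 - z) * E' z = (1 - z) ^ β * (-β * z * (e z - s * (z ^ m * Complex.log (-z)))
        + (1 - z) * (z * deriv e z - s * (m * z ^ (m - 1) * z) * Complex.log (-z) - s * z ^ m)) := by
      rw [hE']
      field_simp
      ring
    rw [h5, h2, h4, hE, ← h3]
    ring
  have hne : ∀ z ∈ U, branchZero α z * (1 - z) ^ β ≠ 0 := by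
    intro z hz
    have := Complex.slitPlane_ne_zero (hball z hz.1)
    simp [branchZero_ne_zero, Complex.cpow_eq_zero_iff, this]
  have hopen : IsOpen U := Metric.isOpen_ball.inter
    (Complex.isOpen_slitPlane.preimage continuous_neg)
  obtain ⟨c, hc⟩ := cauchyKernel_eq_of_ode hα hβ hopen isPreconnected_slit_ball
    (fun z hz => mem_compl_cut_of_neg_mem_slitPlane hz.2)
    (b := fun z => branchZero α z * (1 - z) ^ β) (E := E) (E' := E') hne
    (fun z hz => ((hasDerivAt_branchZero hz.2).mul
      (hasDerivAt_one_sub_cpow' (hball z hz.1))).congr_deriv (by ring)) hd hEode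
  have hball0 : (0 : ℂ) ∈ Metric.ball (0 : ℂ) 1 := by simp
  have hpow : ∀ γ : ℂ, AnalyticAt ℂ (fun z : ℂ => (1 - z) ^ γ) 0 := fun γ =>
    DifferentiableOn.analyticAt (s := Metric.ball 0 1) (fun z hz =>
      (hasDerivAt_one_sub_cpow' (hball z hz)).differentiableAt.differentiableWithinAt)
      (Metric.ball_mem_nhds _ one_pos)
  refine ⟨fun z => c * (1 - z) ^ β, analyticAt_const.mul (hpow β), ?_⟩
  have hEO : E =O[𝓝[cutᶜ] 0] fun _ => (1 : ℂ) := by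
    have k1 : (fun z : ℂ => (1 - z) ^ β) =O[𝓝[cutᶜ] 0] fun _ => (1 : ℂ) :=
      ((hpow β).continuousAt.tendsto.mono_left nhdsWithin_le_nhds).isBigO_one ℂ
    have k2 : e =O[𝓝[cutᶜ] 0] fun _ => (1 : ℂ) :=
      ((he.differentiableAt (Metric.isOpen_ball.mem_nhds
        hball0)).continuousAt.tendsto.mono_left nhdsWithin_le_nhds).isBigO_one ℂ
    have k3 : (fun z => s * (z ^ m * Complex.log (-z))) =O[𝓝[cutᶜ] 0] fun _ => (1 : ℂ) := by
      rcases hsm with rfl | hm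
      · simpa using isBigO_zero (E' := ℂ) (fun _ => (1 : ℂ)) (𝓝[cutᶜ] 0)
      · refine (isBigO_pow_mul_log ?_).const_mul_left s
        rintro rfl
        exact hα0 (by simpa using hm)
    have k4 := k1.mul (k2.sub k3)
    simp only [mul_one] at k4
    exact k4
  refine hEO.congr' ?_ EventuallyEq.rfl
  filter_upwards [self_mem_nhdsWithin, mem_nhdsWithin_of_mem_nhds
    (Metric.ball_mem_nhds (0 : ℂ) one_pos)] with z hz hz1
  rw [hc z ⟨hz1, neg_mem_slitPlane_of_mem_compl_cut hz (by simpa using hz1)⟩]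
  ring

theorem tendsto_one_sub_compl_cut (x : ℂ) :
    Tendsto (fun z : ℂ => 1 - z) (𝓝[cutᶜ] x) (𝓝[cutᶜ] (1 - x)) := by
  apply tendsto_nhdsWithin_of_tendsto_nhds_of_eventually_within
  · exact ((continuous_const.sub continuous_id).tendsto x).mono_left nhdsWithin_le_nhds
  · filter_upwards [self_mem_nhdsWithin] with z hz using one_sub_mem_compl_cut hz

theorem branchZero_one_sub {β z : ℂ} (hz : z ≠ 1) :
    branchZero β (1 - z) = Complex.exp (β * (Real.pi * Complex.I)) * branchOne β z := by
  rw [branchZero, branchOne, Complex.cpow_def_of_ne_zero (sub_ne_zero.mpr hz), ← Complex.exp_add]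
  congr 1
  rw [neg_sub]
  ring

theorem cauchyKernel_near_one (hα : NotNegInt α) (hβ : NotNegInt β) (hβ0 : β ≠ 0) :
    ∃ h : ℂ → ℂ, AnalyticAt ℂ h 1 ∧
      (fun z => cauchyKernel α β z - branchOne β z * h z) =O[𝓝[cutᶜ] 1] fun _ => (1 : ℂ) := by
  obtain ⟨h, h1, h2⟩ := cauchyKernel_near_zero hβ hα hβ0
  refine ⟨fun z => -(Complex.exp (β * (Real.pi * Complex.I)) * h (1 - z)), ?_, ?_⟩
  · have h3 : AnalyticAt ℂ h (1 - 1) := by simpa using h1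
    exact (analyticAt_const.mul
      (AnalyticAt.fun_comp (f := fun s : ℂ => 1 - s) h3 (by fun_prop))).neg
  · have ht := tendsto_one_sub_compl_cut 1
    rw [sub_self] at ht
    refine ((h2.comp_tendsto ht).neg_left).congr' ?_ EventuallyEq.rfl
    filter_upwards [self_mem_nhdsWithin] with z hz
    have hz1 : z ≠ 1 := by rintro rfl; exact hz one_mem_cut
    simp only [Function.comp_apply]
    rw [cauchyKernel_one_sub hα hβ hz, branchZero_one_sub hz1]
    ring

/-! ### Cauchy transforms of polynomials -/

theorem analyticOnUnit_eval (p : Polynomial ℂ) : AnalyticOnUnit (fun t => p.eval t) :=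
  .of_differentiable p.differentiable

/-- The finite part of `∫_0^1 t^α (1-t)^β p(t) (t - z)⁻¹ dt`. -/
def polyCauchy (α β : ℂ) (p : Polynomial ℂ) (z : ℂ) : ℂ :=
  finitePart α β (fun t => p.eval t * (t - z)⁻¹)

/-- The finite part of `∫_0^1 t^α (1-t)^β p(t) dt`. -/
def polyMoment (α β : ℂ) (p : Polynomial ℂ) : ℂ := finitePart α β (fun t => p.eval t)

theorem cauchyTransform_eq (α β : ℂ) (p : Polynomial ℂ) (z : ℂ) :
    cauchyTransform α β p z = (2 * (Real.pi : ℂ) * Complex.I)⁻¹ * polyCauchy α β p z := by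
  simp only [cauchyTransform, polyCauchy, div_eq_mul_inv]

theorem polyCauchy_add (hα : NotNegInt α) (hβ : NotNegInt β) (p q : Polynomial ℂ) {z : ℂ}
    (hz : z ∈ cutᶜ) : polyCauchy α β (p + q) z = polyCauchy α β p z + polyCauchy α β q z := by
  have h := analyticOnUnit_inv_sub hz
  simp only [polyCauchy, Polynomial.eval_add, add_mul]
  exact finitePart_add hα hβ ((analyticOnUnit_eval p).mul h) ((analyticOnUnit_eval q).mul h)

theorem polyCauchy_C (hα : NotNegInt α) (hβ : NotNegInt β) (c : ℂ) {z : ℂ}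
    (hz : z ∈ cutᶜ) : polyCauchy α β (Polynomial.C c) z = c * cauchyKernel α β z := by
  simp only [polyCauchy, Polynomial.eval_C]
  exact finitePart_const_mul hα hβ c (analyticOnUnit_inv_sub hz)

theorem polyCauchy_X_mul (hα : NotNegInt α) (hβ : NotNegInt β) (p : Polynomial ℂ) {z : ℂ}
    (hz : z ∈ cutᶜ) :
    polyCauchy α β (Polynomial.X * p) z = polyMoment α β p + z * polyCauchy α β p z := by
  simp only [polyCauchy, polyMoment, Polynomial.eval_mul, Polynomial.eval_X]
  exact finitePart_id_mul_inv_sub hα hβ (analyticOnUnit_eval p) hz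

theorem polyCauchy_X_mul' (hα : NotNegInt α) (hβ : NotNegInt β) (p : Polynomial ℂ) {z : ℂ}
    (hz : z ∈ cutᶜ) :
    polyCauchy α β (Polynomial.X * p) z = polyCauchy (α + 1) β p z := by
  simp only [polyCauchy, Polynomial.eval_mul, Polynomial.eval_X, mul_assoc]
  exact finitePart_id_mul hα hβ ((analyticOnUnit_eval p).mul (analyticOnUnit_inv_sub hz))

theorem C_mul_X_pow_succ (a : ℂ) (n : ℕ) :
    Polynomial.C a * Polynomial.X ^ (n + 1)
      = Polynomial.X * (Polynomial.C a * Polynomial.X ^ n) := by ring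

/-- The remainder is the finite part of `(p(t) - p(z)) / (t - z)`, a polynomial in `z`. All analytic
questions thereby reduce to the kernel. -/
theorem exists_polyCauchy_eq (hα : NotNegInt α) (hβ : NotNegInt β) (p : Polynomial ℂ) :
    ∃ q : Polynomial ℂ, ∀ z ∈ cutᶜ,
      polyCauchy α β p z = p.eval z * cauchyKernel α β z + q.eval z := by
  induction p using Polynomial.induction_on with
  | C a => exact ⟨0, fun z hz => by simp [polyCauchy_C hα hβ a hz]⟩
  | add p q hp hq =>
    obtain ⟨p', hp⟩ := hp
    obtain ⟨q', hq⟩ := hq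
    refine ⟨p' + q', fun z hz => ?_⟩
    rw [polyCauchy_add hα hβ p q hz, hp z hz, hq z hz, Polynomial.eval_add, Polynomial.eval_add]
    ring
  | monomial n a ih =>
    obtain ⟨q, hq⟩ := ih
    refine ⟨Polynomial.C (polyMoment α β (Polynomial.C a * Polynomial.X ^ n)) + Polynomial.X * q,
      fun z hz => ?_⟩
    rw [C_mul_X_pow_succ, polyCauchy_X_mul hα hβ _ hz, hq z hz]
    simp only [Polynomial.eval_add, Polynomial.eval_mul, Polynomial.eval_C, Polynomial.eval_X]
    ring

theorem eventually_mem_compl_cut : ∀ᶠ z in cocompact ℂ, z ∈ cutᶜ :=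
  (isCompact_Icc.image Complex.continuous_ofReal : IsCompact cut).compl_mem_cocompact

/-- A factor `X` is absorbed into the weight by raising `α`, so the induction on the degree is run
for all `α` at once and the decay is never lost. -/
theorem isBigO_polyCauchy (hβ : NotNegInt β) (p : Polynomial ℂ) :
    ∀ {α : ℂ}, NotNegInt α → polyCauchy α β p =O[cocompact ℂ] fun z => z⁻¹ := by
  induction p using Polynomial.induction_on with
  | C a =>
    intro α hα
    refine ((isBigO_cauchyKernel hα hβ).const_mul_left a).congr' ?_ EventuallyEq.rfl
    filter_upwards [eventually_mem_compl_cut] with z hz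
    rw [polyCauchy_C hα hβ a hz]
  | add p q hp hq =>
    intro α hα
    refine ((hp hα).add (hq hα)).congr' ?_ EventuallyEq.rfl
    filter_upwards [eventually_mem_compl_cut] with z hz
    rw [polyCauchy_add hα hβ p q hz]
  | monomial n a ih =>
    intro α hα
    refine (ih hα.add_one).congr' ?_ EventuallyEq.rfl
    filter_upwards [eventually_mem_compl_cut] with z hz
    rw [C_mul_X_pow_succ, polyCauchy_X_mul' hα hβ _ hz]

/-- Moving one factor `z` under the integral costs one moment; each moment met on the way vanishes.
-/
theorem pow_mul_polyCauchy (hα : NotNegInt α) (hβ : NotNegInt β) (p : Polynomial ℂ) (n : ℕ)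
    (h : ∀ k < n, polyMoment α β (Polynomial.X ^ k * p) = 0) {z : ℂ} (hz : z ∈ cutᶜ) :
    z ^ n * polyCauchy α β p z = polyCauchy α β (Polynomial.X ^ n * p) z := by
  induction n with
  | zero => simp
  | succ n ih =>
    rw [pow_succ', pow_succ', mul_assoc, mul_assoc, ih fun k hk => h k (by omega),
      polyCauchy_X_mul hα hβ _ hz, h n (by omega), zero_add]

theorem isBigO_pow_mul_polyCauchy (hα : NotNegInt α) (hβ : NotNegInt β) (p : Polynomial ℂ) (n : ℕ)
    (h : ∀ k < n, polyMoment α β (Polynomial.X ^ k * p) = 0) :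
    (fun z => polyCauchy α β p z * z ^ n) =O[cocompact ℂ] fun z => z⁻¹ := by
  refine (isBigO_polyCauchy hβ (Polynomial.X ^ n * p) hα).congr' ?_ EventuallyEq.rfl
  filter_upwards [eventually_mem_compl_cut] with z hz
  rw [← pow_mul_polyCauchy hα hβ p n h hz, mul_comm]

/-- The first moment that need not vanish is, up to sign, the coefficient of `z^(-n-1)`. This fixes
the normalisation of the second row. -/
theorem isBigO_pow_mul_polyCauchy_add (hα : NotNegInt α) (hβ : NotNegInt β) (p : Polynomial ℂ)
    (n : ℕ) (h : ∀ k < n, polyMoment α β (Polynomial.X ^ k * p) = 0) :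
    (fun z => polyCauchy α β p z * z ^ (n + 1) + polyMoment α β (Polynomial.X ^ n * p))
      =O[cocompact ℂ] fun z => z⁻¹ := by
  refine (isBigO_polyCauchy hβ (Polynomial.X * (Polynomial.X ^ n * p)) hα).congr' ?_ EventuallyEq.rfl
  filter_upwards [eventually_mem_compl_cut] with z hz
  rw [polyCauchy_X_mul hα hβ _ hz, ← pow_mul_polyCauchy hα hβ p n h hz]
  ring

theorem isBigO_eval_mul_inv_pow {p : Polynomial ℂ} {n : ℕ} (hp : ∀ k, n ≤ k → p.coeff k = 0) :
    (fun z => p.eval z * (z ^ n)⁻¹) =O[cocompact ℂ] fun z => z⁻¹ := by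
  have he : ∀ z, p.eval z * (z ^ n)⁻¹ = ∑ i ∈ Finset.range n, p.coeff i * (z ^ i * (z ^ n)⁻¹) := by
    intro z
    rcases n with _ | n
    -- For `n = 0` no degree bound `natDegree < 0` is available, but then all coefficients vanish.
    · have : p = 0 := by ext k; simp [hp k (Nat.zero_le k)]
      simp [this]
    · have hd : p.natDegree < n + 1 := by
        rw [Nat.lt_succ_iff, Polynomial.natDegree_le_iff_coeff_eq_zero]
        intro k hk
        exact hp k hk
      rw [Polynomial.eval_eq_sum_range' hd, Finset.sum_mul]
      simp only [mul_assoc]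
  simp only [he]
  refine IsBigO.fun_sum fun i hi => IsBigO.const_mul_left ?_ _
  rw [Finset.mem_range] at hi
  refine IsBigO.of_bound 1 ?_
  filter_upwards [(tendsto_norm_cocompact_atTop (E := ℂ)).eventually_ge_atTop 1] with z hz
  have hz0 : 0 < ‖z‖ := by linarith
  rw [norm_mul, norm_inv, norm_inv, norm_pow, norm_pow, one_mul, ← div_eq_mul_inv,
    div_le_iff₀ (by positivity)]
  obtain ⟨m, rfl⟩ : ∃ m, n = i + 1 + m := ⟨n - (i + 1), by omega⟩
  have : ‖z‖⁻¹ * ‖z‖ ^ (i + 1 + m) = ‖z‖ ^ i * ‖z‖ ^ m := by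
    rw [pow_add, pow_succ]; field_simp
  rw [this]
  exact le_mul_of_one_le_right (by positivity) (one_le_pow₀ hz)

/-! ### Jacobi polynomials -/

theorem jacobi_zero (α β : ℂ) : jacobi α β 0 = 1 := by
  refine (jacobi_isRodrigues α β 0).unique fun x hx => ?_
  simp [inv_mul_cancel₀ (weight_ne_zero α β hx)]

/-- The first `n` derivatives in Rodrigues' formula give the shifted weight times the polynomial for
`α + 1`, `β + 1`; the last derivative is the product rule. The right side has the shape met in
integration by parts. -/
theorem jacobi_succ (α β : ℂ) (n : ℕ) :
    jacobi α β (n + 1)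
      = (Polynomial.C (α + 1) - Polynomial.C (α + β + 2) * Polynomial.X)
          * jacobi (α + 1) (β + 1) n
        + (Polynomial.X - Polynomial.X ^ 2) * Polynomial.derivative (jacobi (α + 1) (β + 1) n) := by
  refine (jacobi_isRodrigues α β (n + 1)).unique fun x hx => ?_
  have hQ := jacobi_isRodrigues (α + 1) (β + 1) n
  set Q := jacobi (α + 1) (β + 1) n
  have e2 : iteratedDeriv n
      (fun t : ℝ => ((t : ℂ) - (t : ℂ) ^ 2) ^ (n + 1) * weight α β t)
        =ᶠ[𝓝 x] fun y : ℝ => weight (α + 1) (β + 1) y * Q.eval (y : ℂ) := by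
    filter_upwards [isOpen_Ioo.mem_nhds hx] with y hy
    rw [hQ y hy, mul_inv_cancel_left₀ (weight_ne_zero _ _ hy)]
    apply Filter.EventuallyEq.iteratedDeriv_eq
    filter_upwards [isOpen_Ioo.mem_nhds hy] with t ht
    rw [weight_add_one α β ht]; ring
  have hd : deriv (fun y : ℝ => weight (α + 1) (β + 1) y * Q.eval (y : ℂ)) x = _ :=
    ((hasDerivAt_weight α β hx).mul (Q.hasDerivAt (x : ℂ)).comp_ofReal).deriv
  rw [iteratedDeriv_succ, e2.deriv_eq, hd, weight_add_one α β hx]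
  have hw := weight_ne_zero α β hx
  simp only [Polynomial.eval_add, Polynomial.eval_mul, Polynomial.eval_sub, Polynomial.eval_C,
    Polynomial.eval_X, Polynomial.eval_pow]
  field_simp
  ring

theorem leadCoeffConst_succ (α β : ℂ) (n : ℕ) :
    leadCoeffConst α β (n + 1) = -(α + β + 2 + n) * leadCoeffConst (α + 1) (β + 1) n := by
  have h : ∏ k ∈ Finset.Icc 1 (n + 1), ((k : ℂ) + (n + 1 : ℕ) + α + β)
      = (α + β + 2 + n) * ∏ k ∈ Finset.Icc 1 n, ((k : ℂ) + n + (α + 1) + (β + 1)) := by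
    rw [← Finset.Ico_add_one_right_eq_Icc, ← Finset.Ico_add_one_right_eq_Icc,
      Finset.prod_Ico_eq_prod_range, Finset.prod_Ico_eq_prod_range]
    simp only [Nat.add_sub_cancel]
    rw [Finset.prod_range_succ', mul_comm]
    congr 1
    · push_cast; ring
    · refine Finset.prod_congr rfl fun k _ => ?_
      push_cast; ring
  rw [leadCoeffConst, leadCoeffConst, h]
  ring

theorem coeff_jacobi (n : ℕ) : ∀ α β : ℂ,
    (∀ k, n < k → (jacobi α β n).coeff k = 0) ∧ (jacobi α β n).coeff n = leadCoeffConst α β n := by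
  induction n with
  | zero =>
    intro α β
    rw [jacobi_zero]
    refine ⟨fun k hk => ?_, by simp [leadCoeffConst]⟩
    rw [Polynomial.coeff_one, if_neg hk.ne']
  | succ n ih =>
    intro α β
    obtain ⟨h1, h2⟩ := ih (α + 1) (β + 1)
    rw [jacobi_succ]
    set Q := jacobi (α + 1) (β + 1) n
    have hc : ∀ k, ((Polynomial.C (α + 1) - Polynomial.C (α + β + 2) * Polynomial.X) * Q
        + (Polynomial.X - Polynomial.X ^ 2) * Polynomial.derivative Q).coeff (k + 1)
        = (α + 1) * Q.coeff (k + 1) - (α + β + 2) * Q.coeff k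
          + ((k + 1) * Q.coeff (k + 1) - k * Q.coeff k) := by
      intro k
      have e : (Polynomial.C (α + 1) - Polynomial.C (α + β + 2) * Polynomial.X) * Q
          + (Polynomial.X - Polynomial.X ^ 2) * Polynomial.derivative Q
          = Polynomial.C (α + 1) * Q - Polynomial.C (α + β + 2) * (Polynomial.X * Q)
          + (Polynomial.X * Polynomial.derivative Q
            - Polynomial.X * (Polynomial.X * Polynomial.derivative Q)) := by ring
      rw [e]
      simp only [Polynomial.coeff_add, Polynomial.coeff_sub, Polynomial.coeff_C_mul,
        Polynomial.coeff_X_mul, Polynomial.coeff_derivative]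
      rcases k with _ | k
      · simp
      · simp only [Polynomial.coeff_X_mul, Polynomial.coeff_derivative]
        push_cast
        ring
    refine ⟨fun k hk => ?_, ?_⟩
    · obtain ⟨k, rfl⟩ : ∃ m, k = m + 1 := ⟨k - 1, by omega⟩
      rw [hc, h1 (k + 1) (by omega), h1 k (by omega)]
      ring
    · rw [hc, h1 (n + 1) (by omega), h2, leadCoeffConst_succ]
      ring

/-- Rodrigues' formula integrated by parts `n` times: each step moves one derivative to `q` and
raises both exponents, with no boundary terms for the finite part. -/
theorem polyMoment_mul_jacobi (n : ℕ) : ∀ {α β : ℂ}, NotNegInt α → NotNegInt β →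
    ∀ q : Polynomial ℂ, polyMoment α β (q * jacobi α β n)
      = (-1) ^ n * polyMoment (α + n) (β + n) (Polynomial.derivative^[n] q) := by
  induction n with
  | zero => intro α β _ _ q; simp [jacobi_zero]
  | succ n ih =>
    intro α β hα hβ q
    set Q := jacobi (α + 1) (β + 1) n with hQ
    have h := finitePart_integration_by_parts hα hβ (analyticOnUnit_eval (q * Q))
    have e : (fun t => ((α + 1) * (1 - t) - (β + 1) * t) * (q * Q).eval t
        + t * (1 - t) * deriv (fun t => (q * Q).eval t) t)
        = fun t => (q * jacobi α β (n + 1)).eval t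
          + t * ((1 - t) * (Polynomial.derivative q * Q).eval t) := by
      funext t
      rw [Polynomial.deriv, jacobi_succ, ← hQ]
      simp only [Polynomial.derivative_mul, Polynomial.eval_add, Polynomial.eval_mul,
        Polynomial.eval_sub, Polynomial.eval_C, Polynomial.eval_X, Polynomial.eval_pow]
      ring
    have hd := analyticOnUnit_eval (Polynomial.derivative q * Q)
    have hd' : AnalyticOnUnit (fun t => (1 - t) * (Polynomial.derivative q * Q).eval t) :=
      (AnalyticOnUnit.of_differentiable (by fun_prop)).mul hd
    rw [e, finitePart_add hα hβ (analyticOnUnit_eval _) (AnalyticOnUnit.id.mul hd'),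
      finitePart_id_mul hα hβ hd', finitePart_one_sub_mul hα.add_one hβ hd] at h
    have h2 := ih hα.add_one hβ.add_one (Polynomial.derivative q)
    have e1 : α + 1 + (n : ℂ) = α + (n + 1 : ℕ) := by push_cast; ring
    have e2 : β + 1 + (n : ℂ) = β + (n + 1 : ℕ) := by push_cast; ring
    rw [e1, e2] at h2
    rw [Function.iterate_succ_apply, pow_succ, mul_neg_one, neg_mul, ← h2]
    exact eq_neg_of_add_eq_zero_left h

/-- For positive real parts this is Euler's beta integral. Both sides satisfy the same relation
under `α ↦ α + 1`; the condition on `α + β` keeps its factor `α + β + 2` nonzero. -/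
theorem moment_eq_betaFn (hα : NotNegInt α) (hβ : NotNegInt β) :
    (∀ k : ℕ, α + β ≠ -((k : ℂ) + 2)) → moment α β = betaFn (α + 1) (β + 1) := by
  refine ladder_induction_of_symm (P := fun α β => (∀ k : ℕ, α + β ≠ -((k : ℂ) + 2)) →
    moment α β = betaFn (α + 1) (β + 1)) ?_ ?_ ?_ hα hβ
  · intro α β hα hβ _
    have h1 : 0 < (α + 1).re := by simp; linarith
    have h2 : 0 < (β + 1).re := by simp; linarith
    have h := Complex.Gamma_mul_Gamma_eq_betaIntegral h1 h2
    have h3 : Complex.Gamma (α + 1 + (β + 1)) ≠ 0 := by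
      apply Complex.Gamma_ne_zero_of_re_pos
      simp only [Complex.add_re] at *
      linarith
    rw [betaFn, h, mul_div_cancel_left₀ _ h3, moment,
      finitePart_eq_integral hα hβ (AnalyticOnUnit.const 1), Complex.betaIntegral]
    simp [weight]
  · intro α β hα hβ ih hk
    have hα1 := hα.add_one_ne_zero
    have h0 : α + β + 2 ≠ 0 := fun h => hk 0 (by push_cast; linear_combination h)
    have h := moment_add_one_left hα hβ
    rw [ih fun k hk' => hk (k + 1) (by push_cast; linear_combination hk')] at h
    have e1 := Complex.Gamma_add_one (α + 1) hα1
    have e2 := Complex.Gamma_add_one (α + β + 2) h0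
    have e3 : α + 1 + 1 + (β + 1) = α + β + 2 + 1 := by ring
    have e4 : α + 1 + (β + 1) = α + β + 2 := by ring
    rw [betaFn, e1, e3, e2] at h
    rw [betaFn, e4]
    have : moment α β = (α + β + 2) * ((α + 1) * Complex.Gamma (α + 1) * Complex.Gamma (β + 1) /
      ((α + β + 2) * Complex.Gamma (α + β + 2))) / (α + 1) := by
      rw [← h]; field_simp
    rw [this, mul_div_assoc', mul_div_mul_left _ _ h0]
    field_simp
  · intro α β hα hβ ih hk
    rw [moment_comm hα hβ, ih fun k h => hk k (by rw [add_comm]; exact h), betaFn, betaFn,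
      add_comm (β + 1), mul_comm (Complex.Gamma (β + 1))]

theorem polyMoment_X_pow_mul_jacobi_of_lt (hα : NotNegInt α) (hβ : NotNegInt β) {k n : ℕ}
    (hk : k < n) : polyMoment α β (Polynomial.X ^ k * jacobi α β n) = 0 := by
  rw [polyMoment_mul_jacobi n hα hβ, Polynomial.iterate_derivative_eq_zero (by simpa using hk),
    polyMoment]
  simp only [Polynomial.eval_zero]
  rw [finitePart_const (hα.add_natCast n) (hβ.add_natCast n)]
  simp

theorem polyMoment_X_pow_mul_jacobi_self (hα : NotNegInt α) (hβ : NotNegInt β)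
    (hαβ : ∀ k : ℕ, α + β ≠ -((k : ℂ) + 2)) (n : ℕ) :
    polyMoment α β (Polynomial.X ^ n * jacobi α β n)
      = (-1) ^ n * (n.factorial * betaFn (α + n + 1) (β + n + 1)) := by
  rw [polyMoment_mul_jacobi n hα hβ, Polynomial.iterate_derivative_X_pow_eq_C_mul, polyMoment]
  simp only [Nat.sub_self, pow_zero, mul_one, Polynomial.eval_C, Nat.descFactorial_self]
  rw [finitePart_const (hα.add_natCast n) (hβ.add_natCast n),
    moment_eq_betaFn (hα.add_natCast n) (hβ.add_natCast n)]
  intro k hk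
  refine hαβ (k + 2 * n) ?_
  push_cast
  linear_combination hk

theorem polyMoment_C_mul (hα : NotNegInt α) (hβ : NotNegInt β) (c : ℂ) (p q : Polynomial ℂ) :
    polyMoment α β (p * (Polynomial.C c * q)) = c * polyMoment α β (p * q) := by
  rw [polyMoment, polyMoment, ← finitePart_const_mul hα hβ c (analyticOnUnit_eval _)]
  congr 1
  funext t
  simp only [Polynomial.eval_mul, Polynomial.eval_C]
  ring

theorem leadCoeffConst_ne_zero (hαβ : ∀ k : ℕ, α + β ≠ -((k : ℂ) + 2)) (n : ℕ) :
    leadCoeffConst α β n ≠ 0 := by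
  refine mul_ne_zero (pow_ne_zero _ (by norm_num)) (Finset.prod_ne_zero_iff.mpr fun k hk h => ?_)
  rw [Finset.mem_Icc] at hk
  -- The natural subtraction is exact: `1 ≤ k ≤ n` gives `k + n ≥ 2`.
  refine hαβ (k + n - 2) ?_
  have : ((k + n - 2 : ℕ) : ℂ) = k + n - 2 := by
    rw [Nat.cast_sub (by omega)]; push_cast; ring
  rw [this]
  linear_combination h

theorem betaFn_ne_zero (hα : NotNegInt α) (hβ : NotNegInt β)
    (hαβ : ∀ k : ℕ, α + β ≠ -((k : ℂ) + 2)) : betaFn (α + 1) (β + 1) ≠ 0 := by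
  refine div_ne_zero (mul_ne_zero (Complex.Gamma_ne_zero fun m h => hα m ?_)
    (Complex.Gamma_ne_zero fun m h => hβ m ?_)) (Complex.Gamma_ne_zero fun m h => hαβ m ?_)
  · linear_combination h
  · linear_combination h
  · linear_combination h

/-! ### The explicit solution solves the Riemann–Hilbert problem -/

theorem exists_cauchyTransform_eq (hα : NotNegInt α) (hβ : NotNegInt β) (c : ℂ)
    (p : Polynomial ℂ) : ∃ q : Polynomial ℂ, ∀ z ∈ cutᶜ,
      c * cauchyTransform α β p z
        = (2 * (Real.pi : ℂ) * Complex.I)⁻¹ * ((c * p.eval z) * cauchyKernel α β z)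
          + q.eval z := by
  obtain ⟨q, hq⟩ := exists_polyCauchy_eq hα hβ p
  refine ⟨Polynomial.C (c * (2 * (Real.pi : ℂ) * Complex.I)⁻¹) * q, fun z hz => ?_⟩
  rw [cauchyTransform_eq, hq z hz, Polynomial.eval_mul, Polynomial.eval_C]
  ring

/-- Both rows have the same shape, so the local conditions are checked for them together, from the
properties of the kernel alone. -/
theorem exists_explicitSolution_row (hα : NotNegInt α) (hβ : NotNegInt β) (n : ℕ) (i : Fin 2) :
    ∃ P q : Polynomial ℂ, (∀ z, explicitSolution α β n z i 0 = P.eval z) ∧ ∀ z ∈ cutᶜ,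
      explicitSolution α β n z i 1
        = (2 * (Real.pi : ℂ) * Complex.I)⁻¹ * (P.eval z * cauchyKernel α β z) + q.eval z := by
  fin_cases i
  · obtain ⟨q, hq⟩ := exists_cauchyTransform_eq hα hβ 1 (monicJacobi α β n)
    refine ⟨monicJacobi α β n, q, fun z => rfl, fun z hz => ?_⟩
    have := hq z hz
    rw [one_mul, one_mul] at this
    exact this
  · obtain ⟨q, hq⟩ := exists_cauchyTransform_eq hα hβ (normConst α β n) (monicJacobi α β (n - 1))
    refine ⟨Polynomial.C (normConst α β n) * monicJacobi α β (n - 1), q, fun z => ?_, fun z hz => ?_⟩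
    · rw [Polynomial.eval_mul, Polynomial.eval_C]
      rfl
    · rw [Polynomial.eval_mul, Polynomial.eval_C]
      exact hq z hz

theorem continuousAt_isBigO_one {f : ℂ → ℂ} {a : ℂ} (hf : ContinuousAt f a) :
    f =O[𝓝[cutᶜ] a] fun _ => (1 : ℂ) :=
  (hf.tendsto.mono_left nhdsWithin_le_nhds).isBigO_one ℂ

theorem branch_form_of_cauchyKernel {B f : ℂ → ℂ} {a : ℂ} {c : ℂ} {P q : Polynomial ℂ}
    (hK : ∃ h : ℂ → ℂ, AnalyticAt ℂ h a ∧
      (fun z => cauchyKernel α β z - B z * h z) =O[𝓝[cutᶜ] a] fun _ => (1 : ℂ))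
    (hf : ∀ z ∈ cutᶜ, f z = c * (P.eval z * cauchyKernel α β z) + q.eval z) :
    ∃ h : ℂ → ℂ, AnalyticAt ℂ h a ∧
      (fun z => f z - B z * h z) =O[𝓝[cutᶜ] a] fun _ => (1 : ℂ) := by
  obtain ⟨h, h1, h2⟩ := hK
  refine ⟨fun z => c * P.eval z * h z,
    (analyticAt_const.mul (P.differentiable.analyticAt a)).mul h1, ?_⟩
  have k1 := (continuousAt_isBigO_one (a := a) (P.continuous.continuousAt.const_mul c)).mul h2
  have k2 := k1.add (by simpa using continuousAt_isBigO_one (a := a) q.continuous.continuousAt)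
  simp only [mul_one] at k2
  refine k2.congr' ?_ EventuallyEq.rfl
  filter_upwards [self_mem_nhdsWithin] with z hz
  rw [hf z hz]
  ring

theorem betaFn_shift_ne_zero (hα : NotNegInt α) (hβ : NotNegInt β)
    (hαβ : ∀ k : ℕ, α + β ≠ -((k : ℂ) + 2)) (m : ℕ) :
    betaFn (α + m + 1) (β + m + 1) ≠ 0 := by
  refine betaFn_ne_zero (hα.add_natCast m) (hβ.add_natCast m) fun k hk => ?_
  refine hαβ (k + 2 * m) ?_
  push_cast
  linear_combination hk

/-- These are the entries of the error matrix at infinity. The first column uses degree and leading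
coefficient, the second uses orthogonality, and the last entry the value of the first nonzero
moment. -/
theorem isBigO_explicitSolution (hα : NotNegInt α) (hβ : NotNegInt β)
    (hαβ : ∀ k : ℕ, α + β ≠ -((k : ℂ) + 2)) (m : ℕ) :
    ((fun z => explicitSolution α β (m + 1) z 0 0 * (z ^ (m + 1))⁻¹ - 1)
      =O[cocompact ℂ] fun z => z⁻¹) ∧
    ((fun z => explicitSolution α β (m + 1) z 0 1 * z ^ (m + 1)) =O[cocompact ℂ] fun z => z⁻¹) ∧
    ((fun z => explicitSolution α β (m + 1) z 1 0 * (z ^ (m + 1))⁻¹)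
      =O[cocompact ℂ] fun z => z⁻¹) ∧
    ((fun z => explicitSolution α β (m + 1) z 1 1 * z ^ (m + 1) - 1)
      =O[cocompact ℂ] fun z => z⁻¹) := by
  have hlead := leadCoeffConst_ne_zero hαβ
  have hmom : ∀ n k : ℕ, k < n → polyMoment α β (Polynomial.X ^ k * monicJacobi α β n) = 0 := by
    intro n k hk
    rw [monicJacobi, polyMoment_C_mul hα hβ, polyMoment_X_pow_mul_jacobi_of_lt hα hβ hk, mul_zero]
  have h2pi : (2 * (Real.pi : ℂ) * Complex.I) ≠ 0 := Complex.two_pi_I_ne_zero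
  have hne : ∀ᶠ z in cocompact ℂ, z ≠ 0 := by
    filter_upwards [eventually_mem_compl_cut] with z hz using ne_zero_of_mem_compl_cut hz
  refine ⟨?_, ?_, ?_, ?_⟩
  · have h := isBigO_eval_mul_inv_pow (n := m + 1)
      (p := monicJacobi α β (m + 1) - Polynomial.X ^ (m + 1)) (fun k hk => by
        obtain ⟨h1, h2⟩ := coeff_jacobi (m + 1) α β
        rw [Polynomial.coeff_sub, monicJacobi, Polynomial.coeff_C_mul, Polynomial.coeff_X_pow]
        rcases hk.eq_or_lt with rfl | hk
        · rw [h2, inv_mul_cancel₀ (hlead _), if_pos rfl, sub_self]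
        · rw [h1 k hk, if_neg hk.ne']
          simp)
    refine h.congr' ?_ EventuallyEq.rfl
    filter_upwards [hne] with z hz
    have : explicitSolution α β (m + 1) z 0 0 = (monicJacobi α β (m + 1)).eval z := rfl
    rw [this, Polynomial.eval_sub, Polynomial.eval_pow, Polynomial.eval_X, sub_mul,
      mul_inv_cancel₀ (pow_ne_zero _ hz)]
  · have h := (isBigO_pow_mul_polyCauchy hα hβ (monicJacobi α β (m + 1)) (m + 1)
      (hmom _)).const_mul_left (2 * (Real.pi : ℂ) * Complex.I)⁻¹
    refine h.congr' (Eventually.of_forall fun z => ?_) EventuallyEq.rfl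
    have : explicitSolution α β (m + 1) z 0 1
      = cauchyTransform α β (monicJacobi α β (m + 1)) z := rfl
    simp only
    rw [this, cauchyTransform_eq]
    ring
  · have h := (isBigO_eval_mul_inv_pow (n := m + 1) (p := monicJacobi α β m) (fun k hk => by
        obtain ⟨h1, -⟩ := coeff_jacobi m α β
        rw [monicJacobi, Polynomial.coeff_C_mul, h1 k hk, mul_zero])).const_mul_left
          (normConst α β (m + 1))
    refine h.congr' (Eventually.of_forall fun z => ?_) EventuallyEq.rfl
    have : explicitSolution α β (m + 1) z 1 0
      = normConst α β (m + 1) * (monicJacobi α β m).eval z := rfl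
    simp only
    rw [this]
    ring
  · have h := (isBigO_pow_mul_polyCauchy_add hα hβ (monicJacobi α β m) m (hmom _)).const_mul_left
      (normConst α β (m + 1) * (2 * (Real.pi : ℂ) * Complex.I)⁻¹)
    refine h.congr' (Eventually.of_forall fun z => ?_) EventuallyEq.rfl
    have : explicitSolution α β (m + 1) z 1 1
      = normConst α β (m + 1) * cauchyTransform α β (monicJacobi α β m) z := rfl
    have hB := betaFn_shift_ne_zero hα hβ hαβ m
    have hf : (m.factorial : ℂ) ≠ 0 := by exact_mod_cast m.factorial_ne_zero
    -- This is the role of `c_n`. The value is `-1` because `1 / (t - z)` behaves like `-1 / z`.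
    have key : normConst α β (m + 1) * (2 * (Real.pi : ℂ) * Complex.I)⁻¹
        * polyMoment α β (Polynomial.X ^ m * monicJacobi α β m) = -1 := by
      rw [monicJacobi, polyMoment_C_mul hα hβ, polyMoment_X_pow_mul_jacobi_self hα hβ hαβ,
        normConst, Nat.add_sub_cancel]
      have e1 : α + ((m + 1 : ℕ) : ℂ) = α + m + 1 := by push_cast; ring
      have e2 : β + ((m + 1 : ℕ) : ℂ) = β + m + 1 := by push_cast; ring
      have e3 : ((-1 : ℂ) ^ m) * (-1) ^ m = 1 := by
        rw [← mul_pow]; simp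
      rw [e1, e2]
      have hl := hlead m
      have hpi := h2pi
      generalize 2 * (Real.pi : ℂ) * Complex.I = T at hpi ⊢
      field_simp
      linear_combination -e3
    simp only
    rw [this, cauchyTransform_eq, mul_add, key]
    ring

theorem explicitSolution_isSolution (hα : NotNegInt α) (hβ : NotNegInt β)
    (hαβ : ∀ k : ℕ, α + β ≠ -((k : ℂ) + 2)) (hα0 : α ≠ 0) (hβ0 : β ≠ 0) (n : ℕ) (hn : 1 ≤ n) :
    IsSolution α β n (explicitSolution α β n) := by
  choose P q hP hq using exists_explicitSolution_row hα hβ n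
  have h2pi : (2 * (Real.pi : ℂ) * Complex.I) ≠ 0 := Complex.two_pi_I_ne_zero
  have hleft : ∀ (i : Fin 2) (a : ℂ),
      (fun z => explicitSolution α β n z i 0) =O[𝓝[cutᶜ] a] fun _ => (1 : ℂ) := by
    intro i a
    simp only [hP]
    exact continuousAt_isBigO_one (P i).continuous.continuousAt
  refine ⟨?_, ?_, ?_, fun i => hleft i 0,
    fun i => branch_form_of_cauchyKernel (cauchyKernel_near_zero hα hβ hα0) (hq i),
    fun i => hleft i 1,
    fun i => branch_form_of_cauchyKernel (cauchyKernel_near_one hα hβ hβ0) (hq i)⟩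
  · intro i j
    apply DifferentiableOn.analyticOnNhd _ isOpen_compl_cut
    match j with
    | 0 =>
      simp only [hP]
      exact (P i).differentiable.differentiableOn
    | 1 =>
      refine DifferentiableOn.congr ?_ (hq i)
      exact (((P i).differentiable.differentiableOn.mul
        (differentiableOn_cauchyKernel hα hβ)).const_mul _).add
          (q i).differentiable.differentiableOn
  · intro x hx
    obtain ⟨lp, lm, h1, h2, h3⟩ := cauchyKernel_jump hα hβ x hx
    have hlim : ∀ (S : Set ℂ) (l : ℂ), S ⊆ cutᶜ →
        Tendsto (cauchyKernel α β) (𝓝[S] (x : ℂ)) (𝓝 l) →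
        Tendsto (explicitSolution α β n) (𝓝[S] (x : ℂ)) (𝓝 (Matrix.of fun i j =>
          if j = 0 then (P i).eval (x : ℂ) else (2 * (Real.pi : ℂ) * Complex.I)⁻¹ *
            ((P i).eval (x : ℂ) * l) + (q i).eval (x : ℂ))) := by
      intro S l hS hl
      refine tendsto_pi_nhds.mpr fun i => tendsto_pi_nhds.mpr fun j => ?_
      have hc : ∀ r : Polynomial ℂ, Tendsto (fun z => r.eval z) (𝓝[S] (x : ℂ))
          (𝓝 (r.eval (x : ℂ))) := fun r => (r.continuous.tendsto _).mono_left nhdsWithin_le_nhds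
      match j with
      | 0 => simpa [hP] using hc (P i)
      | 1 =>
        refine ((((hc (P i)).mul hl).const_mul _).add (hc (q i))).congr' ?_
        filter_upwards [self_mem_nhdsWithin] with z hz
        exact (hq i z (hS hz)).symm
    refine ⟨_, _, hlim _ lp (fun z hz => mem_compl_cut_of_im_ne_zero (ne_of_gt hz)) h1,
      hlim _ lm (fun z hz => mem_compl_cut_of_im_ne_zero (ne_of_lt hz)) h2, ?_⟩
    ext i j
    rw [Matrix.mul_apply, Fin.sum_univ_two]
    match j with
    | 0 => simp
    | 1 =>
      have h4 : lp = lm + 2 * (Real.pi : ℂ) * Complex.I * weight α β x := by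
        linear_combination h3
      simp only [Matrix.of_apply, weight, h4] at *
      simp only [one_ne_zero, if_false, if_true, Matrix.cons_val_zero, Matrix.cons_val_one,
        Matrix.cons_val', Matrix.cons_val_fin_one]
      generalize 2 * (Real.pi : ℂ) * Complex.I = T at h2pi ⊢
      field_simp
      ring
  -- With `n = m + 1` the truncated subtraction `n - 1` reduces to `m`.
  · obtain ⟨m, rfl⟩ : ∃ m, n = m + 1 := ⟨n - 1, by omega⟩
    obtain ⟨h1, h2, h3, h4⟩ := isBigO_explicitSolution hα hβ hαβ m
    refine ⟨fun z => !![explicitSolution α β (m + 1) z 0 0 * (z ^ (m + 1))⁻¹ - 1,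
      explicitSolution α β (m + 1) z 0 1 * z ^ (m + 1);
      explicitSolution α β (m + 1) z 1 0 * (z ^ (m + 1))⁻¹,
      explicitSolution α β (m + 1) z 1 1 * z ^ (m + 1) - 1], ?_, ?_⟩
    · intro i j
      match i, j with
      | 0, 0 => exact h1
      | 0, 1 => exact h2
      | 1, 0 => exact h3
      | 1, 1 => exact h4
    · filter_upwards [eventually_mem_compl_cut] with z hz
      have hz0 : z ^ (m + 1) ≠ 0 := pow_ne_zero _ (ne_zero_of_mem_compl_cut hz)
      ext i j
      rw [Matrix.mul_apply, Fin.sum_univ_two]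
      match i, j with
      | 0, 0 => simp; field_simp
      | 0, 1 => simp; field_simp
      | 1, 0 => simp; field_simp
      | 1, 1 => simp; field_simp

/-! ### Extension across the cut -/

/-- The boundary integral of a rectangle. -/
def rectIntegral (f : ℂ → ℂ) (a b s t : ℝ) : ℂ :=
  (∫ x : ℝ in a..b, f (x + s * Complex.I)) - (∫ x : ℝ in a..b, f (x + t * Complex.I))
    + Complex.I • (∫ y : ℝ in s..t, f (b + y * Complex.I))
    - Complex.I • (∫ y : ℝ in s..t, f (a + y * Complex.I))

/-- A rectangle crossing the real axis is cut along it. Each half has its interior off the axis and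
the function is continuous up to its boundary, so Cauchy's theorem applies; the two integrals along
the axis cancel. -/
theorem rectIntegral_eq_zero {f : ℂ → ℂ} {U : Set ℂ} (hc : ContinuousOn f U)
    (hd : ∀ z ∈ U, z.im ≠ 0 → DifferentiableAt ℂ f z) {a b s t : ℝ}
    (hsub : Set.uIcc a b ×ℂ Set.uIcc s t ⊆ U) : rectIntegral f a b s t = 0 := by
  have main : ∀ s t : ℝ, Set.uIcc a b ×ℂ Set.uIcc s t ⊆ U →
      (0 : ℝ) ∉ Set.Ioo (min s t) (max s t) → rectIntegral f a b s t = 0 := by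
    intro s t hsub h0
    have h := Complex.integral_boundary_rect_eq_zero_of_continuousOn_of_differentiableOn f
      ⟨a, s⟩ ⟨b, t⟩ (hc.mono hsub) (fun z hz => ?_)
    · exact h
    · refine (hd z (hsub ?_) ?_).differentiableWithinAt
      · exact ⟨Set.Ioo_subset_Icc_self hz.1, Set.Ioo_subset_Icc_self hz.2⟩
      · intro him
        apply h0
        have := hz.2
        rw [Set.mem_preimage, him] at this
        exact this
  by_cases h0 : (0 : ℝ) ∈ Set.Ioo (min s t) (max s t)
  · have hm : (0 : ℝ) ∈ Set.uIcc s t := Set.Ioo_subset_Icc_self h0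
    have h1 := main s 0 (fun z hz => hsub ⟨hz.1, Set.uIcc_subset_uIcc_left hm hz.2⟩) (by
      rintro ⟨h1, h2⟩
      rcases le_total s 0 with h | h
      · rw [max_eq_right h] at h2; exact lt_irrefl _ h2
      · rw [min_eq_right h] at h1; exact lt_irrefl _ h1)
    have h2 := main 0 t (fun z hz => hsub ⟨hz.1, Set.uIcc_subset_uIcc_right hm hz.2⟩) (by
      rintro ⟨h1, h2⟩
      rcases le_total t 0 with h | h
      · rw [max_eq_left h] at h2; exact lt_irrefl _ h2
      · rw [min_eq_left h] at h1; exact lt_irrefl _ h1)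
    have hint : ∀ c ∈ Set.uIcc a b, ∀ u v : ℝ, u ∈ Set.uIcc s t → v ∈ Set.uIcc s t →
        IntervalIntegrable (fun y : ℝ => f (c + y * Complex.I)) MeasureTheory.volume u v := by
      intro c hcm u v hu hv
      apply ContinuousOn.intervalIntegrable
      refine hc.comp (by fun_prop) fun y hy => hsub ⟨?_, ?_⟩
      · simpa using hcm
      · simpa using Set.uIcc_subset_uIcc hu hv hy
    have i1 := intervalIntegral.integral_add_adjacent_intervals
      (hint a Set.left_mem_uIcc s 0 Set.left_mem_uIcc hm)
      (hint a Set.left_mem_uIcc 0 t hm Set.right_mem_uIcc)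
    have i2 := intervalIntegral.integral_add_adjacent_intervals
      (hint b Set.right_mem_uIcc s 0 Set.left_mem_uIcc hm)
      (hint b Set.right_mem_uIcc 0 t hm Set.right_mem_uIcc)
    rw [rectIntegral] at h1 h2 ⊢
    rw [← i1, ← i2]
    simp only [smul_eq_mul] at *
    linear_combination h1 + h2
  · exact main s t hsub h0

/-- A continuous function which is holomorphic off the real line is holomorphic. -/
theorem differentiableOn_of_continuousOn_of_im_ne_zero {f : ℂ → ℂ} {U : Set ℂ} (hU : IsOpen U)
    (hc : ContinuousOn f U) (hd : ∀ z ∈ U, z.im ≠ 0 → DifferentiableAt ℂ f z) :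
    DifferentiableOn ℂ f U := by
  refine (Complex.isConservativeOn_and_continuousOn_iff_isDifferentiableOn hU).mp ⟨?_, hc⟩
  intro z w hzw
  have h := rectIntegral_eq_zero hc hd (a := z.re) (b := w.re) (s := z.im) (t := w.im) hzw
  rw [← add_eq_zero_iff_eq_neg, Complex.wedgeIntegral_add_wedgeIntegral_eq]
  exact h

theorem dense_compl_cut : Dense cutᶜ := by
  intro z
  have h : Tendsto (fun t : ℝ => z + t * Complex.I) (𝓝[≠] 0) (𝓝 z) := by
    have : Continuous (fun t : ℝ => z + t * Complex.I) := by fun_prop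
    simpa using (this.tendsto 0).mono_left nhdsWithin_le_nhds
  by_cases hz : z ∈ cutᶜ
  · exact subset_closure hz
  · refine mem_closure_of_tendsto h ?_
    filter_upwards [self_mem_nhdsWithin] with t ht
    apply mem_compl_cut_of_im_ne_zero
    obtain ⟨x, -, rfl⟩ := not_not.mp hz
    simpa using ht

/-- `f` has boundary values on both sides of `(0,1)`, and they agree. -/
def HasNoJump (f : ℂ → ℂ) : Prop := ∀ x ∈ Set.Ioo (0 : ℝ) 1, ∃ l : ℂ,
  Tendsto f (𝓝[{z : ℂ | 0 < z.im}] (x : ℂ)) (𝓝 l) ∧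
  Tendsto f (𝓝[{z : ℂ | z.im < 0}] (x : ℂ)) (𝓝 l)

/-- Near an interior point of the cut, its complement consists of the two open half-planes only. -/
theorem HasNoJump.exists_tendsto {f : ℂ → ℂ} (hf : HasNoJump f) {x : ℝ}
    (hx : x ∈ Set.Ioo (0 : ℝ) 1) : ∃ l, Tendsto f (𝓝[cutᶜ] (x : ℂ)) (𝓝 l) := by
  obtain ⟨l, h1, h2⟩ := hf x hx
  refine ⟨l, (h1.sup h2).mono_left ?_⟩
  rw [← nhdsWithin_union]
  refine nhdsWithin_le_of_mem (mem_of_superset (inter_mem_nhdsWithin cutᶜ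
    (Metric.isOpen_ball.mem_nhds (ofReal_mem_ball_half hx))) ?_)
  rintro z ⟨hz, hb⟩
  by_contra h
  have him : z.im = 0 := by
    simp only [Set.mem_union, Set.mem_ofPred_eq, not_or, not_lt] at h
    exact le_antisymm h.1 h.2
  obtain ⟨h1, h2⟩ := mem_slitPlane_of_mem_ball_half hb
  rw [Complex.mem_slitPlane_iff] at h1 h2
  simp only [him, ne_eq, not_true_eq_false, or_false, Complex.sub_re, Complex.one_re,
    Complex.sub_im, Complex.one_im, sub_self] at h1 h2
  exact hz ⟨z.re, ⟨h1.le, by linarith⟩, Complex.ext (by simp) (by simp [him])⟩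

/-- The extension by limits is continuous across `(0,1)`, hence holomorphic there by the Morera
argument. The two end points are then isolated singularities near which the function is bounded,
hence removable. -/
theorem exists_entire_extension {f : ℂ → ℂ} (hf : DifferentiableOn ℂ f cutᶜ) (hj : HasNoJump f)
    (h0 : f =O[𝓝[cutᶜ] 0] fun _ => (1 : ℂ)) (h1 : f =O[𝓝[cutᶜ] 1] fun _ => (1 : ℂ)) :
    ∃ g : ℂ → ℂ, Differentiable ℂ g ∧ ∀ z ∈ cutᶜ, g z = f z := by
  set G : ℂ → ℂ := extendFrom cutᶜ f with hG
  have hlim : ∀ z ∈ ({0, 1} : Set ℂ)ᶜ, ∃ l, Tendsto f (𝓝[cutᶜ] z) (𝓝 l) := by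
    intro z hz
    by_cases hzc : z ∈ cutᶜ
    · exact ⟨f z, (hf.continuousOn z hzc).tendsto⟩
    · obtain ⟨x, hx, rfl⟩ := not_not.mp hzc
      refine hj.exists_tendsto ⟨lt_of_le_of_ne hx.1 fun h => hz ?_,
        lt_of_le_of_ne hx.2 fun h => hz ?_⟩
      · left; simp [← h]
      · right; simp [h]
  have hGlim : ∀ z ∈ ({0, 1} : Set ℂ)ᶜ, Tendsto f (𝓝[cutᶜ] z) (𝓝 (G z)) := fun z hz =>
    tendsto_extendFrom (hlim z hz)
  have hGc : ContinuousOn G ({0, 1} : Set ℂ)ᶜ :=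
    continuousOn_extendFrom (fun z _ => dense_compl_cut z) hlim
  have hGf : ∀ z ∈ cutᶜ, G z = f z := fun z hz =>
    extendFrom_eq (dense_compl_cut z) (hf.continuousOn z hz).tendsto
  have hopen : IsOpen ({0, 1} : Set ℂ)ᶜ := (Set.toFinite _).isClosed.isOpen_compl
  have hGd : DifferentiableOn ℂ G ({0, 1} : Set ℂ)ᶜ := by
    refine differentiableOn_of_continuousOn_of_im_ne_zero hopen hGc fun z _ him => ?_
    have hz := isOpen_compl_cut.mem_nhds (mem_compl_cut_of_im_ne_zero him)
    refine (hf.differentiableAt hz).congr_of_eventuallyEq ?_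
    filter_upwards [hz] with w hw using hGf w hw
  -- The bound is known only off the cut; by density it passes to the limits that define `G` on the
  -- cut.
  have hbd : ∀ a : ℂ, f =O[𝓝[cutᶜ] a] (fun _ => (1 : ℂ)) →
      ∃ C, ∀ᶠ z in 𝓝[≠] a, z ∈ ({0, 1} : Set ℂ)ᶜ → ‖G z‖ ≤ C := by
    intro a ha
    obtain ⟨C, hC⟩ := ha.bound
    rw [eventually_nhdsWithin_iff] at hC
    refine ⟨C, ?_⟩
    filter_upwards [nhdsWithin_le_nhds hC.eventually_nhds] with z hz hz'
    have : (𝓝[cutᶜ] z).NeBot := mem_closure_iff_nhdsWithin_neBot.mp (dense_compl_cut z)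
    refine le_of_tendsto (hGlim z hz').norm ?_
    filter_upwards [nhdsWithin_le_nhds hz, self_mem_nhdsWithin] with w hw hwc
    simpa using hw hwc
  have hne0 : ∀ᶠ z in 𝓝[≠] (0 : ℂ), z ∈ ({0, 1} : Set ℂ)ᶜ := by
    filter_upwards [self_mem_nhdsWithin,
      nhdsWithin_le_nhds (isOpen_compl_singleton.mem_nhds (show (0 : ℂ) ∈ ({1} : Set ℂ)ᶜ by simp))]
      with z h1 h2
    simp only [Set.mem_compl_iff, Set.mem_insert_iff, Set.mem_singleton_iff, not_or] at *
    exact ⟨h1, h2⟩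
  have hne1 : ∀ᶠ z in 𝓝[≠] (1 : ℂ), z ∈ ({0, 1} : Set ℂ)ᶜ := by
    filter_upwards [self_mem_nhdsWithin,
      nhdsWithin_le_nhds (isOpen_compl_singleton.mem_nhds (show (1 : ℂ) ∈ ({0} : Set ℂ)ᶜ by simp))]
      with z h1 h2
    simp only [Set.mem_compl_iff, Set.mem_insert_iff, Set.mem_singleton_iff, not_or] at *
    exact ⟨h2, h1⟩
  have hlo : ∀ (g : ℂ → ℂ) (a : ℂ) (C : ℝ), (∀ᶠ z in 𝓝[≠] a, ‖g z‖ ≤ C) →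
      (fun z => g z - g a) =o[𝓝[≠] a] fun z => (z - a)⁻¹ := by
    intro g a C h
    refine IsBoundedUnder.isLittleO_sub_self_inv ⟨C + ‖g a‖, eventually_map.mpr ?_⟩
    filter_upwards [h] with z hz
    exact norm_sub_le_of_le hz le_rfl
  obtain ⟨C0, hC0⟩ := hbd 0 h0
  obtain ⟨C1, hC1⟩ := hbd 1 h1
  set G1 := Function.update G 0 (limUnder (𝓝[≠] 0) G) with hG1
  have hG1d : DifferentiableOn ℂ G1 ({1} : Set ℂ)ᶜ := by
    refine Complex.differentiableOn_update_limUnder_of_isLittleO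
      (isOpen_compl_singleton.mem_nhds (by simp)) (hGd.mono ?_) (hlo G 0 C0 ?_)
    · rintro z ⟨h1, h2⟩
      simp only [Set.mem_compl_iff, Set.mem_insert_iff, Set.mem_singleton_iff, not_or] at *
      exact ⟨h2, h1⟩
    · filter_upwards [hC0, hne0] with z h1 h2 using h1 h2
  have hG1G : ∀ z, z ≠ 0 → G1 z = G z := fun z hz => Function.update_of_ne hz _ _
  set G2 := Function.update G1 1 (limUnder (𝓝[≠] 1) G1) with hG2
  have hG2d : DifferentiableOn ℂ G2 Set.univ := by
    refine Complex.differentiableOn_update_limUnder_of_isLittleO univ_mem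
      (hG1d.mono fun z hz => hz.2) (hlo G1 1 C1 ?_)
    filter_upwards [hC1, hne1] with z h1 h2
    rw [hG1G z (fun h => h2 (Or.inl h))]
    exact h1 h2
  refine ⟨G2, differentiableOn_univ.mp hG2d, fun z hz => ?_⟩
  have hz1 : z ≠ 1 := by rintro rfl; exact hz one_mem_cut
  rw [hG2, Function.update_of_ne hz1, hG1G z (ne_zero_of_mem_compl_cut hz), hGf z hz]

/-! ### Functions without jump are bounded at the end points -/

theorem branchZero_of_im_pos {α z : ℂ} (hz : 0 < z.im) :
    branchZero α z = Complex.exp (α * Complex.log z) := by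
  rw [branchZero, Complex.log, Complex.log, norm_neg,
    Complex.arg_neg_eq_arg_sub_pi_of_im_pos hz]
  congr 1
  push_cast
  ring

/-- Compared with the upper half-plane the branch gains the factor `exp (2πiα)`, which is its jump
across the positive axis. -/
theorem branchZero_of_im_neg {α z : ℂ} (hz : z.im < 0) :
    branchZero α z = Complex.exp (2 * Real.pi * Complex.I * α) * Complex.exp (α * Complex.log z) := by
  rw [branchZero, Complex.log, Complex.log, norm_neg,
    Complex.arg_neg_eq_arg_add_pi_of_im_neg hz, ← Complex.exp_add]
  congr 1
  push_cast
  ring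

theorem norm_branchZero_le (α : ℂ) {z : ℂ} (hz : z ≠ 0) :
    ‖branchZero α z‖ ≤ Real.exp (2 * Real.pi * |α.im|) * ‖z‖ ^ α.re := by
  have hz0 : 0 < ‖z‖ := norm_pos_iff.mpr hz
  rw [branchZero, Complex.norm_exp, Real.rpow_def_of_pos hz0, ← Real.exp_add, Real.exp_le_exp]
  simp only [Complex.mul_re, Complex.add_re, Complex.add_im, Complex.log_re, Complex.log_im,
    norm_neg, Complex.ofReal_re, Complex.ofReal_im, Complex.I_re, Complex.I_im, mul_zero,
    mul_one, Complex.mul_im, sub_self, add_zero]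
  have h1 := Complex.neg_pi_lt_arg (-z)
  have h2 := Complex.arg_le_pi (-z)
  have h3 : |Complex.arg (-z) + Real.pi| ≤ 2 * Real.pi := by
    rw [abs_le]; constructor <;> linarith
  have h4 : -(α.im * (Complex.arg (-z) + Real.pi)) ≤ |α.im| * (2 * Real.pi) := by
    refine (neg_le_abs _).trans ?_
    rw [abs_mul]
    gcongr
  linarith

theorem norm_ofReal_exp_log (α : ℂ) {x : ℝ} (hx : 0 < x) :
    ‖Complex.exp (α * Complex.log x)‖ = x ^ α.re := by
  rw [mul_comm, ← Complex.cpow_def_of_ne_zero (by exact_mod_cast hx.ne'),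
    Complex.norm_cpow_eq_rpow_re_of_pos hx]

/-- An analytic function is comparable to its values on the positive axis. -/
theorem eventually_norm_le_norm_ofReal {H : ℂ → ℂ} (hH : AnalyticAt ℂ H 0) :
    ∀ᶠ z in 𝓝 (0 : ℂ), ‖H z‖ ≤ 3 * ‖H (‖z‖ : ℝ)‖ := by
  have ht : Tendsto (fun z : ℂ => ((‖z‖ : ℝ) : ℂ)) (𝓝 0) (𝓝 0) := by
    have : Continuous (fun z : ℂ => ((‖z‖ : ℝ) : ℂ)) := by fun_prop
    simpa using this.tendsto 0
  by_cases h : ∀ᶠ z in 𝓝 (0 : ℂ), H z = 0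
  · filter_upwards [h] with z hz
    rw [hz]
    simp
  -- `H` is `z^k` times a function `u` not vanishing at `0`. Near `0`, `|u|` lies between `1/2` and
  -- `3/2` of `|u(0)|`, whence the ratio `3`.
  · obtain ⟨k, u, hu, hu0, hHu⟩ := hH.exists_eventuallyEq_pow_smul_nonzero_iff.mpr h
    have hpos : 0 < ‖u 0‖ := norm_pos_iff.mpr hu0
    have hup : ∀ᶠ z in 𝓝 (0 : ℂ), ‖u z‖ < 3 / 2 * ‖u 0‖ :=
      hu.continuousAt.norm.eventually_lt continuousAt_const (by linarith)
    have hlow : ∀ᶠ z in 𝓝 (0 : ℂ), 1 / 2 * ‖u 0‖ < ‖u z‖ :=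
      continuousAt_const.eventually_lt hu.continuousAt.norm (by linarith)
    filter_upwards [hHu, ht.eventually hHu, hup, ht.eventually hlow] with z h1 h2 h3 h4
    rw [h1, h2]
    simp only [sub_zero, norm_smul, norm_pow, Complex.norm_real, norm_norm]
    have : ‖u z‖ ≤ 3 * ‖u (‖z‖ : ℝ)‖ := by linarith
    calc ‖z‖ ^ k * ‖u z‖ ≤ ‖z‖ ^ k * (3 * ‖u (‖z‖ : ℝ)‖) := by gcongr
      _ = _ := by ring

/-- On the positive axis the two boundary values of `z^α H` are both within `C` of the common limit
of `f`, so `(1 - exp (2πiα)) x^α H(x)` is bounded by `2C`. If the factor is nonzero, this bounds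
`z^α H` on the axis, and then around `0` since `|H(z)| ≤ 3 |H(|z|)|`. If it is zero, `α` is an
integer, hence nonnegative by hypothesis, and `z^α` itself is bounded. -/
theorem isBigO_one_of_branchZero {α : ℂ} (hα : NotNegInt α) {f H : ℂ → ℂ} (hj : HasNoJump f)
    (hH : AnalyticAt ℂ H 0)
    (h : (fun z => f z - branchZero α z * H z) =O[𝓝[cutᶜ] 0] fun _ => (1 : ℂ)) :
    f =O[𝓝[cutᶜ] 0] fun _ => (1 : ℂ) := by
  suffices hb : (fun z => branchZero α z * H z) =O[𝓝[cutᶜ] 0] fun _ => (1 : ℂ) by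
    refine (h.add hb).congr_left fun z => ?_
    ring
  set q := Complex.exp (2 * Real.pi * Complex.I * α) with hq
  set A := Real.exp (2 * Real.pi * |α.im|) with hA
  by_cases hq1 : q = 1
  · obtain ⟨m, hm⟩ := Complex.exp_eq_one_iff.mp hq1
    have hm' : α = m := by
      have h2 : (2 * (Real.pi : ℂ) * Complex.I) ≠ 0 := Complex.two_pi_I_ne_zero
      apply mul_left_cancel₀ h2
      linear_combination hm
    have hm0 : 0 ≤ m := by
      by_contra hneg
      obtain ⟨k, hk⟩ := Int.eq_negSucc_of_lt_zero (not_le.mp hneg)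
      apply hα k
      rw [hm', hk]
      push_cast
      ring
    have hre : 0 ≤ α.re := by
      rw [hm']
      simpa using hm0
    have h1 : branchZero α =O[𝓝[cutᶜ] 0] fun _ => (1 : ℂ) := by
      refine IsBigO.of_bound A ?_
      filter_upwards [self_mem_nhdsWithin, mem_nhdsWithin_of_mem_nhds
        (Metric.ball_mem_nhds (0 : ℂ) one_pos)] with z hz hz1
      refine (norm_branchZero_le α (ne_zero_of_mem_compl_cut hz)).trans ?_
      rw [norm_one]
      have : ‖z‖ ≤ 1 := by simpa using (mem_ball_zero_iff.mp hz1).le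
      have := Real.rpow_le_one (norm_nonneg z) this hre
      have := Real.exp_pos (2 * Real.pi * |α.im|)
      gcongr
    simpa using h1.mul (continuousAt_isBigO_one hH.continuousAt)
  · obtain ⟨C, hC⟩ := h.bound
    rw [eventually_nhdsWithin_iff] at hC
    have hq0 : 0 < ‖1 - q‖ := norm_pos_iff.mpr (sub_ne_zero.mpr (Ne.symm hq1))
    -- Phrased as an eventual property of a complex point so that it can be pulled back along `z ↦
    -- ‖z‖`.
    have haxis : ∀ᶠ z : ℂ in 𝓝 0, ∀ x : ℝ, z = (x : ℂ) → 0 < x → x < 1 →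
        x ^ α.re * ‖H x‖ ≤ 2 * C / ‖1 - q‖ := by
      filter_upwards [hC.eventually_nhds, hH.eventually_analyticAt] with z hz hzH x hzx hx hx1
      subst hzx
      obtain ⟨l, hl1, hl2⟩ := hj x ⟨hx, hx1⟩
      have hlog : ContinuousAt (fun z => Complex.exp (α * Complex.log z) * H z) (x : ℂ) := by
        refine ContinuousAt.mul ?_ hzH.continuousAt
        exact (continuousAt_const.mul (continuousAt_clog (Or.inl (by simpa using hx)))).cexp
      have b1 : ‖l - Complex.exp (α * Complex.log x) * H x‖ ≤ C := by
        have : (𝓝[{z : ℂ | 0 < z.im}] (x : ℂ)).NeBot := by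
          refine mem_closure_iff_nhdsWithin_neBot.mp ?_
          rw [Complex.closure_setOfPred_lt_im]
          simp
        refine le_of_tendsto (hl1.sub (hlog.tendsto.mono_left nhdsWithin_le_nhds)).norm ?_
        filter_upwards [nhdsWithin_le_nhds hz, self_mem_nhdsWithin] with w hw him
        have := hw (mem_compl_cut_of_im_ne_zero (ne_of_gt him))
        rwa [branchZero_of_im_pos him, norm_one, mul_one] at this
      have b2 : ‖l - q * (Complex.exp (α * Complex.log x) * H x)‖ ≤ C := by
        have : (𝓝[{z : ℂ | z.im < 0}] (x : ℂ)).NeBot := by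
          refine mem_closure_iff_nhdsWithin_neBot.mp ?_
          rw [Complex.closure_setOfPred_im_lt]
          simp
        refine le_of_tendsto (hl2.sub ((hlog.tendsto.mono_left
          nhdsWithin_le_nhds).const_mul q)).norm ?_
        filter_upwards [nhdsWithin_le_nhds hz, self_mem_nhdsWithin] with w hw him
        have := hw (mem_compl_cut_of_im_ne_zero (ne_of_lt him))
        rwa [branchZero_of_im_neg him, norm_one, mul_one, ← hq, mul_assoc] at this
      have b3 : ‖(1 - q) * (Complex.exp (α * Complex.log x) * H x)‖ ≤ 2 * C := by
        have e : (1 - q) * (Complex.exp (α * Complex.log x) * H x)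
            = (l - q * (Complex.exp (α * Complex.log x) * H x))
              - (l - Complex.exp (α * Complex.log x) * H x) := by ring
        rw [e]
        refine (norm_sub_le_of_le b2 b1).trans (by linarith)
      rw [norm_mul, norm_mul, norm_ofReal_exp_log α hx] at b3
      rw [le_div_iff₀ hq0]
      linarith
    have ht : Tendsto (fun z : ℂ => ((‖z‖ : ℝ) : ℂ)) (𝓝 0) (𝓝 0) := by
      have : Continuous (fun z : ℂ => ((‖z‖ : ℝ) : ℂ)) := by fun_prop
      simpa using this.tendsto 0
    refine IsBigO.of_bound (A * (3 * (2 * C / ‖1 - q‖))) ?_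
    filter_upwards [self_mem_nhdsWithin, nhdsWithin_le_nhds (ht.eventually haxis),
      nhdsWithin_le_nhds (eventually_norm_le_norm_ofReal hH), mem_nhdsWithin_of_mem_nhds
        (Metric.ball_mem_nhds (0 : ℂ) one_pos)] with z hz h1 h2 h3
    have hz0 := ne_zero_of_mem_compl_cut hz
    have k1 := h1 ‖z‖ rfl (norm_pos_iff.mpr hz0) (by simpa using h3)
    rw [norm_mul, norm_one, mul_one]
    have hp := Real.rpow_nonneg (norm_nonneg z) α.re
    calc ‖branchZero α z‖ * ‖H z‖ ≤ (A * ‖z‖ ^ α.re) * (3 * ‖H (‖z‖ : ℝ)‖) := by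
          gcongr
          exact norm_branchZero_le α hz0
      _ = A * (3 * (‖z‖ ^ α.re * ‖H (‖z‖ : ℝ)‖)) := by ring
      _ ≤ _ := by
          have : 0 ≤ A := (Real.exp_pos _).le
          gcongr

theorem isBigO_one_of_branchOne {β : ℂ} (hβ : NotNegInt β) {f H : ℂ → ℂ} (hj : HasNoJump f)
    (hH : AnalyticAt ℂ H 1)
    (h : (fun z => f z - branchOne β z * H z) =O[𝓝[cutᶜ] 1] fun _ => (1 : ℂ)) :
    f =O[𝓝[cutᶜ] 1] fun _ => (1 : ℂ) := by
  have ht0 := tendsto_one_sub_compl_cut 0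
  rw [sub_zero] at ht0
  have ht1 := tendsto_one_sub_compl_cut 1
  rw [sub_self] at ht1
  have key := isBigO_one_of_branchZero hβ (f := fun z => f (1 - z))
    (H := fun z => Complex.exp (-(β * (Real.pi * Complex.I))) * H (1 - z)) ?_ ?_ ?_
  · refine (key.comp_tendsto ht1).congr_left fun z => ?_
    simp
  · intro x hx
    obtain ⟨l, h1, h2⟩ := hj (1 - x) ⟨by linarith [hx.2], by linarith [hx.1]⟩
    have ht : ∀ S T : Set ℂ, (∀ z ∈ S, 1 - z ∈ T) →
        Tendsto (fun z : ℂ => 1 - z) (𝓝[S] (x : ℂ)) (𝓝[T] ((1 - x : ℝ) : ℂ)) := by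
      intro S T hST
      apply tendsto_nhdsWithin_of_tendsto_nhds_of_eventually_within
      · push_cast
        exact ((continuous_const.sub continuous_id).tendsto _).mono_left nhdsWithin_le_nhds
      · filter_upwards [self_mem_nhdsWithin] with z hz using hST z hz
    refine ⟨l, h2.comp (ht _ _ fun z hz => ?_), h1.comp (ht _ _ fun z hz => ?_)⟩
    · simpa using hz
    · simpa using hz
  · have h3 : AnalyticAt ℂ H (1 - 0) := by simpa using hH
    exact analyticAt_const.mul (AnalyticAt.fun_comp (f := fun s : ℂ => 1 - s) h3 (by fun_prop))
  · refine (h.comp_tendsto ht0).congr' ?_ EventuallyEq.rfl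
    filter_upwards [self_mem_nhdsWithin] with z hz
    have hz1 : 1 - z ≠ 1 := fun h => ne_zero_of_mem_compl_cut hz (by simpa using h)
    have e := branchZero_one_sub (β := β) hz1
    rw [sub_sub_cancel] at e
    simp only [Function.comp_apply]
    rw [e, Complex.exp_neg]
    have := Complex.exp_ne_zero (β * (Real.pi * Complex.I))
    field_simp

/-! ### Uniqueness -/

variable {n : ℕ} {Y Z : ℂ → Matrix (Fin 2) (Fin 2) ℂ}

theorem tendsto_entry {F : Filter ℂ} {M : Matrix (Fin 2) (Fin 2) ℂ} (h : Tendsto Y F (𝓝 M))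
    (i j : Fin 2) : Tendsto (fun z => Y z i j) F (𝓝 (M i j)) :=
  tendsto_pi_nhds.mp (tendsto_pi_nhds.mp h i) j

theorem IsSolution.differentiableOn (hY : IsSolution α β n Y) (i j : Fin 2) :
    DifferentiableOn ℂ (fun z => Y z i j) cutᶜ := (hY.analytic i j).differentiableOn

/-- The entries of the first column have no jump; those of the second jump by the weight times
those of the first. -/
theorem IsSolution.exists_boundary_values (hY : IsSolution α β n Y) {x : ℝ}
    (hx : x ∈ Set.Ioo (0 : ℝ) 1) : ∃ (w : Fin 2 → ℂ) (p m : Fin 2 → ℂ), ∀ i,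
      Tendsto (fun z => Y z i 0) (𝓝[{z : ℂ | 0 < z.im}] (x : ℂ)) (𝓝 (w i)) ∧
      Tendsto (fun z => Y z i 0) (𝓝[{z : ℂ | z.im < 0}] (x : ℂ)) (𝓝 (w i)) ∧
      Tendsto (fun z => Y z i 1) (𝓝[{z : ℂ | 0 < z.im}] (x : ℂ)) (𝓝 (p i)) ∧
      Tendsto (fun z => Y z i 1) (𝓝[{z : ℂ | z.im < 0}] (x : ℂ)) (𝓝 (m i)) ∧
      p i = m i + weight α β x * w i := by
  obtain ⟨P, M, hP, hM, hPM⟩ := hY.jump x hx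
  have h0 : ∀ i, P i 0 = M i 0 := fun i => by
    rw [hPM, Matrix.mul_apply, Fin.sum_univ_two]; simp
  have h1 : ∀ i, P i 1 = M i 1 + weight α β x * M i 0 := fun i => by
    rw [hPM, Matrix.mul_apply, Fin.sum_univ_two]; simp [weight]; ring
  refine ⟨fun i => M i 0, fun i => P i 1, fun i => M i 1, fun i => ⟨?_, tendsto_entry hM i 0,
    tendsto_entry hP i 1, tendsto_entry hM i 1, h1 i⟩⟩
  simpa [h0] using tendsto_entry hP i 0

/-- Boundedness of the first column alone would not do later: its entries multiply the analytic
coefficients of the branch terms, and the products must be analytic at the end points. -/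
theorem IsSolution.exists_entire (hY : IsSolution α β n Y) (i : Fin 2) :
    ∃ g : ℂ → ℂ, Differentiable ℂ g ∧ ∀ z ∈ cutᶜ, g z = Y z i 0 := by
  refine exists_entire_extension (hY.differentiableOn i 0) (fun x hx => ?_)
    (hY.atZero_left i) (hY.atOne_left i)
  obtain ⟨w, p, m, h⟩ := hY.exists_boundary_values hx
  exact ⟨w i, (h i).1, (h i).2.1⟩

/-- The bilinear expressions in two solutions that make up the entries of `Y Z⁻¹`. -/
def crossEntry (Y Z : ℂ → Matrix (Fin 2) (Fin 2) ℂ) (i k : Fin 2) (z : ℂ) : ℂ :=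
  Y z i 0 * Z z k 1 - Y z i 1 * Z z k 0

/-- Each second-column entry jumps by the weight times its first-column neighbour; in the
antisymmetric combination the two contributions cancel. -/
theorem hasNoJump_crossEntry (hY : IsSolution α β n Y) (hZ : IsSolution α β n Z) (i k : Fin 2) :
    HasNoJump (crossEntry Y Z i k) := by
  intro x hx
  obtain ⟨w, p, m, h⟩ := hY.exists_boundary_values hx
  obtain ⟨w', p', m', h'⟩ := hZ.exists_boundary_values hx
  obtain ⟨h1, h2, h3, h4, h5⟩ := h i
  obtain ⟨h1', h2', h3', h4', h5'⟩ := h' k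
  refine ⟨_, (h1.mul h3').sub (h3.mul h1'), ?_⟩
  have e : w i * p' k - p i * w' k = w i * m' k - m i * w' k := by
    rw [h5, h5']; ring
  rw [e]
  exact (h2.mul h4').sub (h4.mul h2')

/-- Every product contains exactly one second-column entry, so the expression stays linear in the
branch `B`. -/
theorem crossEntry_branch_form {B : ℂ → ℂ} {a : ℂ} (i k : Fin 2)
    (hgY : ∃ g : ℂ → ℂ, Differentiable ℂ g ∧ ∀ z ∈ cutᶜ, g z = Y z i 0)
    (hgZ : ∃ g : ℂ → ℂ, Differentiable ℂ g ∧ ∀ z ∈ cutᶜ, g z = Z z k 0)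
    (hY : ∃ h : ℂ → ℂ, AnalyticAt ℂ h a ∧
      (fun z => Y z i 1 - B z * h z) =O[𝓝[cutᶜ] a] fun _ => (1 : ℂ))
    (hZ : ∃ h : ℂ → ℂ, AnalyticAt ℂ h a ∧
      (fun z => Z z k 1 - B z * h z) =O[𝓝[cutᶜ] a] fun _ => (1 : ℂ)) :
    ∃ h : ℂ → ℂ, AnalyticAt ℂ h a ∧
      (fun z => crossEntry Y Z i k z - B z * h z) =O[𝓝[cutᶜ] a] fun _ => (1 : ℂ) := by
  obtain ⟨g, hg, hgY⟩ := hgY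
  obtain ⟨g', hg', hgZ⟩ := hgZ
  obtain ⟨h, hh, hY⟩ := hY
  obtain ⟨h', hh', hZ⟩ := hZ
  refine ⟨fun z => g z * h' z - h z * g' z,
    ((hg.analyticAt a).mul hh').sub (hh.mul (hg'.analyticAt a)), ?_⟩
  have k1 := (continuousAt_isBigO_one (hg.continuous.continuousAt (x := a))).mul hZ
  have k2 := hY.mul (continuousAt_isBigO_one (hg'.continuous.continuousAt (x := a)))
  have k3 := k1.sub k2
  simp only [mul_one] at k3
  refine k3.congr' ?_ EventuallyEq.rfl
  filter_upwards [self_mem_nhdsWithin] with z hz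
  rw [crossEntry, hgY z hz, hgZ z hz]
  ring

theorem tendsto_crossEntry (hY : IsSolution α β n Y) (hZ : IsSolution α β n Z) (i k : Fin 2) :
    Tendsto (crossEntry Y Z i k) (cocompact ℂ)
      (𝓝 ((1 : Matrix (Fin 2) (Fin 2) ℂ) i 0 * (1 : Matrix (Fin 2) (Fin 2) ℂ) k 1
        - (1 : Matrix (Fin 2) (Fin 2) ℂ) i 1 * (1 : Matrix (Fin 2) (Fin 2) ℂ) k 0)) := by
  obtain ⟨E, hE, hYE⟩ := hY.atInfinity
  obtain ⟨E', hE', hZE⟩ := hZ.atInfinity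
  have hinv : Tendsto (fun z : ℂ => z⁻¹) (cocompact ℂ) (𝓝 0) := by
    rw [← Metric.cobounded_eq_cocompact]
    exact tendsto_inv₀_cobounded
  have h1 : ∀ i j, Tendsto (fun z => (1 + E z) i j) (cocompact ℂ)
      (𝓝 ((1 : Matrix (Fin 2) (Fin 2) ℂ) i j)) := fun i j => by
    simpa using ((hE i j).trans_tendsto hinv).const_add ((1 : Matrix (Fin 2) (Fin 2) ℂ) i j)
  have h2 : ∀ i j, Tendsto (fun z => (1 + E' z) i j) (cocompact ℂ)
      (𝓝 ((1 : Matrix (Fin 2) (Fin 2) ℂ) i j)) := fun i j => by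
    simpa using ((hE' i j).trans_tendsto hinv).const_add ((1 : Matrix (Fin 2) (Fin 2) ℂ) i j)
  refine (((h1 i 0).mul (h2 k 1)).sub ((h1 i 1).mul (h2 k 0))).congr' ?_
  filter_upwards [hYE, hZE, eventually_mem_compl_cut] with z hz1 hz2 hz
  have hz0 : z ^ n ≠ 0 := pow_ne_zero _ (ne_zero_of_mem_compl_cut hz)
  rw [crossEntry, hz1, hz2]
  simp only [Matrix.mul_apply, Fin.sum_univ_two]
  simp only [Matrix.of_apply, Matrix.cons_val_zero, Matrix.cons_val_one,
    Matrix.cons_val', Matrix.cons_val_fin_one, mul_zero, add_zero, zero_add]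
  field_simp

/-- Liouville's theorem: without jump and bounded at the end points, the combination extends to an
entire function, which has a finite limit at infinity, where the powers `z^n` and `z^(-n)` cancel.
-/
theorem crossEntry_eq (hα : NotNegInt α) (hβ : NotNegInt β) (hY : IsSolution α β n Y)
    (hZ : IsSolution α β n Z) (i k : Fin 2) {z : ℂ} (hz : z ∈ cutᶜ) :
    crossEntry Y Z i k z
      = (1 : Matrix (Fin 2) (Fin 2) ℂ) i 0 * (1 : Matrix (Fin 2) (Fin 2) ℂ) k 1
        - (1 : Matrix (Fin 2) (Fin 2) ℂ) i 1 * (1 : Matrix (Fin 2) (Fin 2) ℂ) k 0 := by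
  have hj := hasNoJump_crossEntry hY hZ i k
  obtain ⟨h, hh, hb⟩ := crossEntry_branch_form i k (hY.exists_entire i) (hZ.exists_entire k)
    (hY.atZero_right i) (hZ.atZero_right k)
  obtain ⟨h', hh', hb'⟩ := crossEntry_branch_form i k (hY.exists_entire i) (hZ.exists_entire k)
    (hY.atOne_right i) (hZ.atOne_right k)
  obtain ⟨g, hg, hgf⟩ := exists_entire_extension
    (((hY.differentiableOn i 0).mul (hZ.differentiableOn k 1)).sub
      ((hY.differentiableOn i 1).mul (hZ.differentiableOn k 0))) hj
    (isBigO_one_of_branchZero hα hj hh hb) (isBigO_one_of_branchOne hβ hj hh' hb')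
  have hlim : Tendsto g (cocompact ℂ) _ := (tendsto_crossEntry hY hZ i k).congr' (by
    filter_upwards [eventually_mem_compl_cut] with w hw using (hgf w hw).symm)
  rw [← hg.apply_eq_of_tendsto_cocompact z hlim]
  exact (hgf z hz).symm

/-- The Riemann–Hilbert problem has at most one solution. -/
theorem IsSolution.unique (hα : NotNegInt α) (hβ : NotNegInt β) (hY : IsSolution α β n Y)
    (hZ : IsSolution α β n Z) {z : ℂ} (hz : z ∈ cutᶜ) : Y z = Z z := by
  have hdet := crossEntry_eq hα hβ hZ hZ 0 1 hz
  have h0 := fun i => crossEntry_eq hα hβ hY hZ i 0 hz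
  have h1 := fun i => crossEntry_eq hα hβ hY hZ i 1 hz
  -- Cramer's rule: as `det Z = 1`, each row of `Y` is the combination of the rows of `Z` with the
  -- cross entries as coefficients.
  have c0 : ∀ i, Y z i 0 = Z z 0 0 * crossEntry Y Z i 1 z - Z z 1 0 * crossEntry Y Z i 0 z := by
    intro i
    simp only [crossEntry, Matrix.one_apply, Fin.isValue, if_true, one_ne_zero, zero_ne_one,
      if_false, mul_one, mul_zero, sub_zero] at hdet ⊢
    linear_combination -(Y z i 0) * hdet
  have c1 : ∀ i, Y z i 1 = Z z 0 1 * crossEntry Y Z i 1 z - Z z 1 1 * crossEntry Y Z i 0 z := by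
    intro i
    simp only [crossEntry, Matrix.one_apply, Fin.isValue, if_true, one_ne_zero, zero_ne_one,
      if_false, mul_one, mul_zero, sub_zero] at hdet ⊢
    linear_combination -(Y z i 1) * hdet
  ext i j
  match i, j with
  | 0, 0 => rw [c0, h0, h1]; simp
  | 0, 1 => rw [c1, h0, h1]; simp
  | 1, 0 => rw [c0, h0, h1]; simp
  | 1, 1 => rw [c1, h0, h1]; simp

end JacobiRH

end

theorem theorem4p3 (α β : ℂ)
    (hα : ∀ k : ℕ, α ≠ -((k : ℂ) + 1)) (hβ : ∀ k : ℕ, β ≠ -((k : ℂ) + 1))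
    (hαβ : ∀ k : ℕ, α + β ≠ -((k : ℂ) + 2))
    (hα0 : α ≠ 0) (hβ0 : β ≠ 0) (n : ℕ) (hn : 1 ≤ n) :
    JacobiRH.IsSolution α β n (JacobiRH.explicitSolution α β n) ∧
    ∀ Y : ℂ → Matrix (Fin 2) (Fin 2) ℂ, JacobiRH.IsSolution α β n Y →
      ∀ z ∈ JacobiRH.cutᶜ, Y z = JacobiRH.explicitSolution α β n z := by
  exact ⟨JacobiRH.explicitSolution_isSolution hα hβ hαβ hα0 hβ0 n hn, fun Y hY z hz =>
    hY.unique hα hβ (JacobiRH.explicitSolution_isSolution hα hβ hαβ hα0 hβ0 n hn) hz⟩
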